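/- Fix $T\in(0,\infty)$. Let $X=(X_t)_{t\in[0,T]}$ be a real Lévy process on a complete probability space $(\Omega,\mathcal F,\mathbb P)$ (i.e. $X_0\equiv 0$, stationary and independent increments, càdlàg paths) and let $\rho$ be a probability measure on $(\mathbb R,\mathcal B(\mathbb R))$. **Notation.** * For $\varepsilon\ge 0$, $c>0$: $\rho\in U(\varepsilon;c)$ means $\rho([-d,d]\setminus\{0\})\le c\,d^{\varepsilon}$ for all $d\in[0,1]$ (with $0^0:=1$). For $\beta\in(0,\infty]$ and a closed non-empty $A\subseteq\mathbb R$: $X\in\mathcal U(\beta,A;c)$ means $\|\mathbb P_{z+X_s}-\mathbb P_{X_s}\|_{\rm TV}\le c|z|s^{-1/\beta}$ for all $z\in A$, $s\in(0,T]$, where $1/\infty:=0$ and $\|\mu\|_{\rm TV}=|\mu|(\mathbb R)$. * $X\subseteq L_p$ means $\mathbb E|X_t|^p<\infty$ for all $t\in[0,T]$ (no condition if $p=0$). * For $\eta\in[0,1]$, $C^\eta$ is the space of Borel functions $f:\mathbb R\to\mathbb R$ with $|f|_\eta:=\sup_{x<y}\frac{|f(x)-f(y)|}{|x-y|^\eta}<\infty$.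 For $\eta\in(0,1)$, $q\in[1,\infty]$, $C^{\eta,q}:=(C_b^0(\mathbb R),C^1_0)_{\eta,q}$ is the real interpolation space, where $C_b^0(\mathbb R)$ consists of the bounded continuous functions vanishing at $0$ with the supremum norm and $C^1_0$ of the Lipschitz functions vanishing at $0$ with the norm $|\cdot|_1$; its norm is $\|f\|_{C^{\eta,q}}=\|v\mapsto v^{-\eta}K(v,f)\|_{L_q((0,\infty),dv/v)}$ with $K(v,f)=\inf\{\|f_0\|_\infty+v|f_1|_1: f=f_0+f_1,\ f_0\in C_b^0(\mathbb R),\ f_1\in C^1_0\}$. * $\mathcal D_X$ is the set of Borel functions $f$ with $\mathbb E|f(x+X_s)|<\infty$ for all $(s,x)\in[0,T]\times\mathbb R$, and $F(t,x):=\mathbb E f(x+X_{T-t})$ for $f\in\mathcal D_X$. ${\rm Dom}(\Gamma^0_\rho)$ is the set of $f\in\mathcal D_X$ such that $$\mathbb E\int_{\mathbb R\setminus\{0\}}\Big|\frac{F(s,x+X_\delta+z)-F(s,x+X_\delta)}{z}\Big|\rho(dz)<\infty\quad\text{for all } 0\le\delta\le s<T,\ x\in\mathbb R.$$ For such $f$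 and $t\in[0,T)$ let $D_\rho F(t,x):=\int_{\mathbb R\setminus\{0\}}\frac{F(t,x+z)-F(t,x)}{z}\rho(dz)$ and $\langle f,\Gamma^0_{t,\rho}\rangle:=D_\rho F(t,0)$. If $C^\eta\subseteq {\rm Dom}(\Gamma^0_\rho)$, then $\|\Gamma^0_{t,\rho}\|_{(C^\eta)^*}$ is the infimum of all $c>0$ with $|\langle f,\Gamma^0_{t,\rho}\rangle|\le c|f|_\eta$ for all $f\in C^\eta$. * $\|G\|_{\mathbb B^{\alpha}_{b,q}}:=\big\|t\mapsto (T-t)^{\alpha}\sup_{x\in\mathbb R}|G(t,x)|\big\|_{L_q([0,T),\frac{dt}{T-t})}$ for $G:[0,T)\times\mathbb R\to\mathbb R$. * $\mathcal I^\alpha_tK:=\frac{\alpha}{T^\alpha}\int_0^T(T-u)^{\alpha-1}K_{u\wedge t}\,du$ for $\alpha>0$ and càdlàg $K:[0,T)\to\mathbb R$. With $(\mathcal F_t)_{t\in[0,T]}$ the augmented natural filtration of $X$, $\|Y\|_{{\rm BMO}_2([0,T))}$ is the infimum of all $c\ge0$ such that $\mathbb E[|Y_t-Y_{\tau-}|^2\,|\,\mathcal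 F_\tau]\le c^2$ a.s. for all $t\in[0,T)$ and all stopping times $\tau:\Omega\to[0,t]$, where $Y_{0-}:=Y_0$. **Theorem.** Let $\eta\in[0,1]$, $(\varepsilon,\beta)\in[0,\infty)\times(0,\infty]$, $c,c'>0$, $\rho\in U(\varepsilon;c)$, $X\in\mathcal U(\beta,\operatorname{supp}\rho;c')$, and $\alpha:=\frac{1-(\varepsilon+\eta)}{\beta}$. 1. If $X\subseteq L_\eta$, then $C^\eta\subseteq{\rm Dom}(\Gamma^0_\rho)$ and there is a $C>0$, depending at most on $(\varepsilon,\beta,\eta,c',T)$, such that for all $t\in[0,T)$ $$\|\Gamma^0_{t,\rho}\|_{(C^\eta)^*}\le C\,(1\vee c)\begin{cases}(T-t)^{-\alpha}&:\ \eta\in[0,1-\varepsilon)\\ \ln\big(1+(T-t)^{-\frac{1-\eta}{\beta}}\big)&:\ \eta=1-\varepsilon<1\\ 1&:\ \eta\in(1-\varepsilon,1)\cup\{1\}.\end{cases}$$ 2. If $\varepsilon\in[0,1)$, $\eta\in(0,1-\varepsilon)$, $q\in[1,\infty)$, $\beta\in(0,\infty)$ and $X\subseteq L_{\eta+\gamma}$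 for some $\gamma>0$, then there is a $C>0$, depending at most on $(\varepsilon,\beta,\eta,\gamma,q,c',T)$, such that for all $f\in C^{\eta,q}$ one has $f\in{\rm Dom}(\Gamma^0_\rho)$ and $$\|D_\rho F\|_{\mathbb B^\alpha_{b,q}}\le C\,(1\vee c)\,\|f\|_{C^{\eta,q}}.$$ 3. If $\varepsilon\in[0,1)$, $\eta\in(0,1-\varepsilon)$, $\beta\in(0,\infty)$ and $X\subseteq L_{\eta+\gamma}$ for some $\gamma>0$, then there is a $C>0$, depending at most on $(\varepsilon,\beta,\eta,\gamma,c',T)$, such that for all $f\in C^{\eta,2}$ the process $(D_\rho F(t,X_t))_{t\in[0,T)}$ has a càdlàg version, and every càdlàg version $\varphi$ of it satisfies $$\sup_{a\in[0,T)}(T-a)^\alpha\|\varphi_a\|_{L_\infty}+\big\|\mathcal I^\alpha\varphi-\varphi_0\big\|_{{\rm BMO}_2([0,T))}\le C\,(1\vee c)\,\|f\|_{C^{\eta,2}}.$$ -/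

import Mathlib

open MeasureTheory ProbabilityTheory Set Filter Topology
open scoped ENNReal NNReal

noncomputable section

namespace LevyGradient

/-- `g` is right-continuous with left limits on the interval `I`. -/
def IsCadlagOn (I : Set ℝ) (g : ℝ → ℝ) : Prop :=
  ∀ t ∈ I, ContinuousWithinAt g (I ∩ Ici t) t ∧ ∃ l : ℝ, Tendsto g (𝓝[I ∩ Iio t] t) (𝓝 l)

/-- `(X_t)_{t ∈ [0,T]}` is a real Lévy process under `P`; only the values `X t` with
`t ∈ [0,T]` matter. -/
structure IsLevyProcess {Ω : Type*} [MeasurableSpace Ω] (T : ℝ) (X : ℝ → Ω → ℝ)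
    (P : Measure Ω) : Prop where
  measurable : ∀ t ∈ Icc 0 T, Measurable (X t)
  zero : ∀ ω, X 0 ω = 0
  indep : HasIndepIncrements (fun t : Icc (0 : ℝ) T => X t) P
  stationary : ∀ s t, 0 ≤ s → s ≤ t → t ≤ T →
    P.map (fun ω => X t ω - X s ω) = P.map (X (t - s))
  cadlag : ∀ ω, IsCadlagOn (Icc 0 T) (fun t => X t ω)

/-- `(X_t)_{t ∈ [0,T]} ⊆ L_p`; for `p = 0` this is measurability only. -/
def SubsetLp {Ω : Type*} [MeasurableSpace Ω] (T p : ℝ) (X : ℝ → Ω → ℝ) (P : Measure Ω) : Prop :=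
  ∀ t ∈ Icc 0 T, MemLp (X t) (ENNReal.ofReal p) P

/-- The total variation norm `‖μ - ν‖_TV = |μ - ν|(ℝ)`. -/
def tvDist (μ ν : Measure ℝ) [IsFiniteMeasure μ] [IsFiniteMeasure ν] : ℝ≥0∞ :=
  (μ.toSignedMeasure - ν.toSignedMeasure).totalVariation univ

/-- `1 / β` for `β ∈ (0,∞]`, with `1 / ∞ = 0`. -/
def recip (β : ℝ≥0∞) : ℝ := (β⁻¹).toReal

/-- The small ball property `ρ ∈ U(ε; c)`. -/
def SmallBall (ε c : ℝ) (ρ : Measure ℝ) : Prop :=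
  ∀ d ∈ Icc (0 : ℝ) 1, ρ (Icc (-d) d \ {0}) ≤ ENNReal.ofReal (c * d ^ ε)

/-- The total variation property `X ∈ 𝒰(β, A; c)`. -/
def TVBound {Ω : Type*} [MeasurableSpace Ω] (T : ℝ) (β : ℝ≥0∞) (A : Set ℝ) (c : ℝ)
    (X : ℝ → Ω → ℝ) (P : Measure Ω) [IsFiniteMeasure P] : Prop :=
  ∀ z ∈ A, ∀ s ∈ Ioc 0 T,
    tvDist (P.map (fun ω => z + X s ω)) (P.map (X s)) ≤
      ENNReal.ofReal (c * |z| * s ^ (-recip β))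

/-- `‖g‖_{B_b(ℝ)} = sup_x |g x| ∈ [0,∞]`. -/
def supNorm (g : ℝ → ℝ) : ℝ≥0∞ := ⨆ x, ‖g x‖ₑ

/-- The Hölder seminorm `|f|_η = sup_{x<y} |f x - f y| / |x - y|^η ∈ [0,∞]`. -/
def holderSeminorm (η : ℝ) (f : ℝ → ℝ) : ℝ≥0∞ :=
  ⨆ (x : ℝ) (y : ℝ) (_ : x < y), ENNReal.ofReal (|f x - f y| / |x - y| ^ η)

/-- The Hölder space `C^η`. -/
def holderSpace (η : ℝ) : Set (ℝ → ℝ) := {f | Measurable f ∧ holderSeminorm η f < ⊤}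

/-- The Hölder functions in `C^η` vanishing at zero. -/
def holderSpaceZero (η : ℝ) : Set (ℝ → ℝ) := {f | f ∈ holderSpace η ∧ f 0 = 0}

/-- Bounded continuous functions vanishing at zero. -/
def boundedContZero : Set (ℝ → ℝ) := {g | Continuous g ∧ supNorm g < ⊤ ∧ g 0 = 0}

/-- The `K`-functional of the couple (bounded continuous functions vanishing at zero with the
supremum norm, Lipschitz functions vanishing at zero with the Lipschitz norm); it is `∞` if `f`
is not in the sum of the two spaces. -/
def kFunctional (v : ℝ) (f : ℝ → ℝ) : ℝ≥0∞ :=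
  ⨅ (g : ℝ → ℝ) (h : ℝ → ℝ) (_ : g ∈ boundedContZero) (_ : h ∈ holderSpaceZero 1)
    (_ : f = g + h), supNorm g + ENNReal.ofReal v * holderSeminorm 1 h

/-- The norm of the real interpolation space `C^{η,q}` of the above couple, that is
`‖v ↦ v^{-η} K(v,f)‖_{L_q((0,∞), dv/v)}`, with value `∞` outside of the space. -/
def interpNorm (η : ℝ) (q : ℝ≥0∞) (f : ℝ → ℝ) : ℝ≥0∞ :=
  eLpNorm (fun v : ℝ => ENNReal.ofReal (v ^ (-η)) * kFunctional v f) q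
    ((volume.restrict (Ioi (0 : ℝ))).withDensity (fun v => ENNReal.ofReal (1 / v)))

/-- The Hölder space `C^{η,q}` as a real interpolation space. -/
def interpSpace (η : ℝ) (q : ℝ≥0∞) : Set (ℝ → ℝ) := {f | interpNorm η q f < ⊤}

section Gradient

variable {Ω : Type*} [MeasurableSpace Ω]

/-- The class `𝒟_X` of Borel functions with `E|f(x + X_s)| < ∞` for `(s,x) ∈ [0,T] × ℝ`. -/
def classD (T : ℝ) (X : ℝ → Ω → ℝ) (P : Measure Ω) : Set (ℝ → ℝ) :=
  {f | Measurable f ∧ ∀ s ∈ Icc 0 T, ∀ x : ℝ, Integrable (fun ω => f (x + X s ω)) P}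

/-- `F(t,x) = E f(x + X_{T-t})`. -/
def valueFun (T : ℝ) (X : ℝ → Ω → ℝ) (P : Measure Ω) (f : ℝ → ℝ) (t x : ℝ) : ℝ :=
  ∫ ω, f (x + X (T - t) ω) ∂P

/-- `D_ρ F(t,x) = ∫_{ℝ∖{0}} (F(t,x+z) - F(t,x)) / z ρ(dz)`. -/
def gradient (T : ℝ) (X : ℝ → Ω → ℝ) (P : Measure Ω) (ρ : Measure ℝ) (f : ℝ → ℝ)
    (t x : ℝ) : ℝ :=
  ∫ z in ({0}ᶜ : Set ℝ), (valueFun T X P f t (x + z) - valueFun T X P f t x) / z ∂ρ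

/-- The domain `Dom(Γ⁰_ρ)`. Since `X_0 = 0`, the case `δ = 0` says that the integral defining
`D_ρ F(s,x)` converges absolutely for all `(s,x) ∈ [0,T) × ℝ`. -/
def domGamma (T : ℝ) (X : ℝ → Ω → ℝ) (P : Measure Ω) (ρ : Measure ℝ) : Set (ℝ → ℝ) :=
  {f | f ∈ classD T X P ∧ ∀ s ∈ Ico 0 T, ∀ δ ∈ Icc 0 s, ∀ x : ℝ,
    ∫⁻ ω, ∫⁻ z in ({0}ᶜ : Set ℝ),
      ‖(valueFun T X P f s (x + X δ ω + z) - valueFun T X P f s (x + X δ ω)) / z‖ₑ ∂ρ ∂P < ⊤}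

/-- The functional `f ↦ ⟨f, Γ⁰_{t,ρ}⟩ = D_ρ F(t,0)`. -/
def gammaFun (T : ℝ) (X : ℝ → Ω → ℝ) (P : Measure Ω) (ρ : Measure ℝ) (t : ℝ)
    (f : ℝ → ℝ) : ℝ :=
  gradient T X P ρ f t 0

/-- `‖Γ⁰_{t,ρ}‖_{(C^η)^*}`: the infimum of all `c > 0` with `|⟨f, Γ⁰_{t,ρ}⟩| ≤ c |f|_η` on `C^η`
(`∞` if there is no such `c`). -/
def gammaDualNorm (T : ℝ) (X : ℝ → Ω → ℝ) (P : Measure Ω) (ρ : Measure ℝ) (η t : ℝ) : ℝ≥0∞ :=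
  ⨅ (c : ℝ≥0) (_ : 0 < c)
    (_ : ∀ f ∈ holderSpace η, ‖gammaFun T X P ρ t f‖ₑ ≤ c * holderSeminorm η f), (c : ℝ≥0∞)

end Gradient

/-- The size in `s = T - t` of `‖Γ⁰_{t,ρ}‖_{(C^η)^*}`. -/
def gammaRate (ε η : ℝ) (β : ℝ≥0∞) (s : ℝ) : ℝ :=
  if η < 1 - ε then s ^ (-((1 - (ε + η)) * recip β))
  else if η = 1 - ε ∧ η < 1 then Real.log (1 + s ^ (-((1 - η) * recip β)))
  else 1

/-- `‖G‖_{𝔹^α_{b,q}} = ‖t ↦ (T-t)^α ‖G(t,·)‖_{B_b(ℝ)}‖_{L_q([0,T), dt/(T-t))}`. -/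
def besovNorm (T α : ℝ) (q : ℝ≥0∞) (G : ℝ → ℝ → ℝ) : ℝ≥0∞ :=
  eLpNorm (fun t : ℝ => ENNReal.ofReal ((T - t) ^ α) * supNorm (G t)) q
    ((volume.restrict (Ico 0 T)).withDensity (fun t => ENNReal.ofReal (1 / (T - t))))

/-- The Riemann-Liouville type operator
`I^α_t K = α / T^α ∫_0^T (T-u)^{α-1} K_{u ∧ t} du` for `α > 0`. -/
def riemannLiouville (T α : ℝ) (K : ℝ → ℝ) (t : ℝ) : ℝ :=
  α / T ^ α * ∫ u in Ioo 0 T, (T - u) ^ (α - 1) * K (min u t)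

section Paths

variable {Ω : Type*} [m : MeasurableSpace Ω]

/-- The natural filtration of `(X_t)_{t ∈ [0,T]}`, augmented by all null sets. -/
def augmentedFiltration (T : ℝ) (X : ℝ → Ω → ℝ) (P : Measure Ω) [P.IsComplete]
    (hX : ∀ t ∈ Icc 0 T, Measurable (X t)) : Filtration ℝ m where
  seq t := (⨆ s ∈ Icc 0 (min t T), MeasurableSpace.comap (X s) inferInstance) ⊔
    MeasurableSpace.generateFrom {N | P N = 0}
  mono' s t hst := by
    refine sup_le_sup_right (iSup₂_le fun r hr => ?_) _
    exact le_iSup₂_of_le r ⟨hr.1, hr.2.trans (min_le_min_right T hst)⟩ le_rfl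
  le' t := by
    refine sup_le (iSup₂_le fun s hs => ?_) (MeasurableSpace.generateFrom_le fun N hN => ?_)
    · exact (hX s ⟨hs.1, hs.2.trans (min_le_right _ _)⟩).comap_le
    · exact measurableSet_of_null hN

/-- `K_{t-}`, with the convention `K_{0-} = K_0`. -/
def leftValue (K : ℝ → ℝ) (t : ℝ) : ℝ := if t ≤ 0 then K 0 else Function.leftLim K t

/-- `‖Y‖_{BMO_2([0,T))}`: the infimum of all `c ≥ 0` such that, for all `t ∈ [0,T)` and all
stopping times `τ : Ω → [0,t]`, `E[|Y_t - Y_{τ-}|² | 𝓕_τ] ≤ c²` a.s. (`∞` if there is none). -/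
def bmoNorm (T : ℝ) (𝓕 : Filtration ℝ m) (P : Measure Ω) (Y : ℝ → Ω → ℝ) : ℝ≥0∞ :=
  ⨅ (c : ℝ≥0) (_ : ∀ t ∈ Ico 0 T, ∀ τ : Ω → ℝ, (∀ ω, τ ω ∈ Icc 0 t) →
      ∀ hτ : IsStoppingTime 𝓕 (fun ω => (τ ω : WithTop ℝ)),
        ∀ᵐ ω ∂P, condLExp hτ.measurableSpace P
          (fun ω' => ‖Y t ω' - leftValue (fun u => Y u ω') (τ ω')‖ₑ ^ 2) ω ≤ (c : ℝ≥0∞) ^ 2),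
    (c : ℝ≥0∞)

/-- `φ` is a càdlàg version of `(G(t, X_t))_{t ∈ [0,T)}`. -/
def IsCadlagVersion (T : ℝ) (X : ℝ → Ω → ℝ) (P : Measure Ω) (G : ℝ → ℝ → ℝ)
    (φ : ℝ → Ω → ℝ) : Prop :=
  (∀ t ∈ Ico 0 T, φ t =ᵐ[P] fun ω => G t (X t ω)) ∧
    ∀ ω, IsCadlagOn (Ico 0 T) (fun t => φ t ω)

end Paths

end LevyGradient

end

noncomputable section

namespace LevyGradient

/-! ### Total variation -/

/-! Put a = (T-t)^{1/β}. For f = g + k with g bounded and k Lipschitz, the total variation bound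
controls the g-part of F(t,x+z) - F(t,x) by c'(|z|/a)‖g‖, and the k-part is at most |z| |k|_1. Hence
the difference is at most (c'+1)(|z|/a)K(a,f) (`enorm_valueFun_sub_le_of_tvBound`). It is also at
most 2K(v,f) whenever |z| ≤ v. With the first bound for |z| ≤ a, the second on dyadic shells |z| ~
a2^k, and the small ball property, one gets, uniformly in x, |D_ρF(t,x)| ≲ (1∨c) Σ_k (a2^k)^{ε-1}
K(a2^k,f) (`absGradient_le_dyadicSum`).

On C^η one has K(v,f) ≤ 2v^η|f|_η, and for η < 1-ε the sum is geometric. For η ≥ 1-ε the difference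
quotients are instead bounded by a multiple of min(|z|^{η-1}, a^{η-1}), which is integrated over the
shells between a and 1 (`setLIntegral_min_rpow_le`): equal contributions give the logarithm,
decaying ones a constant.

On C^{η,q} the substitution v = 2^k a turns each term of the weighted dyadic sum into the
interpolation norm, because dv/v is invariant under dilation. The weights left over are geometric,
and Hölder's inequality sums them (`eLpNorm_weighted_dyadic_le`).

For the process, independent stationary increments give D_ρF(u,x) = E D_ρF(v,x+X_{v-u}). So M_t =
D_ρF(t,X_t) has increments orthogonal to the past, and κ(t) = sup_x|D_ρF(t,x)| is nondecreasing. The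
square of ∫(T-u)^{α-1}(M_{u∧t}-M_{u∧τ∧t})du, integrated over a set of F_τ, is a double time
integral. Orthogonality replaces the later time by the earlier one, and what remains is a multiple
of ∫(T-u)^{2α-1}κ(u)²du (`BoundedMartingale.lintegral_sq_le`), which is the squared weighted norm
with q = 2. The jump at τ is of order (T-τ)^α κ(τ), bounded by the first estimate. -/

theorem add_negPart_eq_add_posPart (μ ν : Measure ℝ) [IsFiniteMeasure μ] [IsFiniteMeasure ν] :
    μ + (μ.toSignedMeasure - ν.toSignedMeasure).toJordanDecomposition.negPart =
      ν + (μ.toSignedMeasure - ν.toSignedMeasure).toJordanDecomposition.posPart := by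
  have h := SignedMeasure.toSignedMeasure_toJordanDecomposition
    (μ.toSignedMeasure - ν.toSignedMeasure)
  set J := (μ.toSignedMeasure - ν.toSignedMeasure).toJordanDecomposition
  rw [JordanDecomposition.toSignedMeasure, sub_eq_sub_iff_add_eq_add] at h
  rw [← Measure.toSignedMeasure_eq_toSignedMeasure_iff, Measure.toSignedMeasure_add,
    Measure.toSignedMeasure_add, ← h, add_comm]

/-- By the preceding identity, the difference equals that of the integrals over the two Jordan
parts, whose masses add up to the total variation. -/
theorem enorm_integral_sub_integral_le {μ ν : Measure ℝ} [IsFiniteMeasure μ] [IsFiniteMeasure ν]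
    {g : ℝ → ℝ} (hg : Measurable g) (hA : supNorm g < ⊤) :
    ‖∫ x, g x ∂μ - ∫ x, g x ∂ν‖ₑ ≤ supNorm g * tvDist μ ν := by
  have hJ := add_negPart_eq_add_posPart μ ν
  have hle : ∀ x, ‖g x‖ₑ ≤ supNorm g := fun x => le_iSup (fun x => ‖g x‖ₑ) x
  have hint : ∀ (κ : Measure ℝ) [IsFiniteMeasure κ], Integrable g κ := fun κ _ => by
    refine ⟨hg.aestronglyMeasurable, ?_⟩
    refine (lintegral_mono hle).trans_lt ?_
    rw [lintegral_const]
    exact ENNReal.mul_lt_top hA (measure_lt_top _ _)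
  unfold tvDist SignedMeasure.totalVariation
  set J := (μ.toSignedMeasure - ν.toSignedMeasure).toJordanDecomposition
  have h1 := congrArg (fun κ => ∫ x, g x ∂κ) hJ
  simp only [integral_add_measure (hint _) (hint _)] at h1
  have h2 : ∫ x, g x ∂μ - ∫ x, g x ∂ν = ∫ x, g x ∂J.posPart - ∫ x, g x ∂J.negPart := by
    linarith
  rw [h2, Measure.add_apply, mul_add]
  have h3 : ∀ κ : Measure ℝ, ‖∫ x, g x ∂κ‖ₑ ≤ supNorm g * κ univ := fun κ => by
    refine (enorm_integral_le_lintegral_enorm _).trans ((lintegral_mono hle).trans ?_)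
    rw [lintegral_const]
  exact (enorm_sub_le).trans (add_le_add (h3 _) (h3 _))

/-! ### Hölder functions and the measurable `K`-functional -/

theorem abs_sub_le_holderSeminorm {η : ℝ} {f : ℝ → ℝ} (hf : holderSeminorm η f < ⊤)
    (x y : ℝ) : |f x - f y| ≤ (holderSeminorm η f).toReal * |x - y| ^ η := by
  have key : ∀ x y : ℝ, x < y → |f x - f y| ≤ (holderSeminorm η f).toReal * |x - y| ^ η := by
    intro x y hxy
    have hpos : 0 < |x - y| ^ η := Real.rpow_pos_of_pos (abs_pos.2 (sub_ne_zero.2 hxy.ne)) _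
    have h : ENNReal.ofReal (|f x - f y| / |x - y| ^ η) ≤ holderSeminorm η f :=
      le_iSup_of_le x (le_iSup_of_le y (le_iSup_of_le hxy le_rfl))
    rw [ENNReal.ofReal_le_iff_le_toReal hf.ne] at h
    rwa [div_le_iff₀ hpos] at h
  rcases lt_trichotomy x y with h | h | h
  · exact key x y h
  · subst h; simp only [sub_self, abs_zero]; positivity
  · rw [abs_sub_comm, abs_sub_comm x]; exact key y x h

theorem holderSeminorm_le {η L : ℝ} {f : ℝ → ℝ}
    (h : ∀ x y, |f x - f y| ≤ L * |x - y| ^ η) : holderSeminorm η f ≤ ENNReal.ofReal L := by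
  refine iSup_le fun x => iSup_le fun y => iSup_le fun hxy => ENNReal.ofReal_le_ofReal ?_
  have hpos : 0 < |x - y| ^ η := Real.rpow_pos_of_pos (abs_pos.2 (sub_ne_zero.2 hxy.ne)) _
  rw [div_le_iff₀ hpos]
  exact h x y

/-- Approximation of a Hölder function by its inf-convolution with a multiple of the modulus. -/
theorem exists_lipschitz_approx {η L v : ℝ} {f : ℝ → ℝ} (h0 : 0 ≤ η) (h1 : η ≤ 1) (hL : 0 ≤ L)
    (hv : 0 < v) (hf : ∀ x y, |f x - f y| ≤ L * |x - y| ^ η) :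
    ∃ h : ℝ → ℝ, (∀ x y, |h x - h y| ≤ L * v ^ (η - 1) * |x - y|) ∧
      ∀ x, |f x - h x| ≤ L * v ^ η := by
  set M := L * v ^ (η - 1) with hM
  have hM0 : 0 ≤ M := by positivity
  -- For r ≤ v the constant term suffices; for r ≥ v the linear term does, since r^(η-1) ≤ v^(η-1).
  have key : ∀ r, 0 ≤ r → r ^ η ≤ v ^ η + v ^ (η - 1) * r := by
    intro r hr
    rcases le_total r v with h | h
    · have := Real.rpow_le_rpow hr h h0
      have : 0 ≤ v ^ (η - 1) * r := by positivity
      linarith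
    · have hr' : 0 < r := hv.trans_le h
      have e : r ^ η = r ^ (η - 1) * r := by
        rw [Real.rpow_sub_one hr'.ne']; field_simp
      have := Real.rpow_le_rpow_of_nonpos hv h (by linarith : η - 1 ≤ 0)
      have : 0 ≤ v ^ η := by positivity
      nlinarith
  have lower : ∀ x y, f x - L * v ^ η ≤ f y + M * |x - y| := by
    intro x y
    have a := (le_abs_self _).trans (hf x y)
    have b := mul_le_mul_of_nonneg_left (key |x - y| (abs_nonneg _)) hL
    rw [hM]; nlinarith
  have bdd : ∀ x, BddBelow (range fun y => f y + M * |x - y|) := fun x =>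
    ⟨f x - L * v ^ η, by rintro _ ⟨y, rfl⟩; exact lower x y⟩
  have lip : ∀ x y, (⨅ w, f w + M * |x - w|) ≤ (⨅ w, f w + M * |y - w|) + M * |x - y| := by
    intro x y
    rw [← sub_le_iff_le_add]
    refine le_ciInf fun w => ?_
    rw [sub_le_iff_le_add]
    refine (ciInf_le (bdd x) w).trans ?_
    have := mul_le_mul_of_nonneg_left (abs_sub_le x y w) hM0
    linarith
  refine ⟨fun x => ⨅ w, f w + M * |x - w|, fun x y => ?_, fun x => ?_⟩
  · rw [abs_sub_le_iff]
    have a := lip x y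
    have b := lip y x
    rw [abs_sub_comm y x] at b
    constructor <;> linarith
  · have a : (⨅ w, f w + M * |x - w|) ≤ f x := by
      simpa using ciInf_le (bdd x) x
    have b : f x - L * v ^ η ≤ ⨅ w, f w + M * |x - w| := le_ciInf fun w => lower x w
    rw [abs_of_nonneg (by linarith)]
    linarith

/-- The `K`-functional of bounded measurable and Lipschitz functions, without normalization. -/
def kMeas (v : ℝ) (f : ℝ → ℝ) : ℝ≥0∞ :=
  ⨅ (g : ℝ → ℝ) (h : ℝ → ℝ) (_ : Measurable g) (_ : supNorm g < ⊤) (_ : holderSeminorm 1 h < ⊤)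
    (_ : f = g + h), supNorm g + ENNReal.ofReal v * holderSeminorm 1 h

theorem continuous_of_holderSeminorm_lt_top {η : ℝ} (hη : 0 < η) {f : ℝ → ℝ}
    (hf : holderSeminorm η f < ⊤) : Continuous f := by
  rw [continuous_iff_continuousAt]
  intro x
  rw [ContinuousAt, tendsto_iff_dist_tendsto_zero]
  have hb := abs_sub_le_holderSeminorm hf
  refine squeeze_zero (fun _ => dist_nonneg) (fun y => (Real.dist_eq _ _).trans_le (hb y x)) ?_
  have : Continuous fun y : ℝ => (holderSeminorm η f).toReal * |y - x| ^ η := by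
    refine continuous_const.mul (Continuous.rpow_const (by fun_prop) fun _ => Or.inr hη.le)
  simpa [Real.zero_rpow hη.ne'] using this.tendsto x

theorem supNorm_le_ofReal {g : ℝ → ℝ} {A : ℝ} (h : ∀ x, |g x| ≤ A) :
    supNorm g ≤ ENNReal.ofReal A :=
  iSup_le fun x => by
    rw [← ofReal_norm, Real.norm_eq_abs]
    exact ENNReal.ofReal_le_ofReal (h x)

theorem kMeas_le_kFunctional (v : ℝ) (f : ℝ → ℝ) : kMeas v f ≤ kFunctional v f := by
  refine le_iInf fun g => le_iInf fun h => le_iInf fun hg => le_iInf fun hh => le_iInf fun e => ?_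
  exact iInf_le_of_le g (iInf_le_of_le h (iInf_le_of_le hg.1.measurable (iInf_le_of_le hg.2.1
    (iInf_le_of_le hh.1.2 (iInf_le_of_le e le_rfl)))))

theorem kFunctional_mono (f : ℝ → ℝ) : Monotone fun v => kFunctional v f := by
  intro v w hvw
  unfold kFunctional
  dsimp only
  gcongr

/-- For η = 0 the function need not be continuous, so what remains after subtracting the
inf-convolution is only measurable. This is why the bounded part in `kMeas` is merely measurable. -/
theorem kMeas_le_of_holder {η v : ℝ} {f : ℝ → ℝ} (h0 : 0 ≤ η) (h1 : η ≤ 1) (hv : 0 < v)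
    (hfm : Measurable f) (hf : holderSeminorm η f < ⊤) :
    kMeas v f ≤ ENNReal.ofReal (2 * v ^ η) * holderSeminorm η f := by
  obtain ⟨h, hh, hfh⟩ := exists_lipschitz_approx h0 h1 ENNReal.toReal_nonneg hv
    (abs_sub_le_holderSeminorm hf)
  set L := (holderSeminorm η f).toReal
  have hlip : holderSeminorm 1 h ≤ ENNReal.ofReal (L * v ^ (η - 1)) :=
    holderSeminorm_le fun x y => by simpa using hh x y
  have hlip' := hlip.trans_lt ENNReal.ofReal_lt_top
  have hsup : supNorm (fun x => f x - h x) ≤ ENNReal.ofReal (L * v ^ η) := supNorm_le_ofReal hfh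
  have hhm := (continuous_of_holderSeminorm_lt_top one_pos hlip').measurable
  have e : f = (fun x => f x - h x) + h := by ext; simp
  have hK : kMeas v f ≤
      supNorm (fun x => f x - h x) + ENNReal.ofReal v * holderSeminorm 1 h :=
    iInf₂_le_of_le _ h (iInf₂_le_of_le (hfm.sub hhm) (hsup.trans_lt ENNReal.ofReal_lt_top)
      (iInf₂_le hlip' e))
  refine hK.trans ?_
  refine (add_le_add hsup (mul_le_mul_right hlip _)).trans (le_of_eq ?_)
  rw [← ENNReal.ofReal_mul hv.le, ← ENNReal.ofReal_add (by positivity) (by positivity)]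
  conv_rhs => rw [← ENNReal.ofReal_toReal hf.ne, ← ENNReal.ofReal_mul (by positivity)]
  congr 1
  rw [Real.rpow_sub_one hv.ne']
  field_simp
  ring

/-- A bound that holds for all decompositions holds for the measurable `K`-functional. -/
theorem le_mul_kMeas {f : ℝ → ℝ} {v : ℝ} {B A : ℝ≥0∞} (hA : A ≠ 0) (hA' : A ≠ ⊤)
    (h : ∀ g k : ℝ → ℝ, Measurable g → supNorm g < ⊤ → holderSeminorm 1 k < ⊤ → f = g + k →
      B ≤ A * (supNorm g + ENNReal.ofReal v * holderSeminorm 1 k)) : B ≤ A * kMeas v f := by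
  rw [mul_comm, ← ENNReal.div_le_iff hA hA']
  refine le_iInf fun g => le_iInf fun k => le_iInf fun hg => le_iInf fun hg' => le_iInf fun hk =>
    le_iInf fun e => ?_
  rw [ENNReal.div_le_iff hA hA', mul_comm]
  exact h g k hg hg' hk e

theorem enorm_sub_le_holderSeminorm_one {h : ℝ → ℝ} (hh : holderSeminorm 1 h < ⊤) (x y : ℝ) :
    ‖h x - h y‖ₑ ≤ ENNReal.ofReal |x - y| * holderSeminorm 1 h := by
  rw [← ofReal_norm, Real.norm_eq_abs, ← ENNReal.ofReal_toReal hh.ne,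
    ← ENNReal.ofReal_mul (abs_nonneg _), mul_comm |x - y|]
  refine ENNReal.ofReal_le_ofReal ?_
  simpa using abs_sub_le_holderSeminorm hh x y

theorem enorm_le_supNorm (g : ℝ → ℝ) (x : ℝ) : ‖g x‖ₑ ≤ supNorm g := le_iSup (fun x => ‖g x‖ₑ) x

/-- In any splitting the bounded part varies by at most twice its supremum, the Lipschitz part by at
most v times its constant. -/
theorem enorm_sub_le_kMeas (f : ℝ → ℝ) {x y v : ℝ} (h : |x - y| ≤ v) :
    ‖f x - f y‖ₑ ≤ 2 * kMeas v f := by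
  refine le_mul_kMeas two_ne_zero ENNReal.ofNat_ne_top fun g k _ _ hk e => ?_
  subst e
  have e' : (g + k) x - (g + k) y = (g x - g y) + (k x - k y) := by simp; ring
  rw [e']
  calc ‖(g x - g y) + (k x - k y)‖ₑ ≤ ‖g x - g y‖ₑ + ‖k x - k y‖ₑ := enorm_add_le _ _
    _ ≤ (supNorm g + supNorm g) + ENNReal.ofReal v * holderSeminorm 1 k := by
        refine add_le_add (enorm_sub_le.trans (add_le_add (enorm_le_supNorm _ _)
          (enorm_le_supNorm _ _))) ((enorm_sub_le_holderSeminorm_one hk x y).trans ?_)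
        gcongr
    _ ≤ _ := by rw [mul_add, two_mul, two_mul]; gcongr; exact le_self_add

/-! ### Bounding the gradient by the `K`-functional on dyadic scales -/

section Estimates

variable {Ω : Type*} [MeasurableSpace Ω] {P : Measure Ω} {X : ℝ → Ω → ℝ} {T : ℝ}
  {f : ℝ → ℝ}

/-- The integral of the modulus of the difference quotients. -/
def absGradient (T : ℝ) (X : ℝ → Ω → ℝ) (P : Measure Ω) (ρ : Measure ℝ) (f : ℝ → ℝ)
    (t x : ℝ) : ℝ≥0∞ :=
  ∫⁻ z in ({0}ᶜ : Set ℝ), ‖(valueFun T X P f t (x + z) - valueFun T X P f t x) / z‖ₑ ∂ρ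

theorem enorm_gradient_le_absGradient (ρ : Measure ℝ) (t x : ℝ) :
    ‖gradient T X P ρ f t x‖ₑ ≤ absGradient T X P ρ f t x :=
  enorm_integral_le_lintegral_enorm _

variable [IsProbabilityMeasure P]

theorem recip_nonneg (β : ℝ≥0∞) : 0 ≤ recip β := ENNReal.toReal_nonneg

theorem recip_pos {β : ℝ≥0∞} (h0 : 0 < β) (h : β ≠ ⊤) : 0 < recip β :=
  ENNReal.toReal_pos (ENNReal.inv_ne_zero.2 h) (ENNReal.inv_ne_top.2 h0.ne')

theorem sub_mem_Icc_of_mem_Ico {t : ℝ} (ht : t ∈ Ico 0 T) : T - t ∈ Icc 0 T :=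
  ⟨by linarith [ht.2], by linarith [ht.1]⟩

theorem enorm_integral_le_of_forall_enorm_le {g : Ω → ℝ} {B : ℝ≥0∞} (h : ∀ ω, ‖g ω‖ₑ ≤ B) :
    ‖∫ ω, g ω ∂P‖ₑ ≤ B := by
  refine (enorm_integral_le_lintegral_enorm _).trans ((lintegral_mono h).trans ?_)
  simp

/-- The gain of smoothness through the total variation bound. -/
theorem enorm_valueFun_sub_le_of_tvBound {β : ℝ≥0∞} {A : Set ℝ} {c' : ℝ} (hc' : 0 < c')
    (hX : ∀ s ∈ Icc 0 T, Measurable (X s)) (hf : f ∈ classD T X P) (hTV : TVBound T β A c' X P)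
    {z : ℝ} (hz : z ∈ A) (hz0 : z ≠ 0) {t : ℝ} (ht : t ∈ Ico 0 T) (x : ℝ) :
    ‖valueFun T X P f t (x + z) - valueFun T X P f t x‖ₑ ≤
      ENNReal.ofReal ((c' + 1) * |z| / (T - t) ^ recip β) *
        kMeas ((T - t) ^ recip β) f := by
  have hs : T - t ∈ Ioc 0 T := ⟨by linarith [ht.2], by linarith [ht.1]⟩
  have hs' : T - t ∈ Icc 0 T := sub_mem_Icc_of_mem_Ico ht
  have hXm := hX _ hs'
  have ha : 0 < (T - t) ^ recip β := Real.rpow_pos_of_pos hs.1 _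
  have hz' : 0 < |z| := abs_pos.2 hz0
  refine le_mul_kMeas (by simpa using by positivity) ENNReal.ofReal_ne_top
    fun g k hg hg' hk e => ?_
  have hgi : ∀ y, Integrable (fun ω => g (y + X (T - t) ω)) P := fun y => by
    refine ⟨(hg.comp (measurable_const.add hXm)).aestronglyMeasurable, ?_⟩
    refine (lintegral_mono fun ω => enorm_le_supNorm g _).trans_lt ?_
    simpa using hg'
  -- The Lipschitz part is unbounded; its integrability is inherited from k = f - g.
  have hki : ∀ y, Integrable (fun ω => k (y + X (T - t) ω)) P := fun y => by
    have := (hf.2 _ hs' y).sub (hgi y)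
    refine this.congr (.of_forall fun ω => ?_)
    simp [e]
  have hsplit : ∀ y, valueFun T X P f t y =
      ∫ ω, g (y + X (T - t) ω) ∂P + ∫ ω, k (y + X (T - t) ω) ∂P := fun y => by
    rw [← integral_add (hgi y) (hki y), valueFun]
    simp [e]
  have e1 : valueFun T X P f t (x + z) - valueFun T X P f t x =
      (∫ ω, g (x + z + X (T - t) ω) ∂P - ∫ ω, g (x + X (T - t) ω) ∂P) +
        ∫ ω, (k (x + z + X (T - t) ω) - k (x + X (T - t) ω)) ∂P := by
    rw [hsplit, hsplit, integral_sub (hki _) (hki _)]; ring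
  -- The shift by z is moved from g to the law of X_{T-t}, so no regularity of g is needed.
  have h1 : ‖∫ ω, g (x + z + X (T - t) ω) ∂P - ∫ ω, g (x + X (T - t) ω) ∂P‖ₑ ≤
      ENNReal.ofReal (c' * |z| / (T - t) ^ recip β) * supNorm g := by
    have hgx : Measurable fun y => g (x + y) := hg.comp (measurable_const.add measurable_id)
    have hsx : supNorm (fun y => g (x + y)) ≤ supNorm g :=
      iSup_le fun y => enorm_le_supNorm g (x + y)
    have := enorm_integral_sub_integral_le (μ := P.map fun ω => z + X (T - t) ω)
      (ν := P.map (X (T - t))) hgx (hsx.trans_lt hg')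
    rw [integral_map (φ := fun ω => z + X (T - t) ω) (hXm.const_add z).aemeasurable hgx.aestronglyMeasurable,
      integral_map hXm.aemeasurable hgx.aestronglyMeasurable] at this
    simp only [← add_assoc] at this
    refine this.trans ((mul_le_mul' hsx (hTV z hz _ hs)).trans (le_of_eq ?_))
    rw [mul_comm, Real.rpow_neg hs.1.le, div_eq_mul_inv]
  have h2 : ‖∫ ω, (k (x + z + X (T - t) ω) - k (x + X (T - t) ω)) ∂P‖ₑ ≤
      ENNReal.ofReal |z| * holderSeminorm 1 k := by
    refine enorm_integral_le_of_forall_enorm_le fun ω =>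
      (enorm_sub_le_holderSeminorm_one hk _ _).trans (le_of_eq ?_)
    congr 3; ring
  rw [e1]
  refine (enorm_add_le _ _).trans ((add_le_add h1 h2).trans ?_)
  -- The Lipschitz part is rewritten as |z| |k|_1 = (|z|/a)·(a|k|_1), so that c'+1 serves both
  -- parts.
  rw [mul_add, ← mul_assoc, ← ENNReal.ofReal_mul (by positivity)]
  gcongr
  · linarith
  · rw [div_mul_cancel₀ _ ha.ne']
    nlinarith

theorem enorm_valueFun_sub_le_kMeas (hf : f ∈ classD T X P) {t : ℝ} (ht : t ∈ Ico 0 T)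
    {x y v : ℝ} (h : |x - y| ≤ v) :
    ‖valueFun T X P f t x - valueFun T X P f t y‖ₑ ≤ 2 * kMeas v f := by
  have hs' : T - t ∈ Icc 0 T := sub_mem_Icc_of_mem_Ico ht
  rw [valueFun, valueFun, ← integral_sub (hf.2 _ hs' x) (hf.2 _ hs' y)]
  exact enorm_integral_le_of_forall_enorm_le fun ω => enorm_sub_le_kMeas f (by simpa using h)

/-- For d ≥ 1 the total mass 1 is below the right-hand side once c is replaced by max 1 c. This is
the origin of the factor 1 ∨ c. -/
theorem SmallBall.measure_le {ε c d : ℝ} {ρ : Measure ℝ} [IsProbabilityMeasure ρ]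
    (hρ : SmallBall ε c ρ) (hε : 0 ≤ ε) (hd : 0 < d) :
    ρ (Icc (-d) d \ {0}) ≤ ENNReal.ofReal (max 1 c * d ^ ε) := by
  rcases le_total d 1 with h | h
  · refine (hρ d ⟨hd.le, h⟩).trans (ENNReal.ofReal_le_ofReal ?_)
    gcongr
    exact le_max_right _ _
  · refine prob_le_one.trans ?_
    rw [ENNReal.one_le_ofReal]
    have := Real.one_le_rpow h hε
    nlinarith [le_max_left 1 c]

theorem enorm_div_le_of_enorm_le {w z : ℝ} (hz : z ≠ 0) {B : ℝ} {K : ℝ≥0∞}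
    (h : ‖w‖ₑ ≤ ENNReal.ofReal B * K) : ‖w / z‖ₑ ≤ ENNReal.ofReal (B / |z|) * K := by
  have : ‖w / z‖ₑ = ENNReal.ofReal |z|⁻¹ * ‖w‖ₑ := by
    rw [div_eq_inv_mul, enorm_mul, ← ofReal_norm (z⁻¹), Real.norm_eq_abs, abs_inv]
  rw [this, div_eq_inv_mul, ENNReal.ofReal_mul (by positivity), mul_assoc]
  gcongr

/-- The sum over dyadic scales that controls the gradient. -/
def dyadicSum (ε a : ℝ) (f : ℝ → ℝ) : ℝ≥0∞ :=
  ∑' k : ℕ, ENNReal.ofReal ((a * 2 ^ k) ^ (ε - 1)) * kMeas (a * 2 ^ k) f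

/-- Smoothing through the law pays off only for |z| ≤ a; beyond that the plain oscillation bound is
better. Each z is charged to one ball of radius a2^k, whose mass is at most max 1 c · (a2^k)^ε. -/
theorem absGradient_le_dyadicSum {ε c c' : ℝ} {β : ℝ≥0∞} {ρ : Measure ℝ}
    [IsProbabilityMeasure ρ] (hε : 0 ≤ ε) (hc' : 0 < c')
    (hX : ∀ s ∈ Icc 0 T, Measurable (X s)) (hf : f ∈ classD T X P)
    (hρ : SmallBall ε c ρ) (hTV : TVBound T β ρ.support c' X P) {t : ℝ} (ht : t ∈ Ico 0 T)
    (x : ℝ) :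
    absGradient T X P ρ f t x ≤
      ENNReal.ofReal ((c' + 4) * max 1 c) * dyadicSum ε ((T - t) ^ recip β) f := by
  set a := (T - t) ^ recip β with ha_def
  have ha : 0 < a := Real.rpow_pos_of_pos (by linarith [ht.2]) _
  set B : ℕ → Set ℝ := fun k => Icc (-(a * 2 ^ k)) (a * 2 ^ k) \ {0} with hB
  have hBm : ∀ k, MeasurableSet (B k) := fun k => measurableSet_Icc.diff (measurableSet_singleton 0)
  set C : ℕ → ℝ≥0∞ := fun k => ENNReal.ofReal ((c' + 4) / (a * 2 ^ k)) * kMeas (a * 2 ^ k) f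
  have hmem : ∀ (z : ℝ) k, z ≠ 0 → |z| ≤ a * 2 ^ k → z ∈ B k := fun z k hz h =>
    ⟨⟨by linarith [neg_abs_le z], (le_abs_self z).trans h⟩, hz⟩
  have key : ∀ z ∈ ρ.support, z ≠ 0 →
      ‖(valueFun T X P f t (x + z) - valueFun T X P f t x) / z‖ₑ ≤
        ∑' k, (B k).indicator (fun _ => C k) z := by
    intro z hz hz0
    have hz' : 0 < |z| := abs_pos.2 hz0
    rcases le_or_gt |z| a with h | h
    · refine le_trans ?_ (ENNReal.le_tsum 0)
      rw [indicator_of_mem (hmem z 0 hz0 (by simpa using h))]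
      refine (enorm_div_le_of_enorm_le hz0
        (enorm_valueFun_sub_le_of_tvBound hc' hX hf hTV hz hz0 ht x)).trans ?_
      simp only [C, pow_zero, mul_one]
      rw [← ha_def, div_div, mul_comm a, ← div_div, mul_div_cancel_right₀ _ hz'.ne']
      gcongr
      linarith
    -- On a2^n ≤ |z| < a2^(n+1) the ball of index n+1 contains z, and 2/|z| ≤ 4/(a2^(n+1)); hence
    -- the constant 4.
    · obtain ⟨n, hn1, hn2⟩ := exists_nat_pow_near (x := |z| / a) (y := 2)
        ((one_le_div ha).2 h.le) one_lt_two
      rw [le_div_iff₀' ha] at hn1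
      rw [div_lt_iff₀' ha] at hn2
      refine le_trans ?_ (ENNReal.le_tsum (n + 1))
      rw [indicator_of_mem (hmem z _ hz0 hn2.le)]
      have h2 := enorm_valueFun_sub_le_kMeas hf ht (x := x + z) (y := x) (v := a * 2 ^ (n + 1))
        (by simpa using hn2.le)
      rw [← ENNReal.ofReal_ofNat 2] at h2
      refine (enorm_div_le_of_enorm_le hz0 h2).trans ?_
      simp only [C]
      gcongr ENNReal.ofReal ?_ * _
      rw [div_le_div_iff₀ hz' (by positivity), pow_succ]
      nlinarith
  -- The total variation bound is known only on the support, which carries all the mass of ρ.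
  have hae : ∀ᵐ z ∂(ρ.restrict {0}ᶜ),
      ‖(valueFun T X P f t (x + z) - valueFun T X P f t x) / z‖ₑ ≤
        ∑' k, (B k).indicator (fun _ => C k) z := by
    rw [ae_restrict_iff' (measurableSet_singleton 0).compl]
    filter_upwards [ρ.support_mem_ae] with z hz hz0 using key z hz hz0
  refine (lintegral_mono_ae hae).trans ((setLIntegral_le_lintegral _ _).trans ?_)
  rw [lintegral_tsum fun k => (measurable_const.indicator (hBm k)).aemeasurable, dyadicSum,
    ← ENNReal.tsum_mul_left]
  refine ENNReal.tsum_le_tsum fun k => ?_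
  have hd : 0 < a * 2 ^ k := by positivity
  rw [lintegral_indicator (hBm k), setLIntegral_const]
  refine (mul_le_mul_right (hρ.measure_le hε hd) _).trans (le_of_eq ?_)
  simp only [C]
  rw [mul_right_comm, ← mul_assoc, ← ENNReal.ofReal_mul (by positivity),
    ← ENNReal.ofReal_mul (by positivity), Real.rpow_sub_one hd.ne']
  congr 2
  ring

end Estimates

/-! ### The bound on the Hölder space -/

/-- Inserting K(v,f) ≤ 2v^η|f|_η makes the sum geometric with ratio 2^(ε+η-1) < 1. -/
theorem dyadicSum_le_of_holder {ε η a : ℝ} {f : ℝ → ℝ} (h0 : 0 ≤ η) (h1 : η ≤ 1) (ha : 0 < a)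
    (hεη : η < 1 - ε) (hfm : Measurable f) (hf : holderSeminorm η f < ⊤) :
    dyadicSum ε a f ≤
      ENNReal.ofReal (2 * (1 - (2 : ℝ) ^ (ε + η - 1))⁻¹ * a ^ (-(1 - (ε + η)))) *
        holderSeminorm η f := by
  set q : ℝ := (2 : ℝ) ^ (ε + η - 1) with hq
  have hq0 : 0 ≤ q := by positivity
  have hq1 : q < 1 := Real.rpow_lt_one_of_one_lt_of_neg one_lt_two (by linarith)
  calc dyadicSum ε a f ≤
      ∑' k : ℕ, ENNReal.ofReal (2 * a ^ (-(1 - (ε + η))) * q ^ k) * holderSeminorm η f := by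
        refine ENNReal.tsum_le_tsum fun k => ?_
        have hd : 0 < a * 2 ^ k := by positivity
        refine (mul_le_mul_right (kMeas_le_of_holder h0 h1 hd hfm hf) _).trans (le_of_eq ?_)
        rw [← mul_assoc, ← ENNReal.ofReal_mul (by positivity)]
        congr 2
        rw [mul_left_comm, ← Real.rpow_add hd, Real.mul_rpow ha.le (by positivity),
          ← Real.rpow_natCast q, hq, ← Real.rpow_mul two_pos.le, ← Real.rpow_natCast 2,
          ← Real.rpow_mul two_pos.le, ← mul_assoc]
        congr 2
        · congr 1; ring
        · ring
    _ = _ := by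
        rw [ENNReal.tsum_mul_right, ← ENNReal.ofReal_tsum_of_nonneg (fun k => by positivity)
          ((summable_geometric_of_lt_one hq0 hq1).mul_left _), tsum_mul_left,
          tsum_geometric_of_lt_one hq0 hq1]
        congr 2; ring

/-- The region |z| ≥ 1 contributes at most 1. The shell 2^(-k-1) < |z| ≤ 2^(-k) with k < J
contributes at most 2·2^(k(1-η)) times the mass max 1 c · 2^(-kε). On the remaining ball of radius
2^(-J) ≤ a the cap a^(η-1) is used, with contribution at most max 1 c. -/
theorem setLIntegral_min_rpow_le {ε η a c : ℝ} {ρ : Measure ℝ} [IsProbabilityMeasure ρ]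
    (hε : 0 ≤ ε) (h0 : 0 ≤ η) (h1 : η ≤ 1) (hεη : 1 - ε ≤ η) (ha : 0 < a) (hρ : SmallBall ε c ρ) {J : ℕ}
    (hJ : 1 ≤ a * 2 ^ J) :
    ∫⁻ z in ({0}ᶜ : Set ℝ), ENNReal.ofReal (min (|z| ^ (η - 1)) (a ^ (η - 1))) ∂ρ ≤
      ENNReal.ofReal (max 1 c * (2 + 2 * ∑ k ∈ Finset.range J, ((2 : ℝ) ^ (1 - η - ε)) ^ k)) := by
  set q : ℝ := (2 : ℝ) ^ (1 - η - ε) with hq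
  have hq0 : 0 ≤ q := by positivity
  have hq1 : q ≤ 1 := Real.rpow_le_one_of_one_le_of_nonpos one_le_two (by linarith)
  set B : ℕ → Set ℝ := fun k => Icc (-((1 / 2) ^ k)) ((1 / 2) ^ k) \ {0} with hB
  have hBm : ∀ k, MeasurableSet (B k) := fun k => measurableSet_Icc.diff (measurableSet_singleton 0)
  have hmem : ∀ (z : ℝ) k, z ≠ 0 → |z| ≤ (1 / 2) ^ k → z ∈ B k := fun z k hz h =>
    ⟨⟨by linarith [neg_abs_le z], (le_abs_self z).trans h⟩, hz⟩
  have hmeas : ∀ k, ρ (B k) ≤ ENNReal.ofReal (max 1 c * ((1 / 2 : ℝ) ^ k) ^ ε) := fun k =>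
    hρ.measure_le hε (by positivity)
  have hM : 1 ≤ max 1 c := le_max_left _ _
  set D : ℕ → ℝ := fun k => 2 * ((2 : ℝ) ^ (1 - η)) ^ k
  have key : ∀ z ∈ ({0}ᶜ : Set ℝ), ENNReal.ofReal (min (|z| ^ (η - 1)) (a ^ (η - 1))) ≤
      (1 + ∑ k ∈ Finset.range J, (B k).indicator (fun _ => ENNReal.ofReal (D k)) z) +
        (B J).indicator (fun _ => ENNReal.ofReal (a ^ (η - 1))) z := by
    intro z hz
    have hz0 : z ≠ 0 := hz
    have hz' : 0 < |z| := abs_pos.2 hz0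
    rcases le_or_gt 1 |z| with h | h
    · refine le_add_right (le_add_right ?_)
      rw [← ENNReal.ofReal_one]
      exact ENNReal.ofReal_le_ofReal ((min_le_left _ _).trans
        (Real.rpow_le_one_of_one_le_of_nonpos h (by linarith)))
    · obtain ⟨n, hn1, hn2⟩ := exists_nat_pow_near (x := 1 / |z|) (y := 2)
        ((one_le_div hz').2 h.le) one_lt_two
      have hzn : |z| ≤ (1 / 2) ^ n := by
        rw [le_div_iff₀ hz'] at hn1
        rw [one_div, inv_pow, ← one_div, le_div_iff₀ (by positivity)]
        linarith
      rcases lt_or_ge n J with hn | hn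
      · refine le_add_right (le_add_left ?_)
        refine le_trans ?_ (Finset.single_le_sum (f := fun k =>
          (B k).indicator (fun _ => ENNReal.ofReal (D k)) z) (fun _ _ => zero_le)
          (Finset.mem_range.2 hn))
        rw [indicator_of_mem (hmem z n hz0 hzn)]
        refine ENNReal.ofReal_le_ofReal ((min_le_left _ _).trans ?_)
        have e : |z| ^ (η - 1) = (1 / |z|) ^ (1 - η) := by
          rw [one_div, Real.inv_rpow hz'.le, ← Real.rpow_neg hz'.le]; congr 1; ring
        rw [e]
        refine (Real.rpow_le_rpow (by positivity) hn2.le (by linarith)).trans ?_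
        rw [pow_succ, Real.mul_rpow (by positivity) two_pos.le, ← Real.rpow_natCast 2,
          ← Real.rpow_mul two_pos.le, mul_comm (n : ℝ), Real.rpow_mul two_pos.le,
          Real.rpow_natCast, mul_comm]
        refine mul_le_mul_of_nonneg_right ?_ (by positivity)
        exact (Real.rpow_le_rpow_of_exponent_le one_le_two (by linarith)).trans_eq
          (Real.rpow_one 2)
      · refine le_add_left ?_
        rw [indicator_of_mem (hmem z J hz0 (hzn.trans
          (pow_le_pow_of_le_one (by norm_num) (by norm_num) hn)))]
        exact ENNReal.ofReal_le_ofReal (min_le_right _ _)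
  refine (setLIntegral_mono' (measurableSet_singleton 0).compl key).trans
    ((setLIntegral_le_lintegral _ _).trans ?_)
  have hind : ∀ k (d : ℝ), Measurable ((B k).indicator fun _ => ENNReal.ofReal d) := fun k d =>
    measurable_const.indicator (hBm k)
  rw [lintegral_add_right _ (hind _ _), lintegral_add_left measurable_const,
    lintegral_finsetSum _ fun k _ => hind _ _, lintegral_indicator (hBm J), setLIntegral_const,
    lintegral_const, measure_univ, mul_one]
  have hterm : ∀ k, ∫⁻ z, (B k).indicator (fun _ => ENNReal.ofReal (D k)) z ∂ρ ≤
      ENNReal.ofReal (max 1 c * (2 * q ^ k)) := fun k => by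
    rw [lintegral_indicator (hBm k), setLIntegral_const]
    refine (mul_le_mul_right (hmeas k) _).trans (le_of_eq ?_)
    rw [← ENNReal.ofReal_mul (by positivity)]
    congr 1
    have : q ^ k = ((2 : ℝ) ^ (1 - η)) ^ k * ((1 / 2 : ℝ) ^ k) ^ ε := by
      rw [← Real.rpow_natCast (1 / 2), ← Real.rpow_mul (by norm_num), mul_comm (k : ℝ),
        Real.rpow_mul (by norm_num), Real.rpow_natCast, ← mul_pow, hq, Real.rpow_sub two_pos,
        one_div, Real.inv_rpow two_pos.le, div_eq_mul_inv]
    rw [this]; ring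
  have hlast : ENNReal.ofReal (a ^ (η - 1)) * ρ (B J) ≤ ENNReal.ofReal (max 1 c) := by
    refine (mul_le_mul_right (hmeas J) _).trans ?_
    rw [← ENNReal.ofReal_mul (by positivity)]
    refine ENNReal.ofReal_le_ofReal ?_
    -- The cap is weakened from a to 2^(-J); combined with the mass, the exponent η - 1 + ε is then
    -- nonnegative.
    have hJ' : (1 / 2 : ℝ) ^ J ≤ a := by
      rw [one_div, inv_pow, ← one_div, div_le_iff₀ (by positivity)]; exact hJ
    have hp : 0 < (1 / 2 : ℝ) ^ J := by positivity
    have e1 : a ^ (η - 1) ≤ ((1 / 2 : ℝ) ^ J) ^ (η - 1) :=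
      Real.rpow_le_rpow_of_nonpos hp hJ' (by linarith)
    have e2 : ((1 / 2 : ℝ) ^ J) ^ (η - 1) * ((1 / 2 : ℝ) ^ J) ^ ε ≤ 1 := by
      rw [← Real.rpow_add hp]
      exact Real.rpow_le_one hp.le (pow_le_one₀ (by norm_num) (by norm_num)) (by linarith)
    calc a ^ (η - 1) * (max 1 c * ((1 / 2) ^ J) ^ ε)
        ≤ ((1 / 2 : ℝ) ^ J) ^ (η - 1) * (max 1 c * ((1 / 2) ^ J) ^ ε) := by gcongr
      _ = max 1 c * (((1 / 2 : ℝ) ^ J) ^ (η - 1) * ((1 / 2) ^ J) ^ ε) := by ring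
      _ ≤ max 1 c := mul_le_of_le_one_right (by linarith) e2
  refine (add_le_add (add_le_add_right (Finset.sum_le_sum fun k _ => hterm k) _) hlast).trans ?_
  rw [← ENNReal.ofReal_one, ← ENNReal.ofReal_sum_of_nonneg (fun k _ => by positivity),
    ← ENNReal.ofReal_add zero_le_one (Finset.sum_nonneg fun k _ => by positivity),
    ← ENNReal.ofReal_add (add_nonneg zero_le_one (Finset.sum_nonneg fun k _ => by positivity))
      (by linarith)]
  refine ENNReal.ofReal_le_ofReal ?_
  rw [← Finset.mul_sum, ← Finset.mul_sum]
  nlinarith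

/-- J counts the dyadic scales between s^r and 1, hence is of order log(s^(-r)). Additive constants
are absorbed because the logarithm on the right is at least m > 0 on (0,T]. -/
theorem exists_ceil_logb_le {T θ r : ℝ} (hT : 0 < T) (hθ : 0 < θ) (hr : 0 ≤ r) :
    ∃ C : ℝ, 0 < C ∧ ∀ s ∈ Ioc 0 T, ∃ J : ℕ, 1 ≤ s ^ r * 2 ^ J ∧
      2 + 2 * (J : ℝ) ≤ C * Real.log (1 + s ^ (-(θ * r))) := by
  set m := Real.log (1 + T ^ (-(θ * r))) with hm
  have hm0 : 0 < m := Real.log_pos (by linarith [Real.rpow_pos_of_pos hT (-(θ * r))])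
  have hl2 := Real.log_pos one_lt_two
  refine ⟨4 / m + 2 / (θ * Real.log 2), by positivity, fun s hs => ?_⟩
  have hs0 : 0 < s := hs.1
  set y := s ^ (-r) with hy
  have hy0 : 0 < y := Real.rpow_pos_of_pos hs0 _
  have hyθ : s ^ (-(θ * r)) = y ^ θ := by
    rw [hy, ← Real.rpow_mul hs0.le]; congr 1; ring
  have hsy : s ^ r * y = 1 := by rw [hy, ← Real.rpow_add hs0]; simp
  have hlog1 : m ≤ Real.log (1 + s ^ (-(θ * r))) := by
    have := Real.rpow_pos_of_pos hT (-(θ * r))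
    refine Real.log_le_log (by linarith) (by
      gcongr 1 + ?_
      exact Real.rpow_le_rpow_of_nonpos hs0 hs.2 (by nlinarith))
  have hlog2 : θ * Real.log y ≤ Real.log (1 + s ^ (-(θ * r))) := by
    rw [hyθ, ← Real.log_rpow hy0]
    exact Real.log_le_log (Real.rpow_pos_of_pos hy0 _) (by linarith)
  refine ⟨⌈Real.logb 2 y⌉₊, ?_, ?_⟩
  · have h1 : y ≤ (2 : ℝ) ^ ⌈Real.logb 2 y⌉₊ := by
      rw [← Real.rpow_natCast, ← Real.logb_le_iff_le_rpow one_lt_two hy0]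
      exact Nat.le_ceil _
    have : 0 < s ^ r := Real.rpow_pos_of_pos hs0 _
    nlinarith
  · set l := Real.log (1 + s ^ (-(θ * r)))
    have hl0 : 0 < l := hm0.trans_le hlog1
    have h4 : 4 ≤ 4 / m * l := by
      rw [div_mul_eq_mul_div, le_div_iff₀ hm0]; nlinarith
    have hc : (⌈Real.logb 2 y⌉₊ : ℝ) ≤ l / (θ * Real.log 2) + 1 := by
      rcases le_total (Real.logb 2 y) 0 with h | h
      · rw [Nat.ceil_eq_zero.2 h, Nat.cast_zero]; positivity
      · refine (Nat.ceil_lt_add_one h).le.trans ?_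
        gcongr
        rw [Real.logb, div_le_div_iff₀ hl2 (by positivity)]
        nlinarith
    calc 2 + 2 * (⌈Real.logb 2 y⌉₊ : ℝ) ≤ 4 + 2 / (θ * Real.log 2) * l := by
          have : 2 / (θ * Real.log 2) * l = 2 * (l / (θ * Real.log 2)) := by ring
          linarith
      _ ≤ _ := by rw [add_mul]; linarith

section HolderBound

universe u

theorem mem_classD_of_holder {Ω : Type*} [MeasurableSpace Ω] {P : Measure Ω}
    [IsProbabilityMeasure P] {X : ℝ → Ω → ℝ} {T η : ℝ} {f : ℝ → ℝ} (h0 : 0 ≤ η)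
    (hX : ∀ s ∈ Icc 0 T, Measurable (X s)) (hL : SubsetLp T η X P) (hf : f ∈ holderSpace η) :
    f ∈ classD T X P := by
  refine ⟨hf.1, fun s hs x => ?_⟩
  have hint : Integrable (fun ω => |X s ω| ^ η) P := by
    rcases h0.eq_or_lt with rfl | h
    · simp
    · have := (hL s hs).integrable_norm_rpow (by simpa using h) ENNReal.ofReal_ne_top
      simpa [ENNReal.toReal_ofReal h0] using this
  refine Integrable.mono' ((integrable_const |f x|).add (hint.const_mul (holderSeminorm η f).toReal))
    (hf.1.comp (measurable_const.add (hX s hs))).aestronglyMeasurable (.of_forall fun ω => ?_)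
  have := abs_sub_le_holderSeminorm hf.2 (x + X s ω) x
  rw [add_sub_cancel_left] at this
  rw [Real.norm_eq_abs]
  calc |f (x + X s ω)| = |f x + (f (x + X s ω) - f x)| := by congr 1; ring
    _ ≤ _ := (abs_add_le _ _).trans (add_le_add_right this _)

/-- The oscillation bound at scale |z| gives 4|z|^(η-1) and the total variation bound at scale a
gives 2(c'+1)a^(η-1); the constant 2(c'+2) dominates both. -/
theorem enorm_diffQuot_le_of_holder {Ω : Type*} [MeasurableSpace Ω] {P : Measure Ω}
    [IsProbabilityMeasure P] {X : ℝ → Ω → ℝ} {T η c' : ℝ} {f : ℝ → ℝ} {β : ℝ≥0∞} {A : Set ℝ}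
    (h0 : 0 ≤ η) (h1 : η ≤ 1) (hc' : 0 < c') (hX : ∀ s ∈ Icc 0 T, Measurable (X s))
    (hf : f ∈ holderSpace η) (hfD : f ∈ classD T X P) (hTV : TVBound T β A c' X P) {z : ℝ}
    (hz : z ∈ A) (hz0 : z ≠ 0) {t : ℝ} (ht : t ∈ Ico 0 T) (x : ℝ) :
    ‖(valueFun T X P f t (x + z) - valueFun T X P f t x) / z‖ₑ ≤
      ENNReal.ofReal (2 * (c' + 2)) * holderSeminorm η f *
        ENNReal.ofReal (min (|z| ^ (η - 1)) (((T - t) ^ recip β) ^ (η - 1))) := by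
  have ha : 0 < (T - t) ^ recip β := Real.rpow_pos_of_pos (by linarith [ht.2]) _
  set a := (T - t) ^ recip β with ha_def
  have hz' : 0 < |z| := abs_pos.2 hz0
  have e1 : ‖valueFun T X P f t (x + z) - valueFun T X P f t x‖ₑ ≤
      ENNReal.ofReal ((c' + 1) * |z| / a * (2 * a ^ η)) * holderSeminorm η f := by
    refine (enorm_valueFun_sub_le_of_tvBound hc' hX hfD hTV hz hz0 ht x).trans ?_
    refine (mul_le_mul_right (kMeas_le_of_holder h0 h1 ha hf.1 hf.2) _).trans (le_of_eq ?_)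
    rw [← mul_assoc, ← ENNReal.ofReal_mul (by positivity)]
  have e2 : ‖valueFun T X P f t (x + z) - valueFun T X P f t x‖ₑ ≤
      ENNReal.ofReal (2 * (2 * |z| ^ η)) * holderSeminorm η f := by
    refine (enorm_valueFun_sub_le_kMeas hfD ht (v := |z|) (by simp)).trans ?_
    refine (mul_le_mul_right (kMeas_le_of_holder h0 h1 hz' hf.1 hf.2) _).trans (le_of_eq ?_)
    rw [← mul_assoc, ENNReal.ofReal_mul (q := 2 * |z| ^ η) two_pos.le, ENNReal.ofReal_ofNat]
  rw [mul_right_comm, ← ENNReal.ofReal_mul (by positivity)]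
  rcases le_total (|z| ^ (η - 1)) (a ^ (η - 1)) with h | h
  · rw [min_eq_left h]
    refine (enorm_div_le_of_enorm_le hz0 e2).trans ?_
    gcongr
    rw [Real.rpow_sub_one hz'.ne', mul_div_assoc, mul_div_assoc, ← mul_assoc]
    gcongr
    linarith
  · rw [min_eq_right h]
    refine (enorm_div_le_of_enorm_le hz0 e1).trans ?_
    gcongr
    rw [Real.rpow_sub_one ha.ne']
    have := Real.rpow_pos_of_pos ha η
    have e : (c' + 1) * |z| / a * (2 * a ^ η) / |z| = 2 * (c' + 1) * (a ^ η / a) := by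
      field_simp
    rw [e]
    gcongr
    linarith

theorem absGradient_le_of_diffQuot_le {Ω : Type*} [MeasurableSpace Ω] {P : Measure Ω}
    {X : ℝ → Ω → ℝ} {T t x : ℝ} {f : ℝ → ℝ} {ρ : Measure ℝ} {M : ℝ≥0∞} (hM : M ≠ ⊤)
    {w : ℝ → ℝ≥0∞} (h : ∀ z ∈ ρ.support, z ≠ 0 →
      ‖(valueFun T X P f t (x + z) - valueFun T X P f t x) / z‖ₑ ≤ M * w z) :
    absGradient T X P ρ f t x ≤ M * ∫⁻ z in ({0}ᶜ : Set ℝ), w z ∂ρ := by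
  rw [← lintegral_const_mul' _ _ hM]
  refine lintegral_mono_ae ?_
  rw [ae_restrict_iff' (measurableSet_singleton 0).compl]
  filter_upwards [ρ.support_mem_ae] with z hz hz0 using h z hz hz0

/-- The uniform bound for the gradient on the Hölder space. -/
theorem exists_absGradient_le_gammaRate {T ε η c' : ℝ} {β : ℝ≥0∞} (hT : 0 < T) (hε : 0 ≤ ε)
    (h0 : 0 ≤ η) (h1 : η ≤ 1) (hc' : 0 < c') :
    ∃ C : ℝ, 0 < C ∧ (∀ s ∈ Ioc 0 T, 0 < gammaRate ε η β s) ∧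
      ∀ (Ω : Type u) [MeasurableSpace Ω] (P : Measure Ω) [IsProbabilityMeasure P]
        (X : ℝ → Ω → ℝ) (ρ : Measure ℝ) [IsProbabilityMeasure ρ] (c : ℝ),
        (∀ s ∈ Icc 0 T, Measurable (X s)) → SmallBall ε c ρ → TVBound T β ρ.support c' X P →
        ∀ f ∈ holderSpace η, f ∈ classD T X P → ∀ t ∈ Ico 0 T, ∀ x,
          absGradient T X P ρ f t x ≤
            ENNReal.ofReal (C * max 1 c * gammaRate ε η β (T - t)) * holderSeminorm η f := by
  have hT' : ∀ t ∈ Ico 0 T, T - t ∈ Ioc 0 T := fun t ht => ⟨by linarith [ht.2], by linarith [ht.1]⟩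
  rcases lt_or_ge η (1 - ε) with hlt | hge
  · set q := (2 : ℝ) ^ (ε + η - 1) with hq
    have hq1 : q < 1 := Real.rpow_lt_one_of_one_lt_of_neg one_lt_two (by linarith)
    have hq2 : 0 < 1 - q := sub_pos.2 hq1
    refine ⟨(c' + 4) * (2 * (1 - q)⁻¹), by positivity, fun s hs => ?_, ?_⟩
    · rw [gammaRate, if_pos hlt]; exact Real.rpow_pos_of_pos hs.1 _
    · intro Ω _ P _ X ρ _ c hX hρ hTV f hf hfD t ht x
      have hs := (hT' t ht).1
      refine (absGradient_le_dyadicSum hε hc' hX hfD hρ hTV ht x).trans ?_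
      refine (mul_le_mul_right (dyadicSum_le_of_holder h0 h1 (Real.rpow_pos_of_pos hs _) hlt
        hf.1 hf.2) _).trans (le_of_eq ?_)
      rw [← mul_assoc, ← ENNReal.ofReal_mul (by positivity), gammaRate, if_pos hlt,
        ← Real.rpow_mul hs.le]
      congr 2
      rw [mul_neg, mul_comm (recip β)]
      ring
  -- The geometric majorant of the dyadic sum now diverges, so the minimum of the two quotient
  -- bounds is integrated instead.
  · obtain ⟨C, hC, hrate, hCb⟩ : ∃ C : ℝ, 0 < C ∧ (∀ s ∈ Ioc 0 T, 0 < gammaRate ε η β s) ∧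
        ∀ (ρ : Measure ℝ) [IsProbabilityMeasure ρ] (c : ℝ), SmallBall ε c ρ → ∀ s ∈ Ioc 0 T,
          ∫⁻ z in ({0}ᶜ : Set ℝ),
            ENNReal.ofReal (min (|z| ^ (η - 1)) ((s ^ recip β) ^ (η - 1))) ∂ρ ≤
              ENNReal.ofReal (C * max 1 c * gammaRate ε η β s) := by
      have hnl : ¬ η < 1 - ε := not_lt.2 hge
      -- For η = 1 the integrand is 1. This includes η = 1 - ε with ε = 0, where no logarithm
      -- appears.
      rcases h1.eq_or_lt with rfl | h1'
      · refine ⟨1, one_pos, fun s hs => ?_, fun ρ _ c hρ s hs => ?_⟩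
        · simp [gammaRate, hnl]
        · simp only [sub_self, Real.rpow_zero, min_self, ENNReal.ofReal_one, lintegral_const,
            one_mul, Measure.restrict_apply_univ]
          refine prob_le_one.trans ?_
          simp [gammaRate, hnl]
      by_cases heq : η = 1 - ε
      -- At the critical exponent the ratio 2^(1-η-ε) is 1, and the sum counts the J scales.
      · obtain ⟨C, hC, hCJ⟩ := exists_ceil_logb_le hT (sub_pos.2 h1') (recip_nonneg β)
        refine ⟨C, hC, fun s hs => ?_, fun ρ _ c hρ s hs => ?_⟩
        · rw [gammaRate, if_neg hnl, if_pos ⟨heq, h1'⟩]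
          have := Real.rpow_pos_of_pos hs.1 (-((1 - η) * recip β))
          exact Real.log_pos (by linarith)
        · obtain ⟨J, hJ1, hJ2⟩ := hCJ s hs
          refine (setLIntegral_min_rpow_le hε h0 h1 hge (Real.rpow_pos_of_pos hs.1 _) hρ
            hJ1).trans (ENNReal.ofReal_le_ofReal ?_)
          rw [gammaRate, if_neg hnl, if_pos ⟨heq, h1'⟩, mul_comm C, mul_assoc]
          gcongr
          have : 1 - η - ε = 0 := by linarith
          simpa [this] using hJ2
      · set q := (2 : ℝ) ^ (1 - η - ε) with hq
        have hgt := lt_of_le_of_ne hge (Ne.symm heq)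
        have hq0 : 0 ≤ q := by positivity
        have hq1 : q < 1 := Real.rpow_lt_one_of_one_lt_of_neg one_lt_two (by linarith)
        have hq2 : 0 < 1 - q := sub_pos.2 hq1
        refine ⟨2 + 2 * (1 - q)⁻¹, by positivity, fun s hs => ?_, fun ρ _ c hρ s hs => ?_⟩
        · simp [gammaRate, hnl, heq]
        · have hpos : 0 < s ^ recip β := Real.rpow_pos_of_pos hs.1 _
          -- Any J with 2^(-J) ≤ a will do, since the full geometric series converges.
          obtain ⟨J, hJ⟩ := pow_unbounded_of_one_lt (1 / s ^ recip β) (one_lt_two (α := ℝ))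
          refine (setLIntegral_min_rpow_le hε h0 h1 hge hpos hρ
            (J := J) ?_).trans (ENNReal.ofReal_le_ofReal ?_)
          · rw [div_lt_iff₀' hpos] at hJ; exact hJ.le
          · rw [gammaRate, if_neg hnl, if_neg (fun h => heq h.1), mul_one, mul_comm (_ + _)]
            gcongr
            rw [← tsum_geometric_of_lt_one hq0 hq1]
            exact (summable_geometric_of_lt_one hq0 hq1).sum_le_tsum _ fun k _ => by positivity
    refine ⟨2 * (c' + 2) * C, by positivity, hrate, ?_⟩
    intro Ω _ P _ X ρ _ c hX hρ hTV f hf hfD t ht x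
    refine (absGradient_le_of_diffQuot_le (ENNReal.mul_ne_top ENNReal.ofReal_ne_top hf.2.ne)
      fun z hz hz0 => enorm_diffQuot_le_of_holder h0 h1 hc' hX hf hfD hTV hz hz0 ht x).trans ?_
    refine (mul_le_mul_right (hCb ρ c hρ _ (hT' t ht)) _).trans (le_of_eq ?_)
    rw [mul_right_comm, ← ENNReal.ofReal_mul (by positivity)]
    congr 2
    ring

theorem mem_domGamma_of_absGradient_le {Ω : Type*} [MeasurableSpace Ω] {P : Measure Ω}
    [IsProbabilityMeasure P] {X : ℝ → Ω → ℝ} {T : ℝ} {f : ℝ → ℝ} {ρ : Measure ℝ}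
    (hfD : f ∈ classD T X P) {B : ℝ → ℝ≥0∞} (hB : ∀ t ∈ Ico 0 T, B t < ⊤)
    (h : ∀ t ∈ Ico 0 T, ∀ x, absGradient T X P ρ f t x ≤ B t) : f ∈ domGamma T X P ρ := by
  refine ⟨hfD, fun s hs δ _ x => (lintegral_mono fun ω => h s hs (x + X δ ω)).trans_lt ?_⟩
  simpa using hB s hs

theorem exists_gammaDualNorm_le {T ε η c' : ℝ} {β : ℝ≥0∞} (hT : 0 < T) (hε : 0 ≤ ε)
    (hη : η ∈ Icc (0 : ℝ) 1) (hc' : 0 < c') :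
    ∃ C : ℝ, 0 < C ∧
      ∀ (Ω : Type u) [MeasurableSpace Ω] (P : Measure Ω) [IsProbabilityMeasure P]
        (X : ℝ → Ω → ℝ) (ρ : Measure ℝ) [IsProbabilityMeasure ρ] (c : ℝ),
        IsLevyProcess T X P → SubsetLp T η X P →
        0 < c → SmallBall ε c ρ → TVBound T β ρ.support c' X P →
        holderSpace η ⊆ domGamma T X P ρ ∧
        ∀ t ∈ Ico 0 T, gammaDualNorm T X P ρ η t ≤
            ENNReal.ofReal (C * max 1 c * gammaRate ε η β (T - t)) := by
  obtain ⟨C, hC, hrate, hb⟩ := exists_absGradient_le_gammaRate.{u} (β := β) hT hε hη.1 hη.2 hc'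
  refine ⟨C, hC, fun Ω _ P _ X ρ _ c hX hL hc hρ hTV => ⟨fun f hf => ?_, fun t ht => ?_⟩⟩
  · have hfD := mem_classD_of_holder hη.1 hX.measurable hL hf
    exact mem_domGamma_of_absGradient_le hfD
      (fun t _ => ENNReal.mul_lt_top ENNReal.ofReal_lt_top hf.2)
      (hb Ω P X ρ c hX.measurable hρ hTV f hf hfD)
  · refine iInf_le_of_le _ (iInf₂_le_of_le ?_ (fun f hf => ?_) le_rfl)
    -- `gammaDualNorm` admits only positive constants, so the rate must be strictly positive.
    · have := hrate (T - t) ⟨by linarith [ht.2], by linarith [ht.1]⟩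
      rw [Real.toNNReal_pos]
      positivity
    · exact (enorm_gradient_le_absGradient ρ t 0).trans
        (hb Ω P X ρ c hX.measurable hρ hTV f hf
          (mem_classD_of_holder hη.1 hX.measurable hL hf) t ht 0)

end HolderBound

/-! ### The bound on the interpolation space -/

section Interpolation

universe u

theorem measurable_interp_integrand (η : ℝ) (f : ℝ → ℝ) :
    Measurable fun v : ℝ => ENNReal.ofReal (v ^ (-η)) * kFunctional v f :=
  (ENNReal.measurable_ofReal.comp (measurable_id.pow_const _)).mul (kFunctional_mono f).measurable

theorem lintegral_interp_rpow {η : ℝ} {q : ℝ≥0∞} (hq : 1 ≤ q) (hq' : q ≠ ⊤) (f : ℝ → ℝ) :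
    ∫⁻ v in Ioi (0 : ℝ), (ENNReal.ofReal (v ^ (-η)) * kFunctional v f) ^ q.toReal *
      ENNReal.ofReal (1 / v) = interpNorm η q f ^ q.toReal := by
  have hq0 : q ≠ 0 := (one_pos.trans_le hq).ne'
  have hqr : q.toReal ≠ 0 := (ENNReal.toReal_pos hq0 hq').ne'
  rw [interpNorm, eLpNorm_eq_lintegral_rpow_enorm_toReal hq0 hq', ← ENNReal.rpow_mul,
    one_div_mul_cancel hqr, ENNReal.rpow_one,
    lintegral_withDensity_eq_lintegral_mul _ (by fun_prop)
      ((measurable_interp_integrand η f).enorm.pow_const _)]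
  refine lintegral_congr fun v => ?_
  simp [mul_comm]

/-- K is nondecreasing in v, so on (v,2v] the integrand is at least (2v)^(-η)K(v,f), and the
dv/v-mass of that interval is at least 1/2. The factor 4 is 2 from this mass times 2 ≥ 2^η. -/
theorem kFunctional_le_interpNorm {η v : ℝ} {q : ℝ≥0∞} (h0 : 0 ≤ η) (h1 : η ≤ 1) (hq : 1 ≤ q)
    (hq' : q ≠ ⊤) (f : ℝ → ℝ) (hv : 0 < v) :
    kFunctional v f ≤ ENNReal.ofReal (4 * v ^ η) * interpNorm η q f := by
  have hq0 : q ≠ 0 := (one_pos.trans_le hq).ne'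
  have hqr : 0 < q.toReal := ENNReal.toReal_pos hq0 hq'
  have hq1 : 1 ≤ q.toReal := by
    rw [← ENNReal.toReal_one]; exact ENNReal.toReal_mono hq' hq
  set b : ℝ≥0∞ := ENNReal.ofReal ((2 * v) ^ (-η)) * kFunctional v f with hb
  have hbq : b ^ q.toReal * ENNReal.ofReal (1 / 2) ≤ interpNorm η q f ^ q.toReal := by
    rw [← lintegral_interp_rpow hq hq']
    calc b ^ q.toReal * ENNReal.ofReal (1 / 2)
        = ∫⁻ _ in Ioc v (2 * v), b ^ q.toReal * ENNReal.ofReal (1 / (2 * v)) := by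
          rw [setLIntegral_const, Real.volume_Ioc, mul_assoc, ← ENNReal.ofReal_mul (by positivity)]
          congr 2
          field_simp
          ring
      _ ≤ ∫⁻ u in Ioc v (2 * v), (ENNReal.ofReal (u ^ (-η)) * kFunctional u f) ^ q.toReal *
            ENNReal.ofReal (1 / u) := by
          refine setLIntegral_mono' measurableSet_Ioc fun u hu => ?_
          have hu0 : 0 < u := hv.trans hu.1
          refine mul_le_mul' (ENNReal.rpow_le_rpow (mul_le_mul' (ENNReal.ofReal_le_ofReal ?_)
            (kFunctional_mono f hu.1.le)) hqr.le) (ENNReal.ofReal_le_ofReal ?_)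
          · exact Real.rpow_le_rpow_of_nonpos hu0 hu.2 (by linarith)
          · exact one_div_le_one_div_of_le hu0 hu.2
      _ ≤ _ := lintegral_mono_set fun u hu => hv.trans hu.1
  have hb2 : b * ENNReal.ofReal (1 / 2) ≤ interpNorm η q f := by
    rw [← ENNReal.rpow_le_rpow_iff hqr, ENNReal.mul_rpow_of_nonneg _ _ hqr.le]
    refine le_trans ?_ hbq
    gcongr
    rw [ENNReal.ofReal_rpow_of_nonneg (by norm_num) hqr.le]
    exact ENNReal.ofReal_le_ofReal ((Real.rpow_le_rpow_of_exponent_ge (by norm_num) (by norm_num)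
      hq1).trans_eq (Real.rpow_one _))
  refine le_trans ?_ (mul_le_mul_right hb2 _)
  rw [hb, mul_right_comm, ← mul_assoc, ← ENNReal.ofReal_mul (by positivity),
    ← ENNReal.ofReal_mul (by positivity)]
  refine le_mul_of_one_le_left zero_le ?_
  rw [ENNReal.one_le_ofReal]
  have h2 : (2 : ℝ) ^ (-η) * 2 ≥ 1 := by
    rw [← Real.rpow_add_one two_ne_zero]
    exact Real.one_le_rpow one_le_two (by linarith)
  have h3 : v ^ η * v ^ (-η) = 1 := by rw [← Real.rpow_add hv]; simp
  have : 4 * v ^ η * ((2 * v) ^ (-η) * (1 / 2)) = (v ^ η * v ^ (-η)) * (2 ^ (-η) * 2) := by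
    rw [Real.mul_rpow two_pos.le hv.le]; ring
  rw [this, h3]
  linarith

theorem measurable_of_kFunctional_lt_top {v : ℝ} {f : ℝ → ℝ} (h : kFunctional v f < ⊤) :
    Measurable f := by
  simp only [kFunctional, iInf_lt_iff] at h
  obtain ⟨g, k, hg, hk, e, _⟩ := h
  rw [e]
  exact hg.1.measurable.add hk.1.1

/-- The oscillation bound at v = |x-y| costs 2, the bound on K costs 4. -/
theorem holderSeminorm_le_interpNorm {η : ℝ} {q : ℝ≥0∞} (h0 : 0 ≤ η) (h1 : η ≤ 1) (hq : 1 ≤ q)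
    (hq' : q ≠ ⊤) {f : ℝ → ℝ} (hf : f ∈ interpSpace η q) :
    holderSeminorm η f ≤ 8 * interpNorm η q f := by
  have hN : 8 * interpNorm η q f ≠ ⊤ := ENNReal.mul_ne_top ENNReal.ofNat_ne_top (ne_of_lt hf)
  refine iSup_le fun x => iSup_le fun y => iSup_le fun hxy => ?_
  have hpos : 0 < |x - y| := abs_pos.2 (sub_ne_zero.2 hxy.ne)
  have h := (enorm_sub_le_kMeas f le_rfl (x := x) (y := y)).trans
    (mul_le_mul_right ((kMeas_le_kFunctional _ f).trans
      (kFunctional_le_interpNorm h0 h1 hq hq' f hpos)) 2)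
  rw [ENNReal.ofReal_div_of_pos (Real.rpow_pos_of_pos hpos _)]
  refine ENNReal.div_le_of_le_mul ?_
  rw [← Real.norm_eq_abs (f x - f y), ofReal_norm]
  refine h.trans (le_of_eq ?_)
  rw [ENNReal.ofReal_mul (by norm_num), ENNReal.ofReal_ofNat, mul_right_comm, ← mul_assoc,
    ← mul_assoc]
  congr 2
  norm_num

theorem interpSpace_subset_holderSpace {η : ℝ} {q : ℝ≥0∞} (h0 : 0 ≤ η) (h1 : η ≤ 1) (hq : 1 ≤ q)
    (hq' : q ≠ ⊤) : interpSpace η q ⊆ holderSpace η := fun f hf =>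
  ⟨measurable_of_kFunctional_lt_top ((kFunctional_le_interpNorm h0 h1 hq hq' f one_pos).trans_lt
    (ENNReal.mul_lt_top ENNReal.ofReal_lt_top hf)),
   (holderSeminorm_le_interpNorm h0 h1 hq hq' hf).trans_lt
    (ENNReal.mul_lt_top (by simp) hf)⟩

/-- Hölder's inequality on ℕ for the measure with weights w. It keeps the weights linear, so a
geometric sequence stays summable. -/
theorem tsum_mul_rpow_le {p : ℝ} (hp : 1 ≤ p) (w b : ℕ → ℝ≥0∞) :
    (∑' k, w k * b k) ^ p ≤ (∑' k, w k) ^ (p - 1) * ∑' k, w k * b k ^ p := by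
  have hp0 : 0 < p := by linarith
  have h : ∑' k, w k * b k ≤ (∑' k, w k) ^ (1 - p⁻¹) * (∑' k, w k * b k ^ p) ^ p⁻¹ := by
    rw [ENNReal.tsum_eq_iSup_sum]
    refine iSup_le fun s => (ENNReal.inner_le_weight_mul_Lp_of_nonneg s hp w b).trans ?_
    have : 0 ≤ 1 - p⁻¹ := sub_nonneg.2 (inv_le_one_of_one_le₀ hp)
    gcongr
    · exact ENNReal.sum_le_tsum s
    · exact ENNReal.sum_le_tsum s
  refine (ENNReal.rpow_le_rpow h hp0.le).trans (le_of_eq ?_)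
  rw [ENNReal.mul_rpow_of_nonneg _ _ hp0.le, ← ENNReal.rpow_mul, ← ENNReal.rpow_mul,
    inv_mul_cancel₀ hp0.ne', ENNReal.rpow_one, sub_mul, inv_mul_cancel₀ hp0.ne', one_mul]

/-- Under v = b(T-t)^r the measure dv/v becomes r dt/(T-t). The factor b drops out, so all dyadic
scales obey the same bound; extending the image to (0,∞) gives the inequality. -/
theorem lintegral_comp_rpow_le {T r b : ℝ} (hr : 0 < r) (hb : 0 < b) (Φ : ℝ → ℝ≥0∞) :
    ∫⁻ t in Ico 0 T, Φ (b * (T - t) ^ r) * ENNReal.ofReal (1 / (T - t)) ≤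
      ENNReal.ofReal (1 / r) * ∫⁻ v in Ioi (0 : ℝ), Φ v * ENNReal.ofReal (1 / v) := by
  have hinj : InjOn (fun t => b * (T - t) ^ r) (Ico 0 T) := by
    intro s hs t ht hst
    have h := mul_left_cancel₀ hb.ne' hst
    have := (Real.rpow_left_inj (by linarith [hs.2]) (by linarith [ht.2]) hr.ne').1 h
    linarith
  have hder : ∀ t ∈ Ico 0 T, HasDerivWithinAt (fun t => b * (T - t) ^ r)
      (b * (-1 * r * (T - t) ^ (r - 1))) (Ico 0 T) t := fun t ht => by
    have h1 : HasDerivAt (fun t : ℝ => T - t) (-1) t := by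
      simpa using (hasDerivAt_id t).const_sub T
    exact ((h1.rpow_const (Or.inl (by linarith [ht.2]))).const_mul b).hasDerivWithinAt
  have h := lintegral_image_eq_lintegral_abs_deriv_mul measurableSet_Ico hder hinj
    (fun v => Φ v * ENNReal.ofReal (1 / v))
  have hsub : (fun t => b * (T - t) ^ r) '' Ico 0 T ⊆ Ioi 0 := by
    rintro _ ⟨t, ht, rfl⟩
    exact mul_pos hb (Real.rpow_pos_of_pos (by linarith [ht.2]) _)
  have h2 := h.symm.trans_le (lintegral_mono_set (μ := volume)
    (f := fun v => Φ v * ENNReal.ofReal (1 / v)) hsub)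
  refine le_trans ?_ (mul_le_mul_right h2 _)
  rw [← lintegral_const_mul' _ _ ENNReal.ofReal_ne_top]
  refine setLIntegral_mono' measurableSet_Ico fun t ht => le_of_eq ?_
  have hs : 0 < T - t := by linarith [ht.2]
  rw [mul_left_comm _ (Φ _), mul_left_comm _ (Φ _), ← ENNReal.ofReal_mul (by positivity),
    ← ENNReal.ofReal_mul (by positivity)]
  congr 2
  rw [Real.rpow_sub_one hs.ne', abs_mul, abs_mul, abs_mul, abs_of_pos hb, abs_of_pos hr,
    abs_neg, abs_one, abs_of_pos (by positivity)]
  have := (Real.rpow_pos_of_pos hs r).ne'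
  field_simp

/-- The weight a^(1-ε-η) splits (a2^k)^(ε-1) into (2^k a)^(-η), as in the interpolation norm, and a
summable geometric factor. -/
theorem dyadicSum_le_weighted {ε η a : ℝ} (ha : 0 < a) (f : ℝ → ℝ) :
    ENNReal.ofReal (a ^ (1 - (ε + η))) * dyadicSum ε a f ≤
      ∑' k : ℕ, ENNReal.ofReal (((2 : ℝ) ^ (ε + η - 1)) ^ k) *
        (ENNReal.ofReal ((2 ^ k * a) ^ (-η)) * kFunctional (2 ^ k * a) f) := by
  rw [dyadicSum, ← ENNReal.tsum_mul_left]
  refine ENNReal.tsum_le_tsum fun k => ?_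
  have h2 : (0 : ℝ) < 2 ^ k := by positivity
  rw [← mul_assoc, ← mul_assoc, ← ENNReal.ofReal_mul (by positivity),
    ← ENNReal.ofReal_mul (by positivity), mul_comm a]
  refine mul_le_mul' (le_of_eq ?_) (kMeas_le_kFunctional _ _)
  congr 1
  rw [Real.mul_rpow h2.le ha.le, Real.mul_rpow h2.le ha.le,
    ← Real.rpow_natCast ((2 : ℝ) ^ (ε + η - 1)) k, ← Real.rpow_natCast 2 k, ← Real.rpow_mul two_pos.le, ← Real.rpow_mul two_pos.le,
    ← Real.rpow_mul two_pos.le]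
  have e1 : a ^ (1 - (ε + η)) * a ^ (ε - 1) = a ^ (-η) := by
    rw [← Real.rpow_add ha]; congr 1; ring
  have e2 : (2 : ℝ) ^ ((ε + η - 1) * k) * 2 ^ (k * -η) = 2 ^ (k * (ε - 1)) := by
    rw [← Real.rpow_add two_pos]; congr 1; ring
  rw [← e1, ← e2]
  ring

/-- The weighted Hölder inequality gives (1-w)^{-(p-1)}, summing over k gives another (1-w)^{-1},
and the substitution v = 2^k(T-t)^r gives 1/r; the p-th root is the stated constant. -/
theorem eLpNorm_weighted_dyadic_le {T r η w : ℝ} {q : ℝ≥0∞} (hq : 1 ≤ q) (hq' : q ≠ ⊤)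
    (hr : 0 < r) (hw0 : 0 ≤ w) (hw1 : w < 1) (f : ℝ → ℝ) :
    eLpNorm (fun t : ℝ => ∑' k : ℕ, ENNReal.ofReal (w ^ k) *
        (ENNReal.ofReal ((2 ^ k * (T - t) ^ r) ^ (-η)) * kFunctional (2 ^ k * (T - t) ^ r) f)) q
      ((volume.restrict (Ico 0 T)).withDensity (fun t => ENNReal.ofReal (1 / (T - t)))) ≤
      ENNReal.ofReal ((1 - w)⁻¹ * (1 / r) ^ (1 / q.toReal)) * interpNorm η q f := by
  have hq0 : q ≠ 0 := (one_pos.trans_le hq).ne'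
  have hqr : 0 < q.toReal := ENNReal.toReal_pos hq0 hq'
  have hq1 : 1 ≤ q.toReal := by
    rw [← ENNReal.toReal_one]; exact ENNReal.toReal_mono hq' hq
  have hw2 : 0 < 1 - w := sub_pos.2 hw1
  set p := q.toReal
  set H : ℝ → ℝ≥0∞ := fun v => ENNReal.ofReal (v ^ (-η)) * kFunctional v f with hH
  have hHm : Measurable H := measurable_interp_integrand η f
  have hm : ∀ k : ℕ, Measurable fun t : ℝ => H (2 ^ k * (T - t) ^ r) := fun k =>
    hHm.comp (by fun_prop)
  have hW : ∑' k : ℕ, ENNReal.ofReal (w ^ k) = ENNReal.ofReal (1 - w)⁻¹ := by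
    rw [← ENNReal.ofReal_tsum_of_nonneg (fun k => by positivity)
      (summable_geometric_of_lt_one hw0 hw1), tsum_geometric_of_lt_one hw0 hw1]
  rw [← ENNReal.rpow_le_rpow_iff hqr, eLpNorm_eq_lintegral_rpow_enorm_toReal hq0 hq',
    ← ENNReal.rpow_mul, one_div_mul_cancel hqr.ne', ENNReal.rpow_one]
  simp only [enorm_eq_self]
  calc _ ≤ ∫⁻ t, ENNReal.ofReal (1 - w)⁻¹ ^ (p - 1) *
        ∑' k : ℕ, ENNReal.ofReal (w ^ k) * H (2 ^ k * (T - t) ^ r) ^ p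
        ∂((volume.restrict (Ico 0 T)).withDensity (fun t => ENNReal.ofReal (1 / (T - t)))) := by
        refine lintegral_mono fun t => ?_
        rw [← hW]
        exact tsum_mul_rpow_le hq1 _ _
    _ = ENNReal.ofReal (1 - w)⁻¹ ^ (p - 1) * ∑' k : ℕ, ENNReal.ofReal (w ^ k) *
          ∫⁻ t in Ico 0 T, H (2 ^ k * (T - t) ^ r) ^ p * ENNReal.ofReal (1 / (T - t)) := by
        have hmp : ∀ k : ℕ, Measurable fun t : ℝ => H (2 ^ k * (T - t) ^ r) ^ p := fun k =>
          (hm k).pow_const _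
        rw [lintegral_const_mul _ (Measurable.tsum fun k => (hmp k).const_mul _),
          lintegral_tsum fun k => ((hmp k).const_mul _).aemeasurable]
        congr 1
        refine tsum_congr fun k => ?_
        rw [lintegral_const_mul _ (hmp k),
          lintegral_withDensity_eq_lintegral_mul _ (by fun_prop) (hmp k)]
        congr 1
        exact lintegral_congr fun t => mul_comm _ _
    _ ≤ ENNReal.ofReal (1 - w)⁻¹ ^ (p - 1) * ∑' k : ℕ, ENNReal.ofReal (w ^ k) *
          (ENNReal.ofReal (1 / r) * interpNorm η q f ^ p) := by
        gcongr with k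
        rw [← lintegral_interp_rpow hq hq']
        exact lintegral_comp_rpow_le hr (by positivity) fun v => H v ^ p
    _ = _ := by
        rw [ENNReal.tsum_mul_right, hW, ENNReal.mul_rpow_of_nonneg _ _ hqr.le, ← mul_assoc,
          ← mul_assoc]
        congr 1
        rw [ENNReal.ofReal_mul (by positivity), ENNReal.mul_rpow_of_nonneg _ _ hqr.le,
          ← ENNReal.ofReal_rpow_of_pos (by positivity), ← ENNReal.rpow_mul,
          one_div_mul_cancel hqr.ne', ENNReal.rpow_one]
        congr 1
        have hW0 : ENNReal.ofReal (1 - w)⁻¹ ≠ 0 := by simpa using hw1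
        conv_rhs => rw [← sub_add_cancel p 1, ENNReal.rpow_add _ _ hW0 ENNReal.ofReal_ne_top,
          ENNReal.rpow_one]

/-- The weighted norm bound for the gradient on the interpolation space. -/
theorem exists_besovNorm_gradient_le {T ε η c' : ℝ} {β q : ℝ≥0∞} (hε : 0 ≤ ε)
    (h1 : η < 1 - ε) (hβ0 : 0 < β) (hβ : β ≠ ⊤) (hq : 1 ≤ q) (hq' : q ≠ ⊤)
    (hc' : 0 < c') :
    ∃ C : ℝ, 0 < C ∧
      ∀ (Ω : Type u) [MeasurableSpace Ω] (P : Measure Ω) [IsProbabilityMeasure P]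
        (X : ℝ → Ω → ℝ) (ρ : Measure ℝ) [IsProbabilityMeasure ρ] (c : ℝ),
        (∀ s ∈ Icc 0 T, Measurable (X s)) → SmallBall ε c ρ → TVBound T β ρ.support c' X P →
        ∀ f ∈ classD T X P,
          besovNorm T ((1 - (ε + η)) * recip β) q (gradient T X P ρ f) ≤
            ENNReal.ofReal (C * max 1 c) * interpNorm η q f := by
  set w := (2 : ℝ) ^ (ε + η - 1) with hw
  have hw1 : w < 1 := Real.rpow_lt_one_of_one_lt_of_neg one_lt_two (by linarith)
  have hw2 : 0 < 1 - w := sub_pos.2 hw1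
  have hr := recip_pos hβ0 hβ
  refine ⟨(c' + 4) * ((1 - w)⁻¹ * (1 / recip β) ^ (1 / q.toReal)), by positivity, ?_⟩
  intro Ω _ P _ X ρ _ c hX hρ hTV f hf
  have hM : 0 < max 1 c := one_pos.trans_le (le_max_left _ _)
  rw [mul_right_comm, ENNReal.ofReal_mul (by positivity), mul_assoc]
  refine le_trans ?_ (mul_le_mul_right (eLpNorm_weighted_dyadic_le (T := T) (r := recip β)
    (w := w) hq hq' hr (by positivity) hw1 f) _)
  refine eLpNorm_le_nnreal_smul_eLpNorm_of_ae_le_mul' (c := ((c' + 4) * max 1 c).toNNReal) ?_ q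
  refine (withDensity_absolutelyContinuous _ _).ae_le ?_
  filter_upwards [ae_restrict_mem measurableSet_Ico] with t ht
  have hs : 0 < T - t := by linarith [ht.2]
  have ha : 0 < (T - t) ^ recip β := Real.rpow_pos_of_pos hs _
  simp only [enorm_eq_self]
  have hsup : supNorm (gradient T X P ρ f t) ≤
      ENNReal.ofReal ((c' + 4) * max 1 c) * dyadicSum ε ((T - t) ^ recip β) f :=
    iSup_le fun x => (enorm_gradient_le_absGradient ρ t x).trans
      (absGradient_le_dyadicSum hε hc' hX hf hρ hTV ht x)
  refine (mul_le_mul_right hsup _).trans ?_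
  rw [mul_left_comm]
  refine mul_le_mul_right ?_ _
  rw [mul_comm _ (recip β), Real.rpow_mul hs.le]
  exact dyadicSum_le_weighted ha f

end Interpolation

/-! ### Regularity and semigroup property of the gradient -/

section Regularity

variable {Ω : Type*} [MeasurableSpace Ω] {P : Measure Ω} {X : ℝ → Ω → ℝ} {T η : ℝ}
  {f : ℝ → ℝ}

theorem IsLevyProcess.tendsto_zero (hX : IsLevyProcess T X P) (hT : 0 ≤ T) (ω : Ω) :
    Tendsto (fun h => X h ω) (𝓝[Icc 0 T] 0) (𝓝 0) := by
  have h := (hX.cadlag ω 0 ⟨le_rfl, hT⟩).1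
  have e : Icc 0 T ∩ Ici 0 = Icc 0 T := inter_eq_left.2 fun x hx => hx.1
  rw [e, ContinuousWithinAt, hX.zero] at h
  exact h

theorem IsLevyProcess.indepFun_sub (hX : IsLevyProcess T X P) {u v : ℝ} (hu : 0 ≤ u)
    (huv : u ≤ v) (hv : v ≤ T) : IndepFun (X u) (fun ω => X v ω - X u ω) P :=
  hX.indep.indepFun_eval_sub (r := ⟨0, le_rfl, hu.trans (huv.trans hv)⟩)
    (s := ⟨u, hu, huv.trans hv⟩) (t := ⟨v, hu.trans huv, hv⟩) hu huv (.of_forall hX.zero)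

variable [IsProbabilityMeasure P]

/-- Dominated convergence from right-continuity at 0. The truncation by B makes moment conditions
unnecessary. -/
theorem IsLevyProcess.tendsto_integral_min (hX : IsLevyProcess T X P) (hT : 0 ≤ T) (hη : 0 < η)
    {B L : ℝ} (hB : 0 ≤ B) (hL : 0 ≤ L) :
    Tendsto (fun h => ∫ ω, min B (L * |X h ω| ^ η) ∂P) (𝓝[Icc 0 T] 0) (𝓝 0) := by
  have hcont : Continuous fun y : ℝ => min B (L * |y| ^ η) :=
    continuous_const.min (continuous_const.mul (Continuous.rpow_const (by fun_prop)
      fun _ => Or.inr hη.le))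
  suffices h : Tendsto (fun h => ∫ ω, min B (L * |X h ω| ^ η) ∂P) (𝓝[Icc 0 T] 0)
      (𝓝 (∫ _ : Ω, (0 : ℝ) ∂P)) by simpa using h
  refine tendsto_integral_filter_of_dominated_convergence (fun _ => B) ?_ ?_
    (integrable_const _) ?_
  · filter_upwards [self_mem_nhdsWithin] with h hh
    exact (hcont.measurable.comp (hX.measurable h hh)).aestronglyMeasurable
  · refine .of_forall fun h => .of_forall fun ω => ?_
    rw [Real.norm_eq_abs, abs_of_nonneg (le_min hB (by positivity))]
    exact min_le_left _ _
  · refine .of_forall fun ω => ?_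
    have := (hcont.tendsto 0).comp (hX.tendsto_zero hT ω)
    simpa [Real.zero_rpow hη.ne', hB, Function.comp_def] using this

/-- Evaluating both integrals along the same path leaves the increment X_s - X_{s'}, whose law
depends only on |s-s'|. This quantifies joint continuity in time and space. -/
theorem IsLevyProcess.abs_integral_sub_le (hX : IsLevyProcess T X P) {ψ : ℝ → ℝ}
    {B L : ℝ} (hψm : Measurable ψ) (hψ : ∀ x, |ψ x| ≤ B)
    (hψL : ∀ x y, |ψ x - ψ y| ≤ L * |x - y| ^ η) {s s' : ℝ} (hs : s ∈ Icc 0 T)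
    (hs' : s' ∈ Icc 0 T) (x y : ℝ) :
    |∫ ω, ψ (x + X s ω) ∂P - ∫ ω, ψ (y + X s' ω) ∂P| ≤
      L * |x - y| ^ η + ∫ ω, min (2 * B) (L * |X |s - s'| ω| ^ η) ∂P := by
  wlog hle : s' ≤ s generalizing s s' x y
  · have := this hs' hs y x (le_of_not_ge hle)
    rwa [abs_sub_comm, abs_sub_comm y, abs_sub_comm s'] at this
  have hB : 0 ≤ B := (abs_nonneg _).trans (hψ 0)
  have hL : 0 ≤ L := by
    have := (abs_nonneg _).trans (hψL 1 0)
    simpa using this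
  have hint : ∀ x, ∀ s ∈ Icc 0 T, Integrable (fun ω => ψ (x + X s ω)) P := fun x s hs =>
    Integrable.mono' (integrable_const B)
      (hψm.comp (measurable_const.add (hX.measurable s hs))).aestronglyMeasurable
      (.of_forall fun ω => hψ _)
  have hgm : Measurable fun y : ℝ => min (2 * B) (L * |y| ^ η) :=
    measurable_const.min (measurable_const.mul (by fun_prop))
  have hgi : ∀ D : Ω → ℝ, Measurable D → Integrable (fun ω => min (2 * B) (L * |D ω| ^ η)) P :=
    fun D hD => Integrable.mono' (integrable_const (2 * B))
      (hgm.comp hD).aestronglyMeasurable (.of_forall fun ω => by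
        rw [Real.norm_eq_abs, abs_of_nonneg (le_min (by positivity) (by positivity))]
        exact min_le_left _ _)
  have hDm : Measurable fun ω => X s ω - X s' ω := (hX.measurable s hs).sub (hX.measurable s' hs')
  have hlaw : ∫ ω, min (2 * B) (L * |X s ω - X s' ω| ^ η) ∂P =
      ∫ ω, min (2 * B) (L * |X |s - s'| ω| ^ η) ∂P := by
    have h := hX.stationary s' s hs'.1 hle hs.2
    have hm : Measurable (X (s - s')) := hX.measurable _ ⟨by linarith, by linarith [hs.2, hs'.1]⟩
    rw [abs_of_nonneg (sub_nonneg.2 hle),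
      ← integral_map (f := fun y => min (2 * B) (L * |y| ^ η)) hDm.aemeasurable
        hgm.aestronglyMeasurable, h, integral_map hm.aemeasurable hgm.aestronglyMeasurable]
  rw [← hlaw, ← integral_sub (hint x s hs) (hint y s' hs')]
  have hc : L * |x - y| ^ η = ∫ _ : Ω, L * |x - y| ^ η ∂P := by simp
  rw [hc, ← integral_add (integrable_const _) (hgi _ hDm)]
  refine (abs_integral_le_integral_abs).trans (integral_mono
    ((hint x s hs).sub (hint y s' hs')).abs ((integrable_const _).add (hgi _ hDm)) fun ω => ?_)
  have h1 := hψL (x + X s ω) (y + X s ω)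
  have h2 := hψL (y + X s ω) (y + X s' ω)
  rw [add_sub_add_right_eq_sub] at h1
  rw [add_sub_add_left_eq_sub] at h2
  have h3 : |ψ (y + X s ω) - ψ (y + X s' ω)| ≤ 2 * B :=
    (abs_sub _ _).trans (by linarith [hψ (y + X s ω), hψ (y + X s' ω)])
  exact (abs_sub_le _ (ψ (y + X s ω)) _).trans (add_le_add h1 (le_min h3 h2))

theorem IsLevyProcess.continuousOn_integral (hX : IsLevyProcess T X P) (hη : 0 < η) {ψ : ℝ → ℝ}
    {B L : ℝ} (hψm : Measurable ψ) (hψ : ∀ x, |ψ x| ≤ B)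
    (hψL : ∀ x y, |ψ x - ψ y| ≤ L * |x - y| ^ η) :
    ContinuousOn (fun p : ℝ × ℝ => ∫ ω, ψ (p.2 + X p.1 ω) ∂P) (Icc 0 T ×ˢ univ) := by
  rintro ⟨s, x⟩ ⟨hs, -⟩
  have hT : 0 ≤ T := hs.1.trans hs.2
  have hB : 0 ≤ B := (abs_nonneg _).trans (hψ 0)
  have hL : 0 ≤ L := by
    have := (abs_nonneg _).trans (hψL 1 0)
    simpa using this
  rw [ContinuousWithinAt, tendsto_iff_dist_tendsto_zero]
  have h1 : Tendsto (fun p : ℝ × ℝ => L * |p.2 - x| ^ η) (𝓝[Icc 0 T ×ˢ univ] (s, x)) (𝓝 0) := by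
    have hc : Continuous fun p : ℝ × ℝ => L * |p.2 - x| ^ η :=
      continuous_const.mul (Continuous.rpow_const (by fun_prop) fun _ => Or.inr hη.le)
    have := (hc.tendsto (s, x)).mono_left (nhdsWithin_le_nhds (s := Icc 0 T ×ˢ univ))
    simpa [Real.zero_rpow hη.ne'] using this
  have h2 : Tendsto (fun p : ℝ × ℝ => |p.1 - s|) (𝓝[Icc 0 T ×ˢ univ] (s, x)) (𝓝[Icc 0 T] 0) := by
    refine tendsto_nhdsWithin_iff.2 ⟨?_, ?_⟩
    · have hc : Continuous fun p : ℝ × ℝ => |p.1 - s| := by fun_prop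
      have := (hc.tendsto (s, x)).mono_left (nhdsWithin_le_nhds (s := Icc 0 T ×ˢ univ))
      simpa using this
    · filter_upwards [self_mem_nhdsWithin] with p hp
      have h1 := hp.1.1
      have h2 := hp.1.2
      exact ⟨abs_nonneg _, abs_le.2 ⟨by linarith [hs.2], by linarith [hs.1]⟩⟩
  have h3 := h1.add ((hX.tendsto_integral_min hT hη (B := 2 * B) (by positivity) hL).comp h2)
  rw [add_zero] at h3
  refine squeeze_zero' (.of_forall fun _ => dist_nonneg) ?_ h3
  filter_upwards [self_mem_nhdsWithin] with p hp
  rw [Real.dist_eq]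
  exact hX.abs_integral_sub_le hψm hψ hψL hp.1 hs p.2 x

theorem abs_valueFun_sub_le (hf : f ∈ holderSpace η) (hfD : f ∈ classD T X P) {t : ℝ}
    (ht : T - t ∈ Icc 0 T) (x y : ℝ) :
    |valueFun T X P f t x - valueFun T X P f t y| ≤
      (holderSeminorm η f).toReal * |x - y| ^ η := by
  rw [valueFun, valueFun, ← integral_sub (hfD.2 _ ht x) (hfD.2 _ ht y), ← Real.norm_eq_abs]
  refine (norm_integral_le_of_norm_le_const (.of_forall fun ω => ?_)).trans_eq
    (by rw [probReal_univ, mul_one])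
  have := abs_sub_le_holderSeminorm hf.2 (x + X (T - t) ω) (y + X (T - t) ω)
  simpa using this

theorem valueFun_mem_holderSpace (hη : 0 < η) (hf : f ∈ holderSpace η) (hfD : f ∈ classD T X P)
    {t : ℝ} (ht : T - t ∈ Icc 0 T) : valueFun T X P f t ∈ holderSpace η := by
  have h := (holderSeminorm_le (abs_valueFun_sub_le hf hfD ht)).trans_lt ENNReal.ofReal_lt_top
  exact ⟨(continuous_of_holderSeminorm_lt_top hη h).measurable, h⟩

theorem continuous_valueFun (hη : 0 < η) (hf : f ∈ holderSpace η) (hfD : f ∈ classD T X P)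
    {t : ℝ} (ht : T - t ∈ Icc 0 T) : Continuous (valueFun T X P f t) :=
  continuous_of_holderSeminorm_lt_top hη (valueFun_mem_holderSpace hη hf hfD ht).2

theorem abs_diffQuot_le (h0 : 0 ≤ η) (h1 : η ≤ 1) {c' : ℝ} {β : ℝ≥0∞} {A : Set ℝ}
    (hc' : 0 < c') (hX : ∀ s ∈ Icc 0 T, Measurable (X s)) (hf : f ∈ holderSpace η)
    (hfD : f ∈ classD T X P) (hTV : TVBound T β A c' X P) {z : ℝ} (hz : z ∈ A) (hz0 : z ≠ 0)
    {t t₁ : ℝ} (ht : t ∈ Ico 0 T) (ht₁ : t ≤ t₁) (ht₁T : t₁ < T) (x : ℝ) :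
    |(valueFun T X P f t (x + z) - valueFun T X P f t x) / z| ≤
      2 * (c' + 2) * (holderSeminorm η f).toReal * ((T - t₁) ^ recip β) ^ (η - 1) := by
  have h := enorm_diffQuot_le_of_holder h0 h1 hc' hX hf hfD hTV hz hz0 ht x
  have hp : 0 < (T - t₁) ^ recip β := Real.rpow_pos_of_pos (by linarith) _
  rw [← ENNReal.ofReal_toReal hf.2.ne, ← ENNReal.ofReal_mul (by positivity),
    ← ENNReal.ofReal_mul (by positivity), ← ofReal_norm, Real.norm_eq_abs,
    ENNReal.ofReal_le_ofReal_iff] at h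
  · refine h.trans ?_
    gcongr
    refine (min_le_right _ _).trans (Real.rpow_le_rpow_of_nonpos hp ?_ (by linarith))
    exact Real.rpow_le_rpow (by linarith) (by linarith) (recip_nonneg _)
  · have : 0 ≤ (T - t) ^ recip β := Real.rpow_nonneg (by linarith [ht.2]) _
    positivity

/-- Dominated convergence in z: each quotient is jointly continuous, and away from T all quotients
share a constant bound on the support of ρ. -/
theorem IsLevyProcess.continuousOn_gradient (hX : IsLevyProcess T X P) (h0 : 0 < η) (h1 : η ≤ 1)
    {c' : ℝ} {β : ℝ≥0∞} {ρ : Measure ℝ} [IsProbabilityMeasure ρ] (hc' : 0 < c')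
    (hf : f ∈ holderSpace η) (hfD : f ∈ classD T X P) (hTV : TVBound T β ρ.support c' X P) :
    ContinuousOn (fun p : ℝ × ℝ => gradient T X P ρ f p.1 p.2) (Ico 0 T ×ˢ univ) := by
  rintro ⟨t, x⟩ ⟨ht, -⟩
  have htT : t < T := ht.2
  -- Nearby times stay below t₁ < T, so the bound at t₁ dominates uniformly.
  set t₁ := (t + T) / 2 with ht₁
  refine continuousWithinAt_of_dominated (bound := fun _ => 2 * (c' + 2) *
    (holderSeminorm η f).toReal * ((T - t₁) ^ recip β) ^ (η - 1)) ?_ ?_ (integrable_const _) ?_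
  · filter_upwards [self_mem_nhdsWithin] with p hp
    have hc := continuous_valueFun h0 hf hfD (sub_mem_Icc_of_mem_Ico hp.1)
    have hm : Measurable fun z =>
        (valueFun T X P f p.1 (p.2 + z) - valueFun T X P f p.1 p.2) / z :=
      ((hc.measurable.comp (measurable_const.add measurable_id)).sub measurable_const).div
        measurable_id
    exact hm.aestronglyMeasurable
  · have hev : ∀ᶠ p : ℝ × ℝ in 𝓝[Ico 0 T ×ˢ univ] (t, x), p.1 < t₁ :=
      (continuous_fst.tendsto (t, x)).eventually_lt_const (by simp only [ht₁]; linarith)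
        |>.filter_mono nhdsWithin_le_nhds
    filter_upwards [self_mem_nhdsWithin, hev] with p hp hp₁
    rw [ae_restrict_iff' (measurableSet_singleton 0).compl]
    filter_upwards [ρ.support_mem_ae] with z hz hz0
    exact abs_diffQuot_le h0.le h1 hc' hX.measurable hf hfD hTV hz hz0 hp.1 hp₁.le
      (by simp only [ht₁]; linarith) p.2
  · refine .of_forall fun z => ContinuousWithinAt.div_const ?_ z
    set L := (holderSeminorm η f).toReal
    have hL := abs_sub_le_holderSeminorm hf.2
    -- For fixed z the increment f(·+z) - f is bounded, although f itself need not be.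
    have hψ := hX.continuousOn_integral h0 (ψ := fun y => f (y + z) - f y) (B := L * |z| ^ η)
      (L := 2 * L) ((hf.1.comp (measurable_id.add_const z)).sub hf.1)
      (fun y => by simpa using hL (y + z) y) (fun y y' => by
        have a := hL (y + z) (y' + z)
        have b := hL y' y
        rw [add_sub_add_right_eq_sub] at a
        rw [abs_sub_comm y' y] at b
        calc _ = |(f (y + z) - f (y' + z)) + (f y' - f y)| := by congr 1; ring
          _ ≤ _ := (abs_add_le _ _).trans (by linarith))
    have hmaps : MapsTo (fun p : ℝ × ℝ => (T - p.1, p.2)) (Ico 0 T ×ˢ univ) (Icc 0 T ×ˢ univ) :=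
      fun p hp => ⟨sub_mem_Icc_of_mem_Ico hp.1, mem_univ _⟩
    have hcomp := hψ.comp (Continuous.continuousOn (by fun_prop)) hmaps
    refine (hcomp.congr fun p hp => ?_) (t, x) ⟨ht, mem_univ _⟩
    have hs := sub_mem_Icc_of_mem_Ico hp.1
    simp only [Function.comp_apply]
    rw [valueFun, valueFun, ← integral_sub (hfD.2 _ hs _) (hfD.2 _ hs _)]
    refine integral_congr_ae (.of_forall fun ω => ?_)
    simp only [add_right_comm]

/-- A jointly continuous function of time and a càdlàg path is càdlàg. -/
theorem isCadlagOn_comp {G : ℝ × ℝ → ℝ} (hG : ContinuousOn G (Ico 0 T ×ˢ univ)) {p : ℝ → ℝ}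
    (hp : IsCadlagOn (Icc 0 T) p) : IsCadlagOn (Ico 0 T) fun t => G (t, p t) := by
  intro t ht
  obtain ⟨hr, l, hl⟩ := hp t ⟨ht.1, ht.2.le⟩
  have hsub : ∀ s : Set ℝ, 𝓝[Ico 0 T ∩ s] t ≤ 𝓝[Icc 0 T ∩ s] t := fun s =>
    nhdsWithin_mono _ (inter_subset_inter_left _ Ico_subset_Icc_self)
  have key : ∀ (s : Set ℝ) (y : ℝ), Tendsto p (𝓝[Ico 0 T ∩ s] t) (𝓝 y) →
      Tendsto (fun u => G (u, p u)) (𝓝[Ico 0 T ∩ s] t) (𝓝 (G (t, y))) := by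
    intro s y h
    refine (hG (t, y) ⟨ht, mem_univ _⟩).tendsto.comp (tendsto_nhdsWithin_iff.2 ⟨?_, ?_⟩)
    · exact (tendsto_id.mono_left nhdsWithin_le_nhds).prodMk_nhds h
    · filter_upwards [self_mem_nhdsWithin] with u hu using ⟨hu.1, mem_univ _⟩
  exact ⟨key _ _ (hr.tendsto.mono_left (hsub _)), _, key _ _ (hl.mono_left (hsub _))⟩

/-- The freezing principle: the joint law is a product, so H may be held fixed while D is replaced
by a variable of the same law. -/
theorem integral_comp_prodMk_of_indepFun {α : Type*} [MeasurableSpace α] {H : Ω → α}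
    {D D' : Ω → ℝ} (hH : Measurable H) (hD : Measurable D) (hD' : Measurable D')
    (hind : IndepFun H D P) (hlaw : P.map D = P.map D') {Ψ : α × ℝ → ℝ} (hΨ : Measurable Ψ)
    (hint : Integrable (fun ω => Ψ (H ω, D ω)) P) :
    ∫ ω, Ψ (H ω, D ω) ∂P = ∫ ω, ∫ ω', Ψ (H ω, D' ω') ∂P ∂P := by
  have hprod := (indepFun_iff_map_prod_eq_prod_map_map hH.aemeasurable hD.aemeasurable).1 hind
  have hHD : Measurable fun ω => (H ω, D ω) := hH.prodMk hD
  have hint' : Integrable Ψ ((P.map H).prod (P.map D)) := by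
    rw [← hprod]
    exact (integrable_map_measure hΨ.aestronglyMeasurable hHD.aemeasurable).2 hint
  have := Measure.isProbabilityMeasure_map (μ := P) hH.aemeasurable
  have := Measure.isProbabilityMeasure_map (μ := P) hD.aemeasurable
  rw [← integral_map hHD.aemeasurable hΨ.aestronglyMeasurable, hprod, integral_prod _ hint',
    integral_map hH.aemeasurable (hint'.integral_prod_left.aestronglyMeasurable)]
  refine integral_congr_ae (.of_forall fun ω => ?_)
  dsimp only
  have hm : Measurable fun y => Ψ (H ω, y) := hΨ.comp (measurable_const.prodMk measurable_id)
  rw [hlaw, integral_map hD'.aemeasurable hm.aestronglyMeasurable]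

/-- The semigroup property: X_{T-u} is X_{v-u} plus an independent increment distributed like
X_{T-v}. -/
theorem IsLevyProcess.valueFun_eq (hX : IsLevyProcess T X P) (hf : f ∈ classD T X P) {u v : ℝ}
    (hu : 0 ≤ u) (huv : u ≤ v) (hv : v ≤ T) (y : ℝ) :
    valueFun T X P f u y = ∫ ω, valueFun T X P f v (y + X (v - u) ω) ∂P := by
  have h1 : v - u ∈ Icc 0 T := ⟨by linarith, by linarith⟩
  have h2 : T - u ∈ Icc 0 T := ⟨by linarith, by linarith⟩
  have h3 : T - v ∈ Icc 0 T := ⟨by linarith, by linarith⟩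
  have hlaw := hX.stationary (v - u) (T - u) h1.1 (by linarith) h2.2
  rw [show T - u - (v - u) = T - v by ring] at hlaw
  have h := integral_comp_prodMk_of_indepFun (hX.measurable _ h1)
    ((hX.measurable _ h2).sub (hX.measurable _ h1)) (hX.measurable _ h3)
    (hX.indepFun_sub h1.1 (by linarith) h2.2) hlaw (Ψ := fun p => f (y + p.1 + p.2))
    (hf.1.comp (by fun_prop)) ((hf.2 _ h2 y).congr (.of_forall fun ω => by simp [add_assoc]))
  simp only [valueFun]
  rw [← h]
  refine integral_congr_ae (.of_forall fun ω => ?_)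
  simp [add_assoc]

/-- The semigroup property of F passes through the ρ-integral by Fubini, since the quotients at time
v < T are bounded. -/
theorem IsLevyProcess.gradient_eq (hX : IsLevyProcess T X P) (h0 : 0 < η) (h1 : η ≤ 1)
    {c' : ℝ} {β : ℝ≥0∞} {ρ : Measure ℝ} [IsProbabilityMeasure ρ] (hc' : 0 < c')
    (hL : SubsetLp T η X P) (hf : f ∈ holderSpace η) (hTV : TVBound T β ρ.support c' X P)
    {u v : ℝ} (hu : 0 ≤ u) (huv : u ≤ v) (hv : v < T) (x : ℝ) :
    gradient T X P ρ f u x = ∫ ω, gradient T X P ρ f v (x + X (v - u) ω) ∂P := by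
  have hfD := mem_classD_of_holder h0.le hX.measurable hL hf
  have hvI : v ∈ Ico 0 T := ⟨hu.trans huv, hv⟩
  have hs := sub_mem_Icc_of_mem_Ico hvI
  have hvu : v - u ∈ Icc 0 T := ⟨by linarith, by linarith⟩
  have hFc := continuous_valueFun h0 hf hfD hs
  have hFD := mem_classD_of_holder h0.le hX.measurable hL (valueFun_mem_holderSpace h0 hf hfD hs)
  have hXm := hX.measurable _ hvu
  have e1 : gradient T X P ρ f u x = ∫ z in ({0}ᶜ : Set ℝ), ∫ ω,
      (valueFun T X P f v (x + X (v - u) ω + z) - valueFun T X P f v (x + X (v - u) ω)) / z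
        ∂P ∂ρ := by
    refine integral_congr_ae (.of_forall fun z => ?_)
    dsimp only
    rw [hX.valueFun_eq hfD hu huv hv.le, hX.valueFun_eq hfD hu huv hv.le,
      ← integral_sub (hFD.2 _ hvu _) (hFD.2 _ hvu _), ← integral_div]
    simp only [add_right_comm]
  rw [e1, integral_integral_swap]
  · rfl
  · refine Integrable.mono' (integrable_const (2 * (c' + 2) * (holderSeminorm η f).toReal *
      ((T - v) ^ recip β) ^ (η - 1))) ?_ ?_
    · refine Measurable.aestronglyMeasurable ?_
      refine Measurable.div ((hFc.measurable.comp ?_).sub (hFc.measurable.comp ?_)) measurable_fst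
      · exact (measurable_const.add (hXm.comp measurable_snd)).add measurable_fst
      · exact measurable_const.add (hXm.comp measurable_snd)
    · have hae : ∀ᵐ z ∂(ρ.restrict {0}ᶜ), z ∈ ρ.support ∧ z ≠ 0 := by
        rw [ae_restrict_iff' (measurableSet_singleton 0).compl]
        filter_upwards [ρ.support_mem_ae] with z hz hz0 using ⟨hz, hz0⟩
      have hq : Tendsto Prod.fst (ae ((ρ.restrict {0}ᶜ).prod P)) (ae (ρ.restrict {0}ᶜ)) :=
        Measure.quasiMeasurePreserving_fst.tendsto_ae
      filter_upwards [hq.eventually hae] with p hp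
      exact abs_diffQuot_le h0.le h1 hc' hX.measurable hf hfD hTV hp.1 hp.2 hvI le_rfl hv _

end Regularity

/-! ### Independence of the augmented filtration and future increments -/

section Independence

variable {Ω : Type*} [m : MeasurableSpace Ω] {P : Measure Ω} {X : ℝ → Ω → ℝ} {T : ℝ}

/-- Independence is not affected by adding the null sets. -/
theorem indep_sup_generateFrom_null {Ω : Type*} {m₁ m₂ m : MeasurableSpace Ω}
    {P : Measure Ω} (h : Indep m₁ m₂ P) :
    Indep (m₁ ⊔ MeasurableSpace.generateFrom {N | P N = 0}) m₂ P := by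
  -- Every set of the enlarged σ-algebra differs from a set of m₁ by a null set, which probabilities
  -- do not see.
  have hle : m₁ ⊔ MeasurableSpace.generateFrom {N | P N = 0} ≤
      @eventuallyMeasurableSpace Ω m₁ (ae P) _ :=
    sup_le (@le_eventuallyMeasurableSpace Ω m₁ (ae P) _)
      (MeasurableSpace.generateFrom_le fun N hN =>
        ⟨∅, @MeasurableSet.empty Ω m₁, ae_eq_empty.2 hN⟩)
  rw [Indep_iff] at h ⊢
  intro A D hA hD
  obtain ⟨B, hB, hAB⟩ := hle A hA
  rw [measure_congr (hAB.inter (ae_eq_refl D)), measure_congr hAB]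
  exact h B D hB hD

/-- Values at finitely many times up to u are telescoping sums of increments over a grid ending at
u; the next increment of the extended grid is X_v - X_u. -/
theorem IsLevyProcess.indep_finset (hX : IsLevyProcess T X P) {u v : ℝ} (hu : 0 ≤ u)
    (huv : u ≤ v) (hv : v ≤ T) (F : Finset (Icc 0 u)) :
    Indep (⨆ s ∈ F, MeasurableSpace.comap (X s) inferInstance)
      (MeasurableSpace.comap (fun ω => X v ω - X u ω) inferInstance) P := by
  classical
  have hT : 0 ≤ T := hu.trans (huv.trans hv)
  let o : Icc 0 T := ⟨0, le_rfl, hT⟩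
  let u' : Icc 0 T := ⟨u, hu, huv.trans hv⟩
  let v' : Icc 0 T := ⟨v, hu.trans huv, hv⟩
  let i : Icc 0 u → Icc 0 T := fun s => ⟨s, s.2.1, s.2.2.trans (huv.trans hv)⟩
  -- The time 0 is added so that the sums telescope from X_0 = 0, the time u so that the grid ends
  -- there.
  set E : Finset (Icc 0 T) := insert o (insert u' (F.image i)) with hE
  have hEu : ∀ s ∈ E, s ≤ u' := by
    intro s hs
    simp only [hE, Finset.mem_insert, Finset.mem_image] at hs
    rcases hs with rfl | rfl | ⟨r, -, rfl⟩
    · exact hu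
    · exact le_rfl
    · exact r.2.2
  have hne : E.Nonempty := ⟨o, Finset.mem_insert_self _ _⟩
  have hn : 0 < E.card := hne.card_pos
  set n := E.card with hn_def
  let e := E.orderEmbOfFin rfl
  -- From index n on the sequence is constantly v, so increment number n-1 runs from u to v.
  let τ : ℕ → Icc 0 T := fun k => if h : k < n then e ⟨k, h⟩ else v'
  have hτlt : ∀ k (h : k < n), τ k = e ⟨k, h⟩ := fun k h => dif_pos h
  have hτge : ∀ k, n ≤ k → τ k = v' := fun k h => dif_neg (not_lt.2 h)
  have hle : ∀ k (h : k < n), e ⟨k, h⟩ ≤ v' := fun k h =>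
    (hEu _ (E.orderEmbOfFin_mem rfl _)).trans huv
  have hmono : Monotone τ := by
    intro j k hjk
    rcases lt_or_ge k n with hk | hk
    · rw [hτlt k hk, hτlt j (hjk.trans_lt hk)]
      exact e.monotone hjk
    · rw [hτge k hk]
      rcases lt_or_ge j n with hj | hj
      · rw [hτlt j hj]; exact hle j hj
      · rw [hτge j hj]
  have hτ0 : τ 0 = o := by
    rw [hτlt 0 hn]
    refine le_antisymm ?_ (e ⟨0, hn⟩).2.1
    have : e ⟨0, hn⟩ = E.min' hne := E.orderEmbOfFin_zero rfl hn
    rw [this]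
    exact E.min'_le _ (Finset.mem_insert_self _ _)
  have hτn : τ (n - 1) = u' := by
    rw [hτlt (n - 1) (by omega)]
    refine le_antisymm (hEu _ (E.orderEmbOfFin_mem rfl _)) ?_
    have : e ⟨n - 1, by omega⟩ = E.max' hne := E.orderEmbOfFin_last rfl hn
    rw [this]
    exact E.le_max' _ (by simp [hE])
  have hmX : ∀ s : Icc 0 T, Measurable (X s) := fun s => hX.measurable s s.2
  have hinc := hX.indep.nat hmono
  have hind := hinc.indepFun_finset (Finset.range (n - 1)) {n - 1} (by simp)
    (fun k => (hmX _).sub (hmX _))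
  have hD : Measurable[MeasurableSpace.comap (fun ω (k : ({n - 1} : Finset ℕ)) =>
      X (τ (k + 1)) ω - X (τ k) ω) inferInstance] (fun ω => X v ω - X u ω) := by
    have h := (measurable_pi_apply (X := fun _ : ({n - 1} : Finset ℕ) => ℝ)
      ⟨n - 1, Finset.mem_singleton_self _⟩).comp
      (comap_measurable (fun ω (k : ({n - 1} : Finset ℕ)) => X (τ (k + 1)) ω - X (τ k) ω))
    convert h using 1
    ext ω
    simp only [Function.comp_apply]
    rw [show n - 1 + 1 = n by omega, hτge n le_rfl, hτn]
  have hF : ∀ s ∈ F, Measurable[MeasurableSpace.comap (fun ω (k : Finset.range (n - 1)) =>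
      X (τ (k + 1)) ω - X (τ k) ω) inferInstance] (X s) := by
    intro s hs
    obtain ⟨⟨j, hj⟩, hjs⟩ : ∃ j, e j = i s := by
      have : i s ∈ Set.range e := by
        rw [E.range_orderEmbOfFin rfl]
        simp only [hE, Finset.coe_insert, Finset.coe_image]
        exact Or.inr (Or.inr ⟨s, hs, rfl⟩)
      exact this
    have hsum : X s = fun ω => ∑ k ∈ (Finset.range j).attach,
        (X (τ (k + 1)) ω - X (τ k) ω) := by
      ext ω
      rw [Finset.sum_attach (Finset.range j) (fun k => X (τ (k + 1)) ω - X (τ k) ω),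
        Finset.sum_range_sub (fun k => X (τ k) ω), hτ0, hX.zero, sub_zero, hτlt j hj, hjs]
    rw [hsum]
    refine Finset.measurable_fun_sum _ fun k _ => ?_
    have hk : (k : ℕ) ∈ Finset.range (n - 1) := by
      have := Finset.mem_range.1 k.2
      exact Finset.mem_range.2 (by omega)
    exact (measurable_pi_apply (X := fun _ : Finset.range (n - 1) => ℝ) ⟨k, hk⟩).comp
      (comap_measurable (fun ω (k : Finset.range (n - 1)) => X (τ (k + 1)) ω - X (τ k) ω))
  have hind' : Indep _ _ P := hind
  exact indep_of_indep_of_le_left (indep_of_indep_of_le_right hind' hD.comap_le)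
    (iSup₂_le fun s hs => (hF s hs).comap_le)

theorem IsLevyProcess.measurable_augmentedFiltration [P.IsComplete] (hX : IsLevyProcess T X P)
    {u s : ℝ} (hs : s ∈ Icc 0 u) (hu : u ≤ T) :
    Measurable[augmentedFiltration T X P hX.measurable u] (X s) := by
  refine Measurable.of_comap_le ?_
  refine le_trans ?_ (le_sup_left (b := MeasurableSpace.generateFrom {N | P N = 0}))
  rw [min_eq_left hu]
  exact le_iSup₂_of_le (f := fun s (_ : s ∈ Icc 0 u) =>
    MeasurableSpace.comap (X s) inferInstance) s hs le_rfl

variable [IsProbabilityMeasure P]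

/-- The σ-algebras of finite sets of times form a directed family, along which independence passes
to the supremum. -/
theorem IsLevyProcess.indep_natural (hX : IsLevyProcess T X P) {u v : ℝ} (hu : 0 ≤ u)
    (huv : u ≤ v) (hv : v ≤ T) :
    Indep (⨆ s ∈ Icc 0 u, MeasurableSpace.comap (X s) inferInstance)
      (MeasurableSpace.comap (fun ω => X v ω - X u ω) inferInstance) P := by
  classical
  have hm : ∀ s ∈ Icc 0 u, Measurable (X s) := fun s hs =>
    hX.measurable s ⟨hs.1, hs.2.trans (huv.trans hv)⟩
  have hD : Measurable fun ω => X v ω - X u ω :=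
    (hX.measurable v ⟨hu.trans huv, hv⟩).sub (hX.measurable u ⟨hu, huv.trans hv⟩)
  have h := indep_iSup_of_directed_le (fun F => hX.indep_finset hu huv hv F)
    (fun F => iSup₂_le fun s _ => (hm s s.2).comap_le) hD.comap_le
    (fun F F' => ⟨F ∪ F', biSup_mono fun s hs => Finset.mem_union_left _ hs,
      biSup_mono fun s hs => Finset.mem_union_right _ hs⟩)
  refine indep_of_indep_of_le_left h (iSup₂_le fun s hs => ?_)
  refine le_iSup_of_le {⟨s, hs⟩} ?_
  simp

theorem IsLevyProcess.indep_augmentedFiltration [P.IsComplete] (hX : IsLevyProcess T X P)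
    {u v : ℝ} (hu : 0 ≤ u) (huv : u ≤ v) (hv : v ≤ T) :
    Indep (augmentedFiltration T X P hX.measurable u)
      (MeasurableSpace.comap (fun ω => X v ω - X u ω) inferInstance) P := by
  have h := indep_sup_generateFrom_null (hX.indep_natural hu huv hv)
  have e : (augmentedFiltration T X P hX.measurable u : MeasurableSpace Ω) =
      (⨆ s ∈ Icc 0 u, MeasurableSpace.comap (X s) inferInstance) ⊔
        MeasurableSpace.generateFrom {N | P N = 0} := by
    rw [← min_eq_left (huv.trans hv)]
    simp [augmentedFiltration]
  rwa [e]

/-- Increments of `G(t, X_t)` are orthogonal to the past if `G` has the semigroup property. -/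
theorem IsLevyProcess.integral_mul_sub_eq_zero [P.IsComplete] (hX : IsLevyProcess T X P)
    {u v : ℝ} (hu : 0 ≤ u) (huv : u ≤ v) (hv : v ≤ T) {g g' : ℝ → ℝ} (hg : Measurable g)
    {B B' : ℝ} (hB : ∀ x, |g x| ≤ B) (hg' : ∀ x, g' x = ∫ ω, g (x + X (v - u) ω) ∂P)
    {Z : Ω → ℝ} (hZ : Measurable[augmentedFiltration T X P hX.measurable u] Z)
    (hZB : ∀ ω, |Z ω| ≤ B') :
    ∫ ω, Z ω * g (X v ω) ∂P = ∫ ω, Z ω * g' (X u ω) ∂P := by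
  have huI : u ∈ Icc 0 T := ⟨hu, huv.trans hv⟩
  have hvI : v ∈ Icc 0 T := ⟨hu.trans huv, hv⟩
  have hXu := hX.measurable_augmentedFiltration (u := u) ⟨hu, le_rfl⟩ huI.2
  have hFle := (augmentedFiltration T X P hX.measurable).le u
  -- Z and X_u are frozen together; averaging the independent increment turns g into g'.
  have hH : Measurable[augmentedFiltration T X P hX.measurable u] fun ω => (Z ω, X u ω) :=
    Measurable.prodMk hZ hXu
  have hind : IndepFun (fun ω => (Z ω, X u ω)) (fun ω => X v ω - X u ω) P :=
    indep_of_indep_of_le_left (hX.indep_augmentedFiltration hu huv hv) hH.comap_le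
  have hZm : Measurable Z := hZ.mono hFle le_rfl
  have hB0 : 0 ≤ B := (abs_nonneg _).trans (hB 0)
  have hint : Integrable (fun ω => Z ω * g (X u ω + (X v ω - X u ω))) P := by
    refine Integrable.mono' (integrable_const (B' * B)) ?_ (.of_forall fun ω => ?_)
    · exact (hZm.mul (hg.comp ((hX.measurable u huI).add
        ((hX.measurable v hvI).sub (hX.measurable u huI))))).aestronglyMeasurable
    · rw [Real.norm_eq_abs, abs_mul]
      exact mul_le_mul (hZB ω) (hB _) (abs_nonneg _) ((abs_nonneg _).trans (hZB ω))
  have h := integral_comp_prodMk_of_indepFun (hH.mono hFle le_rfl)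
    ((hX.measurable v hvI).sub (hX.measurable u huI))
    (hX.measurable (v - u) ⟨by linarith, by linarith⟩) hind
    (hX.stationary u v hu huv hv) (Ψ := fun p : (ℝ × ℝ) × ℝ => p.1.1 * g (p.1.2 + p.2))
    (by fun_prop) hint
  simp only [Pi.sub_apply, add_sub_cancel] at h
  rw [h]
  refine integral_congr_ae (.of_forall fun ω => ?_)
  simp only [hg', integral_const_mul]

end Independence

/-! ### Right-continuous processes -/

/-- Time is rounded to the next grid point strictly to its right; the rounded processes take
countably many times and converge by right-continuity. -/
theorem measurable_uncurry_of_rightContinuous {Ω : Type*} [MeasurableSpace Ω]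
    {N : ℝ → Ω → ℝ} (hN : ∀ r, Measurable (N r))
    (hr : ∀ ω r, ContinuousWithinAt (fun r => N r ω) (Ioi r) r) :
    Measurable (fun p : ℝ × Ω => N p.1 p.2) := by
  let d : ℕ → ℤ → ℝ := fun n k => (k + 1) / (n + 1)
  let a : ℕ → ℝ → ℝ := fun n r => d n ⌊(n + 1) * r⌋
  have hlt : ∀ n r, r < a n r := fun n r => by
    have := Int.lt_floor_add_one (((n : ℝ) + 1) * r)
    simp only [a, d]
    rw [lt_div_iff₀ (by positivity), mul_comm]
    exact this
  have hle : ∀ n r, a n r ≤ r + 1 / (n + 1) := fun n r => by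
    have := Int.floor_le (((n : ℝ) + 1) * r)
    have hn : (0 : ℝ) < n + 1 := by positivity
    simp only [a, d]
    rw [div_le_iff₀ hn, add_mul r, one_div_mul_cancel hn.ne']
    linarith
  have hlim : ∀ r, Tendsto (fun n => a n r) atTop (𝓝[>] r) := fun r => by
    refine tendsto_nhdsWithin_iff.2 ⟨?_, .of_forall fun n => hlt n r⟩
    have h1 : Tendsto (fun n : ℕ => r + 1 / ((n : ℝ) + 1)) atTop (𝓝 r) := by
      simpa using tendsto_const_nhds.add (tendsto_one_div_add_atTop_nhds_zero_nat (𝕜 := ℝ))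
    exact tendsto_of_tendsto_of_tendsto_of_le_of_le tendsto_const_nhds h1
      (fun n => (hlt n r).le) fun n => hle n r
  refine measurable_of_tendsto_metrizable (f := fun n (p : ℝ × Ω) => N (a n p.1) p.2)
    (fun n => ?_) (tendsto_pi_nhds.2 fun p => (hr p.2 p.1).tendsto.comp (hlim p.1))
  have h1 : Measurable fun p : ℤ × Ω => N (d n p.1) p.2 :=
    measurable_from_prod_countable_right fun k => hN (d n k)
  have h2 : Measurable fun p : ℝ × Ω => (⌊((n : ℝ) + 1) * p.1⌋, p.2) :=
    ((Int.measurable_floor.comp (measurable_const_mul _)).comp measurable_fst).prodMk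
      measurable_snd
  exact h1.comp h2

/-! ### The Riemann-Liouville operator along a path -/

section RiemannLiouville

theorem intervalIntegrable_sub_rpow {T α : ℝ} (hα : 0 < α) (s : ℝ) :
    IntervalIntegrable (fun r : ℝ => (T - r) ^ (α - 1)) volume s T := by
  have h := (intervalIntegral.intervalIntegrable_rpow' (a := T - s) (b := T - T)
    (r := α - 1) (by linarith)).comp_sub_left T
  simpa using h

theorem integrableOn_sub_rpow {T α s : ℝ} (hα : 0 < α) (hs : s ≤ T) :
    IntegrableOn (fun r : ℝ => (T - r) ^ (α - 1)) (Ioo s T) :=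
  ((intervalIntegrable_iff_integrableOn_Ioo_of_le hs).1 (intervalIntegrable_sub_rpow hα s))

theorem integral_sub_rpow {T α s : ℝ} (hα : 0 < α) (hs : s ≤ T) :
    ∫ r in Ioo s T, (T - r) ^ (α - 1) = (T - s) ^ α / α := by
  rw [← integral_Ioc_eq_integral_Ioo, ← intervalIntegral.integral_of_le hs,
    intervalIntegral.integral_comp_sub_left (fun x : ℝ => x ^ (α - 1)) T,
    integral_rpow (Or.inl (by linarith))]
  simp [Real.zero_rpow hα.ne']

theorem lintegral_sub_rpow {T α s : ℝ} (hα : 0 < α) (hs : s ≤ T) :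
    ∫⁻ r in Ioo s T, ENNReal.ofReal ((T - r) ^ (α - 1)) = ENNReal.ofReal ((T - s) ^ α / α) := by
  rw [← integral_sub_rpow hα hs, ofReal_integral_eq_lintegral_ofReal (integrableOn_sub_rpow hα hs)]
  rw [Filter.EventuallyLE, ae_restrict_iff' measurableSet_Ioo]
  exact .of_forall fun r hr => Real.rpow_nonneg (by linarith [hr.2]) _

theorem integrableOn_sub_rpow_mul {T α B : ℝ} (hα : 0 < α) (hT : 0 ≤ T) {k : ℝ → ℝ}
    (hk : AEStronglyMeasurable k (volume.restrict (Ioo 0 T))) (hB : ∀ r ∈ Ioo 0 T, |k r| ≤ B) :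
    IntegrableOn (fun r : ℝ => (T - r) ^ (α - 1) * k r) (Ioo 0 T) := by
  refine Integrable.mul_bdd (c := B) (integrableOn_sub_rpow hα hT) hk ?_
  rw [ae_restrict_iff' measurableSet_Ioo]
  exact .of_forall hB

theorem riemannLiouville_sub {T α B t s : ℝ} (hα : 0 < α) (hT : 0 ≤ T) {K : ℝ → ℝ}
    (hs : s ∈ Icc 0 t)
    (hK : ∀ s ∈ Icc 0 t, AEStronglyMeasurable (fun r => K (min r s)) (volume.restrict (Ioo 0 T)))
    (hB : ∀ r ∈ Icc 0 t, |K r| ≤ B) :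
    riemannLiouville T α K t - riemannLiouville T α K s =
      α / T ^ α * ∫ r in Ioo 0 T, (T - r) ^ (α - 1) * (K (min r t) - K (min r s)) := by
  have hint : ∀ s ∈ Icc 0 t,
      IntegrableOn (fun r : ℝ => (T - r) ^ (α - 1) * K (min r s)) (Ioo 0 T) := fun s hs =>
    integrableOn_sub_rpow_mul hα hT (hK s hs) fun r hr =>
      hB _ ⟨le_min hr.1.le hs.1, (min_le_right _ _).trans hs.2⟩
  rw [riemannLiouville, riemannLiouville, ← mul_sub,
    ← integral_sub (hint t ⟨hs.1.trans hs.2, le_rfl⟩) (hint s hs)]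
  simp only [mul_sub]

/-- The paths stopped at t and at s agree up to time s, so only the weight (T-s)^α/α of the interval
(s,T) matters. -/
theorem abs_riemannLiouville_sub_le {T α B t s : ℝ} (hα : 0 < α) (hT : 0 < T) {K : ℝ → ℝ}
    (hs : s ∈ Icc 0 t) (ht : t < T)
    (hK : ∀ s ∈ Icc 0 t, AEStronglyMeasurable (fun r => K (min r s)) (volume.restrict (Ioo 0 T)))
    (hB : ∀ r ∈ Icc 0 t, |K r| ≤ B) :
    |riemannLiouville T α K t - riemannLiouville T α K s| ≤ 2 * B * ((T - s) ^ α / T ^ α) := by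
  have hB0 : 0 ≤ B := (abs_nonneg _).trans (hB s hs)
  have hsT : s ≤ T := hs.2.trans ht.le
  rw [riemannLiouville_sub hα hT.le hs hK hB, abs_mul, abs_of_nonneg (by positivity)]
  have h1 : |∫ r in Ioo 0 T, (T - r) ^ (α - 1) * (K (min r t) - K (min r s))| ≤
      ∫ r in Ioo 0 T, (Ioo s T).indicator (fun r => (T - r) ^ (α - 1) * (2 * B)) r := by
    rw [← Real.norm_eq_abs]
    refine norm_integral_le_of_norm_le ?_ ?_
    · have hi : IntegrableOn (fun r : ℝ => (T - r) ^ (α - 1) * (2 * B)) (Ioo s T) :=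
        Integrable.mul_const (integrableOn_sub_rpow hα hsT) _
      exact (hi.integrable_indicator measurableSet_Ioo).integrableOn
    · rw [ae_restrict_iff' measurableSet_Ioo]
      refine .of_forall fun r hr => ?_
      rcases le_or_gt r s with h | h
      · rw [min_eq_left (h.trans hs.2), min_eq_left h, sub_self, mul_zero, norm_zero]
        exact indicator_nonneg (fun r hr => mul_nonneg (Real.rpow_nonneg (by linarith [hr.2]) _)
          (by positivity)) _
      · have hrs : r ∈ Ioo s T := ⟨h, hr.2⟩
        rw [indicator_of_mem hrs, norm_mul, Real.norm_eq_abs,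
          abs_of_nonneg (Real.rpow_nonneg (by linarith [hr.2]) _)]
        refine mul_le_mul_of_nonneg_left ?_ (Real.rpow_nonneg (by linarith [hr.2]) _)
        have a := hB (min r t) ⟨le_min hr.1.le (hs.1.trans hs.2), min_le_right _ _⟩
        have b := hB (min r s) ⟨le_min hr.1.le hs.1, (min_le_right _ _).trans hs.2⟩
        exact (abs_sub _ _).trans (by linarith)
  have h2 : ∫ r in Ioo 0 T, (Ioo s T).indicator (fun r => (T - r) ^ (α - 1) * (2 * B)) r =
      (T - s) ^ α / α * (2 * B) := by
    rw [setIntegral_indicator measurableSet_Ioo,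
      inter_eq_right.2 (Ioo_subset_Ioo_left hs.1 : Ioo s T ⊆ Ioo 0 T), integral_mul_const,
      integral_sub_rpow hα hsT]
  calc _ ≤ α / T ^ α * ((T - s) ^ α / α * (2 * B)) := by gcongr; exact h1.trans_eq h2
    _ = _ := by field_simp

theorem abs_sub_leftValue_le {Y b : ℝ → ℝ} {τ : ℝ} (hτ : 0 ≤ τ)
    (h : ∀ s ∈ Icc 0 τ, |Y τ - Y s| ≤ b s) (hb : ContinuousAt b τ) :
    |Y τ - leftValue Y τ| ≤ b τ := by
  have h0 := h τ ⟨hτ, le_rfl⟩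
  rcases hτ.eq_or_lt with rfl | hpos
  · simpa [leftValue] using h0
  · rw [leftValue, if_neg (not_le.2 hpos)]
    by_cases hl : ∃ y, Tendsto Y (𝓝[<] τ) (𝓝 y)
    · obtain ⟨y, hy⟩ := hl
      rw [leftLim_eq_of_tendsto hy]
      refine le_of_tendsto_of_tendsto (tendsto_const_nhds.sub hy).abs
        (hb.tendsto.mono_left nhdsWithin_le_nhds) ?_
      filter_upwards [Ioo_mem_nhdsLT hpos] with s hs using h s ⟨hs.1.le, hs.2.le⟩
    -- Without a left limit `Function.leftLim` returns the value Y τ itself.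
    · rw [leftLim_eq_of_not_tendsto _ hl]
      exact h0

end RiemannLiouville

/-! ### The conditional second moment of the Riemann-Liouville operator of a martingale -/

section SecondMoment

/-- The process stopped at the deterministic time `t`, extended to the whole line. -/
def stopAt {Ω : Type*} (M : ℝ → Ω → ℝ) (t r : ℝ) (ω : Ω) : ℝ := M (max 0 (min r t)) ω

theorem stopAt_of_nonneg {Ω : Type*} {M : ℝ → Ω → ℝ} {t r : ℝ} (ht : 0 ≤ t) (hr : 0 ≤ r) (ω : Ω) :
    stopAt M t r ω = M (min r t) ω := by
  rw [stopAt, max_eq_right (le_min hr ht)]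

/-- A càdlàg process on `[0,T)` adapted to `𝓕` with a deterministic bound `κ` that is
nondecreasing in time, whose increments are orthogonal to the past. -/
structure BoundedMartingale {Ω : Type*} [m : MeasurableSpace Ω] (T : ℝ) (𝓕 : Filtration ℝ m)
    (P : Measure Ω) (M : ℝ → Ω → ℝ) (κ : ℝ → ℝ≥0∞) : Prop where
  adapted : ∀ t ∈ Ico 0 T, Measurable[𝓕 t] (M t)
  cadlag : ∀ ω, IsCadlagOn (Ico 0 T) (fun t => M t ω)
  mono : Monotone κ
  lt_top : ∀ t < T, κ t < ⊤
  bound : ∀ t ∈ Ico 0 T, ∀ ω, ‖M t ω‖ₑ ≤ κ t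
  orth : ∀ u v, 0 ≤ u → u ≤ v → v < T → ∀ Z : Ω → ℝ, Measurable[𝓕 u] Z →
    ∀ B : ℝ, (∀ ω, |Z ω| ≤ B) → ∫ ω, Z ω * M v ω ∂P = ∫ ω, Z ω * M u ω ∂P

variable {Ω : Type*} [m : MeasurableSpace Ω] {T : ℝ} {𝓕 : Filtration ℝ m}
  {P : Measure Ω} {M : ℝ → Ω → ℝ} {κ : ℝ → ℝ≥0∞}

theorem BoundedMartingale.abs_le (h : BoundedMartingale T 𝓕 P M κ) {s t : ℝ} (hs : s ∈ Icc 0 t)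
    (ht : t < T) (ω : Ω) : |M s ω| ≤ (κ t).toReal := by
  have := (h.bound s ⟨hs.1, hs.2.trans_lt ht⟩ ω).trans (h.mono hs.2)
  rwa [← ofReal_norm, ENNReal.ofReal_le_iff_le_toReal (h.lt_top t ht).ne] at this

theorem max_min_mem {t r : ℝ} (ht : 0 ≤ t) : max 0 (min r t) ∈ Icc 0 t :=
  ⟨le_max_left _ _, max_le ht (min_le_right _ _)⟩

/-- Progressive measurability: the σ-algebra on Ω is `𝓕 t`, not the ambient one. It is needed to
evaluate the process at τ ∧ u inside `𝓕 u`. -/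
theorem BoundedMartingale.measurable_stopAt (h : BoundedMartingale T 𝓕 P M κ) {t : ℝ}
    (ht : t ∈ Ico 0 T) :
    @Measurable _ _ (@Prod.instMeasurableSpace ℝ Ω _ (𝓕 t)) _
      (fun p : ℝ × Ω => stopAt M t p.1 p.2) := by
  refine @measurable_uncurry_of_rightContinuous Ω (𝓕 t) (stopAt M t) (fun r => ?_) fun ω r => ?_
  · have hr := max_min_mem (r := r) ht.1
    exact (h.adapted _ ⟨hr.1, hr.2.trans_lt ht.2⟩).mono (𝓕.mono hr.2) le_rfl
  · have hr := max_min_mem (r := r) ht.1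
    have hc := (h.cadlag ω _ ⟨hr.1, hr.2.trans_lt ht.2⟩).1
    refine hc.tendsto.comp (tendsto_nhdsWithin_iff.2 ⟨?_, ?_⟩)
    · have hcont : Continuous fun r : ℝ => max 0 (min r t) := by fun_prop
      exact (hcont.tendsto r).mono_left nhdsWithin_le_nhds
    · filter_upwards [self_mem_nhdsWithin] with r' hr'
      have hr'' := max_min_mem (r := r') ht.1
      exact ⟨⟨hr''.1, hr''.2.trans_lt ht.2⟩,
        (max_le_max_left 0 (min_le_min_right t (le_of_lt hr')) :
          max 0 (min r t) ≤ max 0 (min r' t))⟩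

theorem BoundedMartingale.measurable_stopAt' (h : BoundedMartingale T 𝓕 P M κ) {t : ℝ}
    (ht : t ∈ Ico 0 T) : Measurable (fun p : ℝ × Ω => stopAt M t p.1 p.2) := by
  refine (h.measurable_stopAt ht).mono ?_ le_rfl
  exact sup_le_sup le_rfl (MeasurableSpace.comap_mono (𝓕.le t))

theorem measurable_min_of_forall_lt {Ω : Type*} [MeasurableSpace Ω] {τ : Ω → ℝ} {u : ℝ}
    (h : ∀ r < u, MeasurableSet {ω | τ ω ≤ r}) : Measurable (fun ω => min (τ ω) u) := by
  refine measurable_of_Iic fun r => ?_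
  rcases le_or_gt u r with hur | hur
  · convert! MeasurableSet.univ (α := Ω)
    ext ω
    simp [hur]
  · convert! h r hur using 1
    ext ω
    simp [hur]

theorem measurable_min_of_isStoppingTime {τ : Ω → ℝ}
    (hτ : IsStoppingTime 𝓕 (fun ω => (τ ω : WithTop ℝ))) (u : ℝ) :
    Measurable[𝓕 u] (fun ω => min (τ ω) u) :=
  @measurable_min_of_forall_lt Ω (𝓕 u) τ u fun r hr => by
    simpa using 𝓕.mono hr.le _ (hτ r)

theorem measurable_of_isStoppingTime {τ : Ω → ℝ}
    (hτ : IsStoppingTime 𝓕 (fun ω => (τ ω : WithTop ℝ))) : Measurable τ :=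
  measurable_of_Iic fun r => by
    have h := 𝓕.le r _ (hτ r)
    simp only [WithTop.coe_le_coe] at h
    exact h

/-- The increment of the process between `u ∧ τ` and `u ∧ t`. -/
def incr (M : ℝ → Ω → ℝ) (t : ℝ) (τ : Ω → ℝ) (u : ℝ) (ω : Ω) : ℝ :=
  stopAt M t u ω - stopAt M t (min (τ ω) u) ω

variable {t : ℝ} {τ : Ω → ℝ}

theorem BoundedMartingale.measurable_incr (h : BoundedMartingale T 𝓕 P M κ) (ht : t ∈ Ico 0 T)
    (hτ : Measurable τ) : Measurable (fun p : ℝ × Ω => incr M t τ p.1 p.2) := by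
  have hN := h.measurable_stopAt' ht
  exact hN.sub (hN.comp (((hτ.comp measurable_snd).min measurable_fst).prodMk measurable_snd))

theorem BoundedMartingale.abs_incr_le (h : BoundedMartingale T 𝓕 P M κ) (ht : t ∈ Ico 0 T)
    (u : ℝ) (ω : Ω) : |incr M t τ u ω| ≤ 2 * (κ t).toReal := by
  have h1 := h.abs_le (max_min_mem (r := u) ht.1) ht.2 ω
  have h2 := h.abs_le (max_min_mem (r := min (τ ω) u) ht.1) ht.2 ω
  exact (abs_sub _ _).trans (by unfold stopAt; linarith)

theorem BoundedMartingale.enorm_incr_le (h : BoundedMartingale T 𝓕 P M κ) (ht : t ∈ Ico 0 T)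
    {u : ℝ} (hu : 0 ≤ u) (ω : Ω) : ‖incr M t τ u ω‖ₑ ≤ 2 * κ u := by
  have key : ∀ r ≤ u, ‖stopAt M t r ω‖ₑ ≤ κ u := fun r hr => by
    have hm := max_min_mem (r := r) ht.1
    exact (h.bound _ ⟨hm.1, hm.2.trans_lt ht.2⟩ ω).trans
      (h.mono (max_le hu ((min_le_left _ _).trans hr)))
  rw [two_mul]
  exact enorm_sub_le.trans (add_le_add (key _ le_rfl) (key _ (min_le_right _ _)))

variable [IsProbabilityMeasure P]

/-- After time u ∨ τ the increment W_v - W_u no longer involves τ, so orthogonality at the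
deterministic times u ≤ v suffices and no optional sampling is required. -/
theorem BoundedMartingale.setIntegral_incr_mul_incr (h : BoundedMartingale T 𝓕 P M κ)
    (ht : t ∈ Ico 0 T) (hτ : IsStoppingTime 𝓕 (fun ω => (τ ω : WithTop ℝ))) {A : Set Ω} (hA : MeasurableSet[hτ.measurableSpace] A) {u v : ℝ}
    (hu : 0 ≤ u) (huv : u ≤ v) :
    ∫ ω in A, incr M t τ u ω * incr M t τ v ω ∂P =
      ∫ ω in A, incr M t τ u ω * incr M t τ u ω ∂P := by
  have hτm := measurable_of_isStoppingTime hτ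
  have hAm : MeasurableSet A := hτ.measurableSpace_le A hA
  have hW := h.measurable_incr ht hτm
  have hWu : ∀ u, Measurable (incr M t τ u) := fun u => hW.comp measurable_prodMk_left
  have hNu : ∀ u, Measurable (stopAt M t u) := fun u =>
    (h.measurable_stopAt' ht).comp measurable_prodMk_left
  set Z : Ω → ℝ := A.indicator (incr M t τ u) with hZ
  have hZB : ∀ ω, |Z ω| ≤ 2 * (κ t).toReal := fun ω => by
    by_cases hω : ω ∈ A
    · rw [hZ, indicator_of_mem hω]; exact h.abs_incr_le ht u ω
    · rw [hZ, indicator_of_notMem hω, abs_zero]; positivity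
  have hNB : ∀ u ω, |stopAt M t u ω| ≤ (κ t).toReal := fun u ω =>
    h.abs_le (max_min_mem ht.1) ht.2 ω
  have hZm : Measurable Z := (hWu u).indicator hAm
  have hint : ∀ v, Integrable (fun ω => Z ω * stopAt M t v ω) P := fun v =>
    Integrable.mono' (integrable_const (2 * (κ t).toReal * (κ t).toReal))
      (hZm.mul (hNu v)).aestronglyMeasurable (.of_forall fun ω => by
        rw [Real.norm_eq_abs, abs_mul]
        exact mul_le_mul (hZB ω) (hNB v ω) (abs_nonneg _) (by positivity))
  have horth : ∫ ω, Z ω * stopAt M t v ω ∂P = ∫ ω, Z ω * stopAt M t u ω ∂P := by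
    rcases le_or_gt t u with htu | hut
    · have : stopAt M t v = stopAt M t u := by
        ext ω
        simp [stopAt, min_eq_right htu, min_eq_right (htu.trans huv)]
      rw [this]
    · have hv0 : 0 ≤ min v t := le_min (hu.trans huv) ht.1
      have huT : u ∈ Ico 0 T := ⟨hu, hut.trans ht.2⟩
      -- W_u vanishes on {τ > u}, and A ∩ {τ ≤ u} belongs to `𝓕 u` because A belongs to the
      -- σ-algebra of τ.
      have hZu : Measurable[𝓕 u] Z := by
        have e : Z = (A ∩ {ω | (τ ω : WithTop ℝ) ≤ u}).indicator
            (fun ω => stopAt M u u ω - stopAt M u (min (τ ω) u) ω) := by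
          ext ω
          by_cases hω : ω ∈ A
          · by_cases hτu : τ ω ≤ u
            · have hmem : ω ∈ A ∩ {ω | (τ ω : WithTop ℝ) ≤ u} :=
                ⟨hω, by simpa using hτu⟩
              rw [hZ, indicator_of_mem hω, indicator_of_mem hmem, incr]
              simp [stopAt, min_eq_left hτu, min_eq_left hut.le, min_eq_left (hτu.trans hut.le)]
            · have hmem : ω ∉ A ∩ {ω | (τ ω : WithTop ℝ) ≤ u} := fun hc =>
                hτu (by simpa using hc.2)
              rw [hZ, indicator_of_mem hω, indicator_of_notMem hmem, incr,
                min_eq_right (le_of_not_ge hτu), sub_self]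
          · rw [hZ, indicator_of_notMem hω, indicator_of_notMem fun hc => hω hc.1]
        rw [e]
        have hN := h.measurable_stopAt huT
        have hmin := measurable_min_of_isStoppingTime hτ u
        refine Measurable.indicator ?_ (hA.2 u)
        refine Measurable.sub ?_ ?_
        · exact hN.comp (@measurable_prodMk_left ℝ Ω _ (𝓕 u) u)
        · exact hN.comp (Measurable.prodMk hmin (@measurable_id Ω (𝓕 u)))
      have ho := h.orth u (min v t) hu (le_min huv hut.le) ((min_le_right _ _).trans_lt ht.2) Z
        hZu _ hZB
      have e1 : stopAt M t v = M (min v t) := by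
        ext ω; rw [stopAt_of_nonneg ht.1 (hu.trans huv)]
      have e2 : stopAt M t u = M u := by
        ext ω; rw [stopAt_of_nonneg ht.1 hu, min_eq_left hut.le]
      rw [e1, e2, ho]
  have hsub : ∫ ω, Z ω * (stopAt M t v ω - stopAt M t u ω) ∂P = 0 := by
    simp only [mul_sub]
    rw [integral_sub (hint v) (hint u), horth, sub_self]
  rw [← sub_eq_zero, ← integral_sub]
  · rw [← integral_indicator hAm, ← hsub]
    refine integral_congr_ae (.of_forall fun ω => ?_)
    dsimp only
    by_cases hω : ω ∈ A
    · rw [indicator_of_mem hω, hZ, indicator_of_mem hω]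
      -- For τ ≤ u the starting values at τ cancel in W_v - W_u; for τ > u the factor W_u is zero.
      by_cases hτu : τ ω ≤ u
      · simp only [incr, min_eq_left hτu, min_eq_left (hτu.trans huv)]
        ring
      · have : incr M t τ u ω = 0 := by
          rw [incr, min_eq_right (le_of_not_ge hτu), sub_self]
        simp [this]
    · rw [indicator_of_notMem hω, hZ, indicator_of_notMem hω, zero_mul]
  all_goals
    refine Integrable.mono' (integrable_const (2 * (κ t).toReal * (2 * (κ t).toReal)))
      ((hWu _).mul (hWu _)).aestronglyMeasurable (.of_forall fun ω => ?_)
    rw [Real.norm_eq_abs, abs_mul]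
    exact mul_le_mul (h.abs_incr_le ht _ ω) (h.abs_incr_le ht _ ω) (abs_nonneg _) (by positivity)

theorem BoundedMartingale.enorm_setIntegral_incr_mul_incr_le (h : BoundedMartingale T 𝓕 P M κ)
    (ht : t ∈ Ico 0 T) (hτ : IsStoppingTime 𝓕 (fun ω => (τ ω : WithTop ℝ))) {A : Set Ω} (hA : MeasurableSet[hτ.measurableSpace] A) {u v : ℝ}
    (hu : 0 ≤ u) (hv : 0 ≤ v) :
    ‖∫ ω in A, incr M t τ u ω * incr M t τ v ω ∂P‖ₑ ≤ 4 * κ (min u v) ^ 2 * P A := by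
  have key : ∀ u, 0 ≤ u →
      ‖∫ ω in A, incr M t τ u ω * incr M t τ u ω ∂P‖ₑ ≤ 4 * κ u ^ 2 * P A := fun u hu => by
    refine (enorm_integral_le_lintegral_enorm _).trans ?_
    rw [← setLIntegral_const]
    refine lintegral_mono fun ω => ?_
    rw [enorm_mul]
    refine (mul_le_mul' (h.enorm_incr_le ht hu ω) (h.enorm_incr_le ht hu ω)).trans (le_of_eq ?_)
    ring
  rcases le_total u v with huv | huv
  · rw [h.setIntegral_incr_mul_incr ht hτ hA hu huv, min_eq_left huv]
    exact key u hu
  · simp only [mul_comm (incr M t τ u _)]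
    rw [h.setIntegral_incr_mul_incr ht hτ hA hv huv, min_eq_right huv]
    exact key v hv

end SecondMoment

/-! ### The double time integral behind the second moment -/

section SecondMoment

variable {Ω : Type*} [m : MeasurableSpace Ω] {T : ℝ} {𝓕 : Filtration ℝ m}
  {P : Measure Ω} {M : ℝ → Ω → ℝ} {κ : ℝ → ℝ≥0∞} {t : ℝ} {τ : Ω → ℝ}

/-- By symmetry the integral is twice that over {u ≤ v}, where the later variable integrates out to
(T-u)^α/α. -/
theorem lintegral_prod_sub_rpow_le {α : ℝ} (hα : 0 < α) (hκ : Monotone κ) :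
    ∫⁻ p : ℝ × ℝ, ENNReal.ofReal ((T - p.1) ^ (α - 1)) * ENNReal.ofReal ((T - p.2) ^ (α - 1)) *
        κ (min p.1 p.2) ^ 2 ∂((volume.restrict (Ioo 0 T)).prod (volume.restrict (Ioo 0 T))) ≤
      ENNReal.ofReal (2 / α) *
        ∫⁻ u in Ioo 0 T, ENNReal.ofReal ((T - u) ^ (2 * α - 1)) * κ u ^ 2 := by
  set ν := volume.restrict (Ioo 0 T)
  set w : ℝ → ℝ≥0∞ := fun u => ENNReal.ofReal ((T - u) ^ (α - 1)) with hw
  have hwm : Measurable w := by fun_prop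
  have hκm : Measurable κ := hκ.measurable
  set a : ℝ × ℝ → ℝ≥0∞ := {p : ℝ × ℝ | p.1 ≤ p.2}.indicator
    (fun p => w p.1 * w p.2 * κ p.1 ^ 2)
  have ha1 : ∀ p : ℝ × ℝ, p.1 ≤ p.2 → a p = w p.1 * w p.2 * κ p.1 ^ 2 := fun p hp =>
    indicator_of_mem (s := {p : ℝ × ℝ | p.1 ≤ p.2}) hp _
  have ha2 : ∀ p : ℝ × ℝ, ¬ p.1 ≤ p.2 → a p = 0 := fun p hp =>
    indicator_of_notMem (s := {p : ℝ × ℝ | p.1 ≤ p.2}) hp _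
  have ham : Measurable a := Measurable.indicator (by fun_prop)
    (measurableSet_le measurable_fst measurable_snd)
  have hle : ∀ p : ℝ × ℝ, w p.1 * w p.2 * κ (min p.1 p.2) ^ 2 ≤ a p + a p.swap := by
    intro p
    rcases le_total p.1 p.2 with h | h
    · refine le_add_right ?_
      rw [ha1 p h, min_eq_left h]
    · refine le_add_left ?_
      rw [ha1 p.swap h, min_eq_right h]
      simp [mul_comm]
  have hbase : ∫⁻ p, a p ∂(ν.prod ν) ≤ ENNReal.ofReal (1 / α) *
      ∫⁻ u in Ioo 0 T, ENNReal.ofReal ((T - u) ^ (2 * α - 1)) * κ u ^ 2 := by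
    rw [lintegral_prod _ ham.aemeasurable, ← lintegral_const_mul' _ _ ENNReal.ofReal_ne_top]
    refine setLIntegral_mono' measurableSet_Ioo fun u hu => ?_
    have hTu : 0 < T - u := by linarith [hu.2]
    have h1 : ∀ v, a (u, v) = w u * κ u ^ 2 * (Ici u).indicator w v := fun v => by
      by_cases hv : u ≤ v
      · rw [ha1 (u, v) hv, indicator_of_mem (s := Ici u) hv]
        ring
      · rw [ha2 (u, v) hv, indicator_of_notMem (s := Ici u) hv, mul_zero]
    simp only [h1]
    rw [lintegral_const_mul _ (hwm.indicator measurableSet_Ici),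
      setLIntegral_indicator measurableSet_Ici]
    have h2 : ∫⁻ v in Ici u ∩ Ioo 0 T, w v ≤ ENNReal.ofReal ((T - u) ^ α / α) := by
      rw [← lintegral_sub_rpow hα hu.2.le, setLIntegral_congr Ioo_ae_eq_Ico]
      exact lintegral_mono_set fun v hv => ⟨hv.1, hv.2.2⟩
    refine (mul_le_mul_right h2 _).trans (le_of_eq ?_)
    rw [hw, mul_right_comm, ← mul_assoc, ← ENNReal.ofReal_mul (by positivity),
      ← ENNReal.ofReal_mul (by positivity)]
    congr 2
    rw [show 2 * α - 1 = α - 1 + α by ring, Real.rpow_add hTu]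
    ring
  calc _ ≤ ∫⁻ p, (a p + a p.swap) ∂(ν.prod ν) := lintegral_mono hle
    _ = ∫⁻ p, a p ∂(ν.prod ν) + ∫⁻ p, a p ∂(ν.prod ν) := by
      rw [lintegral_add_left ham, lintegral_prod_swap]
    _ ≤ _ := by
      refine (add_le_add hbase hbase).trans (le_of_eq ?_)
      rw [← add_mul, ← ENNReal.ofReal_add (by positivity) (by positivity)]
      congr 2; ring

variable [IsProbabilityMeasure P]

/-- The square becomes a double integral, Fubini moves the expectation inside, and the product at
times u, v is at most 4κ(u∧v)²P(A). The constant is 8/α = 4·(2/α). -/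
theorem BoundedMartingale.lintegral_sq_le (h : BoundedMartingale T 𝓕 P M κ) {α : ℝ} (hα : 0 < α)
    (ht : t ∈ Ico 0 T) (hτ : IsStoppingTime 𝓕 (fun ω => (τ ω : WithTop ℝ)))
    {A : Set Ω} (hA : MeasurableSet[hτ.measurableSpace] A) :
    ∫⁻ ω in A, ‖∫ u in Ioo 0 T, (T - u) ^ (α - 1) * incr M t τ u ω‖ₑ ^ 2 ∂P ≤
      ENNReal.ofReal (8 / α) *
        (∫⁻ u in Ioo 0 T, ENNReal.ofReal ((T - u) ^ (2 * α - 1)) * κ u ^ 2) * P A := by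
  have hT : 0 ≤ T := ht.1.trans ht.2.le
  have hW := h.measurable_incr ht (measurable_of_isStoppingTime hτ)
  set ν := volume.restrict (Ioo 0 T) with hν
  set w : ℝ → ℝ := fun u => (T - u) ^ (α - 1) with hw
  have hwm : Measurable w := by fun_prop
  have hwi : Integrable w ν := integrableOn_sub_rpow hα hT
  set W := incr M t τ
  set B := 2 * (κ t).toReal with hBdef
  have hB : ∀ u ω, |W u ω| ≤ B := h.abs_incr_le ht
  have hB0 : 0 ≤ B := by positivity
  set q : Ω → ℝ := fun ω => ∫ u, w u * W u ω ∂ν with hq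
  have hq2 : ∀ ω, q ω ^ 2 =
      ∫ p : ℝ × ℝ, w p.1 * w p.2 * (W p.1 ω * W p.2 ω) ∂(ν.prod ν) := fun ω => by
    rw [sq, hq, ← integral_prod_mul]
    refine integral_congr_ae (.of_forall fun p => ?_)
    simp only
    ring
  have hGm : Measurable fun x : Ω × (ℝ × ℝ) =>
      w x.2.1 * w x.2.2 * (W x.2.1 x.1 * W x.2.2 x.1) :=
    ((hwm.comp (measurable_fst.comp measurable_snd)).mul
      (hwm.comp (measurable_snd.comp measurable_snd))).mul
      ((hW.comp ((measurable_fst.comp measurable_snd).prodMk measurable_fst)).mul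
        (hW.comp ((measurable_snd.comp measurable_snd).prodMk measurable_fst)))
  have hwn : ∀ᵐ u ∂ν, 0 ≤ w u := by
    rw [hν, ae_restrict_iff' measurableSet_Ioo]
    exact .of_forall fun u hu => Real.rpow_nonneg (by linarith [hu.2]) _
  have hww : Integrable (fun p : ℝ × ℝ => w p.1 * w p.2) (ν.prod ν) := hwi.mul_prod hwi
  have hGi : Integrable (fun x : Ω × (ℝ × ℝ) => w x.2.1 * w x.2.2 * (W x.2.1 x.1 * W x.2.2 x.1))
      ((P.restrict A).prod (ν.prod ν)) := by
    refine Integrable.mono' ((hww.norm.mul_const (B * B)).comp_snd (P.restrict A))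
      hGm.aestronglyMeasurable (.of_forall fun x => ?_)
    rw [norm_mul, norm_mul (W _ _)]
    exact mul_le_mul_of_nonneg_left (mul_le_mul (hB _ _) (hB _ _) (norm_nonneg _) hB0)
      (norm_nonneg _)
  have hqi : Integrable (fun ω => q ω ^ 2) (P.restrict A) := by
    simp only [hq2]
    exact hGi.integral_prod_left
  have hswap : ∫ ω in A, q ω ^ 2 ∂P =
      ∫ p : ℝ × ℝ, w p.1 * w p.2 * ∫ ω in A, W p.1 ω * W p.2 ω ∂P ∂(ν.prod ν) := by
    simp only [hq2]
    rw [integral_integral_swap hGi]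
    simp only [integral_const_mul]
  have e1 : ∀ ω, ‖q ω‖ₑ ^ 2 = ENNReal.ofReal (q ω ^ 2) := fun ω => by
    rw [← ofReal_norm, ← ENNReal.ofReal_pow (norm_nonneg _), Real.norm_eq_abs, sq_abs]
  calc ∫⁻ ω in A, ‖q ω‖ₑ ^ 2 ∂P = ENNReal.ofReal (∫ ω in A, q ω ^ 2 ∂P) := by
        simp only [e1]
        rw [ofReal_integral_eq_lintegral_ofReal hqi (.of_forall fun ω => sq_nonneg _)]
    _ ≤ ‖∫ p : ℝ × ℝ, w p.1 * w p.2 * ∫ ω in A, W p.1 ω * W p.2 ω ∂P ∂(ν.prod ν)‖ₑ := by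
        rw [hswap]
        exact Real.ofReal_le_enorm _
    _ ≤ ∫⁻ p : ℝ × ℝ, (ENNReal.ofReal (w p.1) * ENNReal.ofReal (w p.2) *
          κ (min p.1 p.2) ^ 2) * (4 * P A) ∂(ν.prod ν) := by
        refine (enorm_integral_le_lintegral_enorm _).trans (lintegral_mono_ae ?_)
        have hm : ∀ᵐ p ∂(ν.prod ν), p ∈ Ioo 0 T ×ˢ Ioo 0 T := by
          rw [hν, Measure.prod_restrict]
          exact ae_restrict_mem (measurableSet_Ioo.prod measurableSet_Ioo)
        filter_upwards [hm] with p hp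
        have hn : ∀ u ∈ Ioo 0 T, ‖w u‖ₑ = ENNReal.ofReal (w u) := fun u hu =>
          Real.enorm_of_nonneg (Real.rpow_nonneg (by linarith [hu.2]) _)
        rw [enorm_mul, enorm_mul, hn _ hp.1, hn _ hp.2]
        refine (mul_le_mul_right (h.enorm_setIntegral_incr_mul_incr_le ht hτ hA hp.1.1.le
          hp.2.1.le) _).trans (le_of_eq ?_)
        ring
    _ ≤ _ := by
        have hκm : Measurable κ := h.mono.measurable
        rw [lintegral_mul_const _ (by fun_prop)]
        refine (mul_le_mul_left (lintegral_prod_sub_rpow_le hα h.mono) _).trans (le_of_eq ?_)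
        have e8 : ENNReal.ofReal (8 / α) = 4 * ENNReal.ofReal (2 / α) := by
          rw [← ENNReal.ofReal_ofNat 4, ← ENNReal.ofReal_mul (by norm_num)]
          congr 1; ring
        rw [e8]
        ring

end SecondMoment

/-! ### The BMO norm of the Riemann-Liouville transform -/

section BMO

/-- Reduces the conditional estimate at τ to integrals over sets A of the σ-algebra of τ. -/
theorem condLExp_le_of_forall_setLIntegral_le {Ω : Type*} {m' m : MeasurableSpace Ω}
    {P : Measure Ω} [IsFiniteMeasure P] (hm : m' ≤ m) {f : Ω → ℝ≥0∞} {c : ℝ≥0∞}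
    (h : ∀ A, MeasurableSet[m'] A → ∫⁻ ω in A, f ω ∂P ≤ c * P A) :
    ∀ᵐ ω ∂P, condLExp m' P f ω ≤ c := by
  have hmeas : Measurable[m'] (condLExp m' P f) := measurable_condLExp m' P f
  refine ae_of_ae_trim hm (ae_le_of_forall_setLIntegral_le_of_sigmaFinite hmeas fun A hA _ => ?_)
  rw [restrict_trim hm P hA, lintegral_trim hm hmeas, lintegral_trim hm measurable_const,
    setLIntegral_condLExp hm P f hA, setLIntegral_const]
  exact h A hA

variable {Ω : Type*} [m : MeasurableSpace Ω] {T : ℝ} {𝓕 : Filtration ℝ m}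
  {P : Measure Ω} {M : ℝ → Ω → ℝ} {κ : ℝ → ℝ≥0∞}

theorem BoundedMartingale.aestronglyMeasurable_path (h : BoundedMartingale T 𝓕 P M κ) {ω : Ω}
    {K : ℝ → ℝ} (hK : ∀ t ∈ Ico 0 T, K t = M t ω) {s : ℝ} (hs : s ∈ Ico 0 T) :
    AEStronglyMeasurable (fun r => K (min r s)) (volume.restrict (Ioo 0 T)) := by
  have hm : Measurable fun r => stopAt M s r ω :=
    (h.measurable_stopAt' hs).comp measurable_prodMk_right
  refine hm.aestronglyMeasurable.congr ?_
  rw [Filter.EventuallyEq, ae_restrict_iff' measurableSet_Ioo]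
  refine .of_forall fun r hr => ?_
  rw [stopAt_of_nonneg hs.1 hr.1.le,
    hK _ ⟨le_min hr.1.le hs.1, (min_le_right _ _).trans_lt hs.2⟩]

theorem BoundedMartingale.riemannLiouville_sub_eq (h : BoundedMartingale T 𝓕 P M κ) {α : ℝ}
    (hα : 0 < α) {ω : Ω} {K : ℝ → ℝ} (hK : ∀ t ∈ Ico 0 T, K t = M t ω) {t : ℝ}
    (ht : t ∈ Ico 0 T) {τ : Ω → ℝ} (hτ : τ ω ∈ Icc 0 t) :
    riemannLiouville T α K t - riemannLiouville T α K (τ ω) =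
      α / T ^ α * ∫ r in Ioo 0 T, (T - r) ^ (α - 1) * incr M t τ r ω := by
  rw [riemannLiouville_sub hα (ht.1.trans ht.2.le) hτ (B := (κ t).toReal)
    (fun s hs => h.aestronglyMeasurable_path hK ⟨hs.1, hs.2.trans_lt ht.2⟩)
    (fun r hr => by rw [hK r ⟨hr.1, hr.2.trans_lt ht.2⟩]; exact h.abs_le hr ht.2 ω)]
  congr 1
  refine setIntegral_congr_fun measurableSet_Ioo fun r hr => ?_
  have h1 : 0 ≤ min r t := le_min hr.1.le ht.1
  have h2 : 0 ≤ min (τ ω) r := le_min hτ.1 hr.1.le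
  rw [incr, stopAt_of_nonneg ht.1 hr.1.le, stopAt_of_nonneg ht.1 h2,
    hK _ ⟨h1, (min_le_right _ _).trans_lt ht.2⟩, min_comm r (τ ω),
    hK _ ⟨h2, (min_le_left _ _).trans_lt (hτ.2.trans_lt ht.2)⟩,
    min_eq_left ((min_le_left (τ ω) r).trans hτ.2)]

/-- The bound on increments over [u,s] passes to the limit u ↑ s with the prefactor 2κ(s) kept
fixed, and (T-s)^α κ(s) ≤ S. -/
theorem BoundedMartingale.enorm_jump_le (h : BoundedMartingale T 𝓕 P M κ) {α : ℝ}
    (hα : 0 < α) {S : ℝ≥0∞} (hS : ∀ s ∈ Ico 0 T, ENNReal.ofReal ((T - s) ^ α) * κ s ≤ S)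
    {ω : Ω} {K : ℝ → ℝ} (hK : ∀ t ∈ Ico 0 T, K t = M t ω) (a : ℝ) {s : ℝ} (hs : s ∈ Ico 0 T) :
    ‖(riemannLiouville T α K s - a) - leftValue (fun u => riemannLiouville T α K u - a) s‖ₑ ≤
      ENNReal.ofReal (2 / T ^ α) * S := by
  have hT : 0 < T := hs.1.trans_lt hs.2
  have hb := abs_sub_leftValue_le (Y := fun u => riemannLiouville T α K u - a)
    (b := fun u => 2 * (κ s).toReal * ((T - u) ^ α / T ^ α)) hs.1 (fun u hu => by
      simp only [sub_sub_sub_cancel_right]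
      exact abs_riemannLiouville_sub_le hα hT hu hs.2
        (fun r hr => h.aestronglyMeasurable_path hK ⟨hr.1, hr.2.trans_lt hs.2⟩)
        (fun r hr => by rw [hK r ⟨hr.1, hr.2.trans_lt hs.2⟩]; exact h.abs_le hr hs.2 ω))
    (Continuous.continuousAt (continuous_const.mul (Continuous.div_const
      (Continuous.rpow_const (by fun_prop) fun _ => Or.inr hα.le) _)))
  rw [← ofReal_norm, Real.norm_eq_abs]
  refine (ENNReal.ofReal_le_ofReal hb).trans ?_
  refine le_trans (le_of_eq ?_) (mul_le_mul_right (hS s hs) _)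
  have hp : 0 < T - s := by linarith [hs.2]
  rw [← mul_assoc, ← ENNReal.ofReal_mul (by positivity)]
  conv_rhs => rw [← ENNReal.ofReal_toReal (h.lt_top s hs.2).ne,
    ← ENNReal.ofReal_mul (by positivity)]
  congr 1
  ring

theorem BoundedMartingale.bmoNorm_le [IsProbabilityMeasure P] (h : BoundedMartingale T 𝓕 P M κ)
    {α : ℝ} (hα : 0 < α) {S : ℝ≥0∞}
    (hS : ∀ s ∈ Ico 0 T, ENNReal.ofReal ((T - s) ^ α) * κ s ≤ S) {φ : ℝ → Ω → ℝ}
    (hφ : ∀ᵐ ω ∂P, ∀ t ∈ Ico 0 T, φ t ω = M t ω) {c : ℝ≥0}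
    (hc : 2 * ENNReal.ofReal (α / T ^ α) ^ 2 * (ENNReal.ofReal (8 / α) *
        ∫⁻ u in Ioo 0 T, ENNReal.ofReal ((T - u) ^ (2 * α - 1)) * κ u ^ 2) +
      2 * (ENNReal.ofReal (2 / T ^ α) * S) ^ 2 ≤ (c : ℝ≥0∞) ^ 2) :
    bmoNorm T 𝓕 P (fun t ω => riemannLiouville T α (fun u => φ u ω) t - φ 0 ω) ≤ c := by
  refine iInf₂_le _ fun t ht τ hτt hτ => condLExp_le_of_forall_setLIntegral_le
    hτ.measurableSpace_le fun A hA => ?_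
  have hpt : ∀ᵐ ω ∂P, ‖(riemannLiouville T α (fun u => φ u ω) t - φ 0 ω) -
      leftValue (fun u => riemannLiouville T α (fun u => φ u ω) u - φ 0 ω) (τ ω)‖ₑ ^ 2 ≤
      2 * ENNReal.ofReal (α / T ^ α) ^ 2 *
          ‖∫ r in Ioo 0 T, (T - r) ^ (α - 1) * incr M t τ r ω‖ₑ ^ 2 +
        2 * (ENNReal.ofReal (2 / T ^ α) * S) ^ 2 := by
    filter_upwards [hφ] with ω hω
    have hT : 0 ≤ T := ht.1.trans ht.2.le
    have h1 := h.riemannLiouville_sub_eq hα (K := fun u => φ u ω) hω ht (hτt ω)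
    have h2 := h.enorm_jump_le hα hS (K := fun u => φ u ω) hω (φ 0 ω) (s := τ ω)
      ⟨(hτt ω).1, (hτt ω).2.trans_lt ht.2⟩
    set y := fun u => riemannLiouville T α (fun u => φ u ω) u - φ 0 ω with hy
    -- The increment after τ is handled in second moment, the jump at τ pointwise; (a+b)² ≤ 2a²+2b²
    -- joins them.
    have h3 : y t - leftValue y (τ ω) =
        (α / T ^ α * ∫ r in Ioo 0 T, (T - r) ^ (α - 1) * incr M t τ r ω) +
          (y (τ ω) - leftValue y (τ ω)) := by
      rw [← h1]; simp only [hy]; ring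
    change ‖y t - leftValue y (τ ω)‖ₑ ^ 2 ≤ _
    rw [h3]
    have h4 : ∀ a b : ℝ≥0∞, (a + b) ^ 2 ≤ 2 * a ^ 2 + 2 * b ^ 2 := fun a b => by
      have := ENNReal.rpow_add_le_mul_rpow_add_rpow a b (p := 2) one_le_two
      norm_num at this
      rw [mul_add] at this
      exact_mod_cast this
    refine (pow_le_pow_left₀ zero_le (enorm_add_le _ _) 2).trans ((h4 _ _).trans ?_)
    refine add_le_add (le_of_eq ?_) ?_
    · rw [enorm_mul, Real.enorm_of_nonneg (by positivity), mul_pow, mul_assoc]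
    · gcongr
  refine (lintegral_mono_ae (ae_restrict_of_ae hpt)).trans ?_
  rw [lintegral_add_right _ measurable_const, setLIntegral_const,
    lintegral_const_mul' _ _ (ENNReal.mul_ne_top (by simp) (by simp))]
  refine (add_le_add_left (mul_le_mul_right (h.lintegral_sq_le hα ht hτ hA) _) _).trans ?_
  refine le_trans (le_of_eq ?_) (mul_le_mul_left hc _)
  ring

end BMO

/-! ### The gradient process -/

section GradientProcess

universe u

/-- Two càdlàg versions of the same process are indistinguishable. -/
theorem ae_forall_eq_of_isCadlagOn {Ω : Type*} [MeasurableSpace Ω] {P : Measure Ω} {T : ℝ}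
    {φ ψ : ℝ → Ω → ℝ} (h : ∀ t ∈ Ico 0 T, φ t =ᵐ[P] ψ t)
    (hφ : ∀ ω, IsCadlagOn (Ico 0 T) (fun t => φ t ω))
    (hψ : ∀ ω, IsCadlagOn (Ico 0 T) (fun t => ψ t ω)) :
    ∀ᵐ ω ∂P, ∀ t ∈ Ico 0 T, φ t ω = ψ t ω := by
  have hq : ∀ᵐ ω ∂P, ∀ q : ℚ, (q : ℝ) ∈ Ico 0 T → φ q ω = ψ q ω :=
    ae_all_iff.2 fun q => by
      by_cases hq : (q : ℝ) ∈ Ico 0 T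
      · filter_upwards [h q hq] with ω hω _ using hω
      · exact .of_forall fun ω hq' => absurd hq' hq
  filter_upwards [hq] with ω hω t ht
  -- Rationals strictly to the right of t accumulate at t, so agreement there passes to t by
  -- right-continuity.
  set D : Set ℝ := Ioo t T ∩ range ((↑) : ℚ → ℝ) with hD
  have hcl : t ∈ closure D := by
    have h1 : Ioo t T ⊆ closure D :=
      Rat.isDenseEmbedding_coe_real.dense.open_subset_closure_inter isOpen_Ioo
    have h2 : t ∈ closure (Ioo t T) := by
      rw [closure_Ioo ht.2.ne]; exact ⟨le_rfl, ht.2.le⟩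
    exact closure_minimal h1 isClosed_closure h2
  have hne : (𝓝[D] t).NeBot := mem_closure_iff_nhdsWithin_neBot.1 hcl
  have hle : 𝓝[D] t ≤ 𝓝[Ico 0 T ∩ Ici t] t :=
    nhdsWithin_mono _ fun r hr => ⟨⟨ht.1.trans hr.1.1.le, hr.1.2⟩, hr.1.1.le⟩
  have e1 := (hφ ω t ht).1.tendsto.mono_left hle
  have e2 := (hψ ω t ht).1.tendsto.mono_left hle
  refine tendsto_nhds_unique_of_eventuallyEq e1 e2 ?_
  filter_upwards [self_mem_nhdsWithin] with r hr
  obtain ⟨q, rfl⟩ := hr.2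
  exact hω q ⟨ht.1.trans hr.1.1.le, hr.1.2⟩

/-- The supremum norm of `G(t,·)` as a function of `t`, extended from `[0,T)` to the line. -/
def timeBound (T : ℝ) (G : ℝ → ℝ → ℝ) (t : ℝ) : ℝ≥0∞ := if t < T then supNorm (G (max t 0)) else ⊤

theorem timeBound_eq {T t : ℝ} {G : ℝ → ℝ → ℝ} (ht : t ∈ Ico 0 T) :
    timeBound T G t = supNorm (G t) := by
  rw [timeBound, if_pos ht.2, max_eq_left ht.1]

/-- Monotonicity on the whole line, with the value ⊤ from T on, yields Borel measurability of the
supremum in time. -/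
theorem timeBound_mono {T : ℝ} {G : ℝ → ℝ → ℝ}
    (h : ∀ u v, 0 ≤ u → u ≤ v → v < T → supNorm (G u) ≤ supNorm (G v)) (hT : 0 < T) :
    Monotone (timeBound T G) := by
  intro u v huv
  by_cases hv : v < T
  · rw [timeBound, timeBound, if_pos hv, if_pos (huv.trans_lt hv)]
    exact h _ _ (le_max_right _ _) (max_le_max_right 0 huv) (max_lt hv hT)
  · rw [timeBound, timeBound, if_neg hv]
    exact le_top

/-- The exponents match because (T-u)^(2α-1) is the squared weight (T-u)^α times the density
1/(T-u). -/
theorem lintegral_timeBound_le {T α : ℝ} {G : ℝ → ℝ → ℝ} (hm : Measurable (timeBound T G)) :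
    ∫⁻ u in Ioo 0 T, ENNReal.ofReal ((T - u) ^ (2 * α - 1)) * timeBound T G u ^ 2 ≤
      besovNorm T α 2 G ^ 2 := by
  have e : besovNorm T α 2 G =
      eLpNorm (fun t : ℝ => ENNReal.ofReal ((T - t) ^ α) * timeBound T G t) 2
        ((volume.restrict (Ico 0 T)).withDensity (fun t => ENNReal.ofReal (1 / (T - t)))) := by
    refine eLpNorm_congr_ae ((withDensity_absolutelyContinuous _ _).ae_le ?_)
    filter_upwards [ae_restrict_mem measurableSet_Ico] with t ht
    rw [timeBound_eq ht]
  have hm' : Measurable fun t : ℝ => ENNReal.ofReal ((T - t) ^ α) * timeBound T G t := by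
    fun_prop
  rw [e, ← ENNReal.rpow_two, eLpNorm_eq_lintegral_rpow_enorm_toReal two_ne_zero
    ENNReal.ofNat_ne_top, ENNReal.toReal_ofNat, ← ENNReal.rpow_mul, one_div_mul_cancel two_ne_zero,
    ENNReal.rpow_one, lintegral_withDensity_eq_lintegral_mul _ (by fun_prop)
      (hm'.enorm.pow_const _)]
  refine le_trans (setLIntegral_mono' measurableSet_Ioo fun u hu => le_of_eq ?_)
    (lintegral_mono_set Ioo_subset_Ico_self)
  have hp : 0 < T - u := by linarith [hu.2]
  simp only [Pi.mul_apply, enorm_eq_self, ENNReal.rpow_two]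
  rw [mul_pow, ← mul_assoc, ← ENNReal.ofReal_pow (by positivity),
    ← ENNReal.ofReal_mul (by positivity)]
  congr 2
  rw [Real.rpow_sub_one hp.ne', mul_comm 2 α, Real.rpow_mul hp.le, Real.rpow_two]
  ring

theorem SubsetLp.mono {Ω : Type*} [MeasurableSpace Ω] {P : Measure Ω} [IsProbabilityMeasure P]
    {X : ℝ → Ω → ℝ} {T p p' : ℝ} (h : SubsetLp T p' X P) (hp : p ≤ p') : SubsetLp T p X P :=
  fun t ht => (h t ht).mono_exponent (ENNReal.ofReal_le_ofReal hp)

section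

variable {Ω : Type*} [MeasurableSpace Ω] {P : Measure Ω} [IsProbabilityMeasure P]
  {X : ℝ → Ω → ℝ} {T η c' : ℝ} {f : ℝ → ℝ} {β : ℝ≥0∞} {ρ : Measure ℝ} [IsProbabilityMeasure ρ]

/-- The gradient at the earlier time is an average of translates of the later one. -/
theorem IsLevyProcess.supNorm_gradient_mono (hX : IsLevyProcess T X P) (h0 : 0 < η) (h1 : η ≤ 1)
    (hc' : 0 < c') (hL : SubsetLp T η X P) (hf : f ∈ holderSpace η)
    (hTV : TVBound T β ρ.support c' X P) (u v : ℝ) (hu : 0 ≤ u) (huv : u ≤ v) (hv : v < T) :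
    supNorm (gradient T X P ρ f u) ≤ supNorm (gradient T X P ρ f v) := by
  refine iSup_le fun x => ?_
  rw [hX.gradient_eq h0 h1 hc' hL hf hTV hu huv hv x]
  exact enorm_integral_le_of_forall_enorm_le fun ω => enorm_le_supNorm _ _

theorem IsLevyProcess.boundedMartingale_gradient [P.IsComplete] (hX : IsLevyProcess T X P)
    (hT : 0 < T) (h0 : 0 < η) (h1 : η ≤ 1) (hc' : 0 < c') (hL : SubsetLp T η X P)
    (hf : f ∈ holderSpace η) (hTV : TVBound T β ρ.support c' X P)
    (hfin : ∀ t ∈ Ico 0 T, supNorm (gradient T X P ρ f t) < ⊤) :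
    BoundedMartingale T (augmentedFiltration T X P hX.measurable) P
      (fun t ω => gradient T X P ρ f t (X t ω)) (timeBound T (gradient T X P ρ f)) := by
  have hfD := mem_classD_of_holder h0.le hX.measurable hL hf
  have hG := hX.continuousOn_gradient h0 h1 hc' hf hfD hTV
  have hGt : ∀ t ∈ Ico 0 T, Measurable (gradient T X P ρ f t) := fun t ht => by
    have hc : Continuous fun x => gradient T X P ρ f t x :=
      hG.comp_continuous (f := fun x : ℝ => (t, x)) (by fun_prop) fun x => ⟨ht, mem_univ _⟩
    exact hc.measurable
  refine ⟨fun t ht => ?_, fun ω => isCadlagOn_comp hG (hX.cadlag ω),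
    timeBound_mono (hX.supNorm_gradient_mono h0 h1 hc' hL hf hTV) hT, fun t ht => ?_,
    fun t ht ω => ?_, fun u v hu huv hv Z hZ B hB => ?_⟩
  · exact (hGt t ht).comp (hX.measurable_augmentedFiltration ⟨ht.1, le_rfl⟩ ht.2.le)
  · rw [timeBound, if_pos ht]
    exact hfin _ ⟨le_max_right _ _, max_lt ht hT⟩
  · rw [timeBound_eq ht]
    exact enorm_le_supNorm _ _
  · have hvI : v ∈ Ico 0 T := ⟨hu.trans huv, hv⟩
    refine hX.integral_mul_sub_eq_zero hu huv hv.le (hGt v hvI)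
      (B := (supNorm (gradient T X P ρ f v)).toReal) (fun x => ?_)
      (fun x => hX.gradient_eq h0 h1 hc' hL hf hTV hu huv hv x) hZ hB
    have := enorm_le_supNorm (gradient T X P ρ f v) x
    rwa [← ofReal_norm, Real.norm_eq_abs, ENNReal.ofReal_le_iff_le_toReal (hfin v hvI).ne] at this

end

/-- The bound for the gradient process. -/
theorem exists_gradient_process_le {T ε η c' : ℝ} {β : ℝ≥0∞} (hT : 0 < T) (hε : 0 ≤ ε)
    (h0 : 0 < η) (h1 : η < 1 - ε) (hβ0 : 0 < β) (hβ : β ≠ ⊤) (hc' : 0 < c') :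
    ∃ C : ℝ, 0 < C ∧
      ∀ (Ω : Type u) [MeasurableSpace Ω] (P : Measure Ω) [IsProbabilityMeasure P] [P.IsComplete]
        (X : ℝ → Ω → ℝ) (ρ : Measure ℝ) [IsProbabilityMeasure ρ] (c : ℝ)
        (hX : IsLevyProcess T X P), SubsetLp T η X P →
        SmallBall ε c ρ → TVBound T β ρ.support c' X P →
        ∀ f ∈ interpSpace η 2,
          (∃ φ : ℝ → Ω → ℝ, IsCadlagVersion T X P (gradient T X P ρ f) φ) ∧
          ∀ φ : ℝ → Ω → ℝ, IsCadlagVersion T X P (gradient T X P ρ f) φ →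
            (⨆ a ∈ Ico 0 T, ENNReal.ofReal ((T - a) ^ ((1 - (ε + η)) * recip β)) *
                eLpNorm (φ a) ⊤ P) +
              bmoNorm T (augmentedFiltration T X P hX.measurable) P
                (fun t ω => riemannLiouville T ((1 - (ε + η)) * recip β) (fun u => φ u ω) t
                  - φ 0 ω) ≤
            ENNReal.ofReal (C * max 1 c) * interpNorm η 2 f := by
  have hη1 : η ≤ 1 := by linarith
  obtain ⟨C₁, hC₁, -, hb₁⟩ := exists_absGradient_le_gammaRate.{u} (β := β) hT hε h0.le hη1 hc'
  obtain ⟨C₂, hC₂, hb₂⟩ := exists_besovNorm_gradient_le.{u} (T := T) (q := 2) hε h1 hβ0 hβ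
    one_le_two ENNReal.ofNat_ne_top hc'
  set α := (1 - (ε + η)) * recip β with hα_def
  have hα : 0 < α := mul_pos (by linarith) (recip_pos hβ0 hβ)
  -- The two summands are the constants of `BoundedMartingale.bmoNorm_le`: C₂ enters through the
  -- weighted norm with q = 2, and 8C₁ through the supremum bound via the Hölder seminorm.
  set D : ℝ := 2 * (α / T ^ α) ^ 2 * (8 / α * C₂ ^ 2) + 2 * (2 / T ^ α * (8 * C₁)) ^ 2 with hD
  have hD0 : 0 ≤ D := by positivity
  refine ⟨8 * C₁ + √D, by positivity, ?_⟩
  intro Ω _ P _ _ X ρ _ c hX hL hρ hTV f hfI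
  have hf := interpSpace_subset_holderSpace h0.le hη1 one_le_two ENNReal.ofNat_ne_top hfI
  have hfD := mem_classD_of_holder h0.le hX.measurable hL hf
  have hNf := holderSeminorm_le_interpNorm h0.le hη1 one_le_two ENNReal.ofNat_ne_top hfI
  have hM : 0 < max 1 c := one_pos.trans_le (le_max_left _ _)
  set N := interpNorm η 2 f
  have hN : N < ⊤ := hfI
  set κ := timeBound T (gradient T X P ρ f) with hκ_def
  have hGb : ∀ t ∈ Ico 0 T, supNorm (gradient T X P ρ f t) ≤
      ENNReal.ofReal (C₁ * max 1 c * (T - t) ^ (-α)) * holderSeminorm η f := fun t ht => by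
    refine iSup_le fun x => (enorm_gradient_le_absGradient ρ t x).trans ?_
    have := hb₁ Ω P X ρ c hX.measurable hρ hTV f hf hfD t ht x
    rwa [gammaRate, if_pos h1] at this
  have hmart := hX.boundedMartingale_gradient hT h0 hη1 hc' hL hf hTV fun t ht =>
    (hGb t ht).trans_lt (ENNReal.mul_lt_top ENNReal.ofReal_lt_top hf.2)
  have hS : ∀ s ∈ Ico 0 T, ENNReal.ofReal ((T - s) ^ α) * κ s ≤
      ENNReal.ofReal (8 * C₁ * max 1 c) * N := fun s hs => by
    have hp : 0 < T - s := by linarith [hs.2]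
    rw [hκ_def, timeBound_eq hs]
    refine (mul_le_mul_right ((hGb s hs).trans (mul_le_mul_right hNf _)) _).trans (le_of_eq ?_)
    have e : (T - s) ^ α * (C₁ * max 1 c * (T - s) ^ (-α)) * 8 = 8 * C₁ * max 1 c := by
      have : (T - s) ^ α * (T - s) ^ (-α) = 1 := by rw [← Real.rpow_add hp]; simp
      linear_combination 8 * C₁ * max 1 c * this
    rw [← mul_assoc, ← mul_assoc, ← ENNReal.ofReal_mul (by positivity),
      ← ENNReal.ofReal_ofNat 8, ← ENNReal.ofReal_mul (by positivity), e]
  -- The gradient is jointly continuous, so composing it with the càdlàg path already gives a càdlàg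
  -- version.
  refine ⟨⟨fun t ω => gradient T X P ρ f t (X t ω), fun t _ => EventuallyEq.rfl, hmart.cadlag⟩,
    fun φ hφ => ?_⟩
  have hφM := ae_forall_eq_of_isCadlagOn hφ.1 hφ.2 hmart.cadlag
  have hfirst : (⨆ a ∈ Ico 0 T, ENNReal.ofReal ((T - a) ^ α) * eLpNorm (φ a) ⊤ P) ≤
      ENNReal.ofReal (8 * C₁ * max 1 c) * N := by
    refine iSup₂_le fun a ha => le_trans ?_ (hS a ha)
    rw [eLpNorm_exponent_top]
    refine mul_le_mul_right (eLpNormEssSup_le_of_ae_enorm_bound ?_) _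
    filter_upwards [hφM] with ω hω
    rw [hω a ha]
    exact hmart.bound a ha ω
  have hV : ∫⁻ u in Ioo 0 T, ENNReal.ofReal ((T - u) ^ (2 * α - 1)) * κ u ^ 2 ≤
      (ENNReal.ofReal (C₂ * max 1 c) * N) ^ 2 :=
    (lintegral_timeBound_le hmart.mono.measurable).trans
      (pow_le_pow_left₀ zero_le (hb₂ Ω P X ρ c hX.measurable hρ hTV f hfD) 2)
  have hcn : ENNReal.ofReal (√D * max 1 c) * N ≠ ⊤ :=
    ENNReal.mul_ne_top ENNReal.ofReal_ne_top hN.ne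
  have hsecond := hmart.bmoNorm_le hα hS hφM
    (c := (ENNReal.ofReal (√D * max 1 c) * N).toNNReal) (by
      rw [ENNReal.coe_toNNReal hcn]
      refine (add_le_add_left (mul_le_mul_right (mul_le_mul_right hV _) _) _).trans (le_of_eq ?_)
      have e1 : 2 * ENNReal.ofReal (α / T ^ α) ^ 2 *
          (ENNReal.ofReal (8 / α) * (ENNReal.ofReal (C₂ * max 1 c) * N) ^ 2) =
          ENNReal.ofReal (2 * (α / T ^ α) ^ 2 * (8 / α * C₂ ^ 2) * max 1 c ^ 2) * N ^ 2 := by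
        rw [mul_pow, ← ENNReal.ofReal_pow (by positivity), ← ENNReal.ofReal_pow (by positivity),
          ← ENNReal.ofReal_ofNat 2, ← ENNReal.ofReal_mul (by positivity), ← mul_assoc,
          ← mul_assoc, ← ENNReal.ofReal_mul (by positivity), ← ENNReal.ofReal_mul (by positivity)]
        congr 2
        ring
      have e2 : 2 * (ENNReal.ofReal (2 / T ^ α) * (ENNReal.ofReal (8 * C₁ * max 1 c) * N)) ^ 2 =
          ENNReal.ofReal (2 * (2 / T ^ α * (8 * C₁)) ^ 2 * max 1 c ^ 2) * N ^ 2 := by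
        rw [← mul_assoc, mul_pow, ← ENNReal.ofReal_mul (by positivity),
          ← ENNReal.ofReal_pow (by positivity), ← ENNReal.ofReal_ofNat 2, ← mul_assoc,
          ← ENNReal.ofReal_mul (by positivity)]
        congr 2
        ring
      rw [e1, e2, ← add_mul, ← ENNReal.ofReal_add (by positivity) (by positivity), ← add_mul,
        ← hD, mul_pow _ N, ← ENNReal.ofReal_pow (by positivity), mul_pow √D, Real.sq_sqrt hD0])
  rw [ENNReal.coe_toNNReal hcn] at hsecond
  refine (add_le_add hfirst hsecond).trans (le_of_eq ?_)
  rw [← add_mul, ← ENNReal.ofReal_add (by positivity) (by positivity), ← add_mul]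

/-- The weighted norm bound together with the membership in the domain. -/
theorem exists_mem_domGamma_besovNorm_le {T ε η c' : ℝ} {β q : ℝ≥0∞} (hT : 0 < T) (hε : 0 ≤ ε)
    (h0 : 0 < η) (h1 : η < 1 - ε) (hβ0 : 0 < β) (hβ : β ≠ ⊤) (hq : 1 ≤ q) (hq' : q ≠ ⊤)
    (hc' : 0 < c') :
    ∃ C : ℝ, 0 < C ∧
      ∀ (Ω : Type u) [MeasurableSpace Ω] (P : Measure Ω) [IsProbabilityMeasure P]
        (X : ℝ → Ω → ℝ) (ρ : Measure ℝ) [IsProbabilityMeasure ρ] (c : ℝ),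
        IsLevyProcess T X P → SubsetLp T η X P →
        0 < c → SmallBall ε c ρ → TVBound T β ρ.support c' X P →
        ∀ f ∈ interpSpace η q, f ∈ domGamma T X P ρ ∧
          besovNorm T ((1 - (ε + η)) * recip β) q (gradient T X P ρ f) ≤
            ENNReal.ofReal (C * max 1 c) * interpNorm η q f := by
  have hη1 : η ≤ 1 := by linarith
  obtain ⟨C₁, -, hb₁⟩ := exists_gammaDualNorm_le.{u} (β := β) hT hε ⟨h0.le, hη1⟩ hc'
  obtain ⟨C₂, hC₂, hb₂⟩ := exists_besovNorm_gradient_le.{u} (T := T) hε h1 hβ0 hβ hq hq' hc'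
  refine ⟨C₂, hC₂, fun Ω _ P _ X ρ _ c hX hL hc hρ hTV f hf => ?_⟩
  have hf' := (hb₁ Ω P X ρ c hX hL hc hρ hTV).1
    (interpSpace_subset_holderSpace h0.le hη1 hq hq' hf)
  exact ⟨hf', hb₂ Ω P X ρ c hX.measurable hρ hTV f hf'.1⟩

end GradientProcess

end LevyGradient

end

theorem mainTheorem9 (T ε η c' : ℝ) (β : ℝ≥0∞) (hT : 0 < T) (hε : 0 ≤ ε)
    (hη : η ∈ Set.Icc (0 : ℝ) 1) (hβ : 0 < β) (hc' : 0 < c') :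
    -- (1) the bound for the functional on the Hölder space
    (∃ C : ℝ, 0 < C ∧
      ∀ (Ω : Type*) [MeasurableSpace Ω] (P : Measure Ω) [IsProbabilityMeasure P]
        (X : ℝ → Ω → ℝ) (ρ : Measure ℝ) [IsProbabilityMeasure ρ] (c : ℝ),
        LevyGradient.IsLevyProcess T X P → LevyGradient.SubsetLp T η X P →
        0 < c → LevyGradient.SmallBall ε c ρ → LevyGradient.TVBound T β ρ.support c' X P →
        LevyGradient.holderSpace η ⊆ LevyGradient.domGamma T X P ρ ∧
        ∀ t ∈ Set.Ico 0 T,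
          LevyGradient.gammaDualNorm T X P ρ η t ≤
            ENNReal.ofReal (C * max 1 c * LevyGradient.gammaRate ε η β (T - t))) ∧
    -- (2) the weighted norm bound for the gradient
    (∀ (q : ℝ≥0∞) (γ : ℝ), ε < 1 → 0 < η → η < 1 - ε → β ≠ ⊤ → 1 ≤ q → q ≠ ⊤ → 0 < γ →
      ∃ C : ℝ, 0 < C ∧
        ∀ (Ω : Type*) [MeasurableSpace Ω] (P : Measure Ω) [IsProbabilityMeasure P]
          (X : ℝ → Ω → ℝ) (ρ : Measure ℝ) [IsProbabilityMeasure ρ] (c : ℝ),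
          LevyGradient.IsLevyProcess T X P → LevyGradient.SubsetLp T (η + γ) X P →
          0 < c → LevyGradient.SmallBall ε c ρ → LevyGradient.TVBound T β ρ.support c' X P →
          ∀ f ∈ LevyGradient.interpSpace η q,
            f ∈ LevyGradient.domGamma T X P ρ ∧
            LevyGradient.besovNorm T ((1 - (ε + η)) * LevyGradient.recip β) q
                (LevyGradient.gradient T X P ρ f) ≤
              ENNReal.ofReal (C * max 1 c) * LevyGradient.interpNorm η q f) ∧
    -- (3) the resulting bound for the gradient process
    (∀ γ : ℝ, ε < 1 → 0 < η → η < 1 - ε → β ≠ ⊤ → 0 < γ →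
      ∃ C : ℝ, 0 < C ∧
        ∀ (Ω : Type*) [MeasurableSpace Ω] (P : Measure Ω) [IsProbabilityMeasure P] [P.IsComplete]
          (X : ℝ → Ω → ℝ) (ρ : Measure ℝ) [IsProbabilityMeasure ρ] (c : ℝ)
          (hX : LevyGradient.IsLevyProcess T X P), LevyGradient.SubsetLp T (η + γ) X P →
          0 < c → LevyGradient.SmallBall ε c ρ → LevyGradient.TVBound T β ρ.support c' X P →
          ∀ f ∈ LevyGradient.interpSpace η 2,
            (∃ φ : ℝ → Ω → ℝ,
              LevyGradient.IsCadlagVersion T X P (LevyGradient.gradient T X P ρ f) φ) ∧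
            ∀ φ : ℝ → Ω → ℝ,
              LevyGradient.IsCadlagVersion T X P (LevyGradient.gradient T X P ρ f) φ →
              (⨆ a ∈ Set.Ico 0 T,
                  ENNReal.ofReal ((T - a) ^ ((1 - (ε + η)) * LevyGradient.recip β)) *
                    eLpNorm (φ a) ⊤ P) +
                LevyGradient.bmoNorm T (LevyGradient.augmentedFiltration T X P hX.measurable) P
                  (fun t ω => LevyGradient.riemannLiouville T
                    ((1 - (ε + η)) * LevyGradient.recip β) (fun u => φ u ω) t - φ 0 ω) ≤
              ENNReal.ofReal (C * max 1 c) * LevyGradient.interpNorm η 2 f) := by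
  refine ⟨LevyGradient.exists_gammaDualNorm_le hT hε hη hc', ?_, ?_⟩
  · intro q γ _ h0 h1 hβt hq hq' hγ
    obtain ⟨C, hC, h⟩ :=
      LevyGradient.exists_mem_domGamma_besovNorm_le hT hε h0 h1 hβ hβt hq hq' hc'
    exact ⟨C, hC, fun Ω _ P _ X ρ _ c hX hL hc hρ hTV =>
      h Ω P X ρ c hX (hL.mono (by linarith)) hc hρ hTV⟩
  · intro γ _ h0 h1 hβt hγ
    obtain ⟨C, hC, h⟩ := LevyGradient.exists_gradient_process_le hT hε h0 h1 hβ hβt hc'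
    exact ⟨C, hC, fun Ω _ P _ _ X ρ _ c hX hL _ hρ hTV =>
      h Ω P X ρ c hX (hL.mono (by linarith)) hρ hTV⟩
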